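/- Let $\varepsilon\in\{1,-1\}$, let $\langle u,v\rangle=u_1v_1+u_2v_2+u_3v_3+\varepsilon u_4v_4$ on $\mathbb{R}^4$, and let $\mathbb{M}^3(\varepsilon)=\{p:\langle p,p\rangle=\varepsilon\}$ (with $p_4>0$ if $\varepsilon=-1$), i.e. $\mathbb{S}^3$ or $\mathbb{H}^3$. Put $\mathbf{e}_4=(0,0,0,1)$, $B[m,d]=\{p\in\mathbb{M}^3(\varepsilon):\langle p,m\rangle\ge d\}$ and $\mathcal{L}=\{x_1=x_2=0\}\cap\mathbb{M}^3(\varepsilon)$. Let $D_\varepsilon$ be the set of $(H,\delta)$ with $H\ge 0$, $\delta>0$ and, if $\varepsilon=1$, also $\delta<\frac{H+\mu}{2}$, where $\mu=\sqrt{H^2+1}$. For $(H,\delta)\in D_\varepsilon$ let $h(x)=x^2-\varepsilon x^4-(Hx^2-\delta)^2$, let $x_m$ be the smallest positive root of $h$, and let $x:\mathbb{R}\to(0,\infty)$ be the unique nonconstant analytic solution of $x'^2=h(x)/x^2$ with $x(0)=x_m$ (it exists and is unique). Put $\phi(s)=\int_0^s\frac{\delta-Hx^2}{x(1-\varepsilon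 x^2)}\,dt$ and $$\psi(s,\theta)=\big(x\cos\theta,\,-x\sin\theta,\,\sqrt{1-\varepsilon x^2}\,S(\phi),\,\sqrt{1-\varepsilon x^2}\,C(\phi)\big),$$ with $(S,C)=(\sin,\cos)$ if $\varepsilon=1$ and $(S,C)=(\sinh,\cosh)$ if $\varepsilon=-1$. This is the rotational surface $\mathcal{S}(\varepsilon,H,\delta)$ (a spherical nodoid or catenoid if $\varepsilon=1$; a hyperbolic nodoid if $\varepsilon=-1$ and $H>1$). Let $x_4(s)$ be the fourth coordinate of $\psi(s,0)$, and $\Gamma_s$ the geodesic of $\mathbb{M}^3(\varepsilon)$ with initial conditions $\psi(s,0)$, $\psi_s(s,0)$. Proposition. There is a function $\tilde s:D_\varepsilon\to(0,\infty)$ such that, writing $\tilde s=\tilde s(H,\delta)$: 1. For every $(H,\delta)\in D_\varepsilon$ the compact annulus $\mathcal{S}_0=\psi([-\tilde s,\tilde s]\times\mathbb{R}/2\pi\mathbb{Z})$ is embedded, has constant mean curvature $H$, and has free boundary in the geodesic ball $B=B[\mathbf{e}_4,\varepsilon x_4(\tilde s)]$, that is, $\mathcal{S}_0\subset B$ and $\mathcal{S}_0$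 meets $\partial B$ orthogonally along $\partial\mathcal{S}_0\subset\partial B$; moreover $x_4(\tilde s)>0$. For the unit normal for which the mean curvature is $H$ (for one of the two unit normals if $H=0$), the profile curves are curvature lines and their principal curvature is a strictly decreasing function of $s$ on $[0,\tilde s+\eta)$ for some $\eta>0$. 2. The map $(H,\delta)\mapsto\tilde s(H,\delta)$ is real analytic on $D_\varepsilon$. If $\varepsilon=1$, it extends continuously to the boundary curve $\delta=\frac{H+\mu}{2}$, $H\ge0$, with values $$\tilde s\Big(H,\frac{H+\mu}{2}\Big)=\frac{\pi}{2\sqrt{2\mu(H+\mu)}}.$$ 3. For every $(H,\delta)\in D_\varepsilon$ there is a neighbourhood $\mathcal{I}\subset\mathbb{R}$ of $\tilde s$ such that for each $s\in\mathcal{I}$ the axis $\mathcal{L}$ and the geodesic $\Gamma_s$ meet at a unique point $\hat p(s)$ with $\hat p_4(s)>0$. The map $\hat p:\mathcal{I}\to\mathcal{L}$ is analytic, $\hat p_3(\tilde s)=0$ and $\hat p_3'(\tilde s)>0$. -/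

import Mathlib

open Real Set Topology

noncomputable section

namespace RotationalCMC

/-- The underlying vector space of `ℝ⁴_ε`; coordinates `x₁,…,x₄` have indices `0,…,3`. -/
abbrev R4 : Type := Fin 4 → ℝ

/-- The bilinear form `dx₁² + dx₂² + dx₃² + ε dx₄²`. -/
def form (ε : ℝ) (u v : R4) : ℝ := u 0 * v 0 + u 1 * v 1 + u 2 * v 2 + ε * (u 3 * v 3)

/-- The space form `𝕄³(ε)`: the unit sphere `𝕊³` for `ε = 1`, the hyperboloid model of `ℍ³`
for `ε = -1`. -/
def spaceForm (ε : ℝ) : Set R4 := {p | form ε p p = ε ∧ (ε = -1 → 0 < p 3)}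

/-- The point `e₄ = (0,0,0,1)`. -/
def e4 : R4 := ![0, 0, 0, 1]

/-! ### Geodesic balls, geodesics, the rotation axis -/

/-- The set `B[m,d] = {p ∈ 𝕄³(ε) : ⟨p,m⟩ ≥ d}`. -/
def ball (ε : ℝ) (m : R4) (d : ℝ) : Set R4 := {p | p ∈ spaceForm ε ∧ d ≤ form ε p m}

/-- The boundary `S[m,d] = {p ∈ 𝕄³(ε) : ⟨p,m⟩ = d}` of `B[m,d]`. -/
def sphere (ε : ℝ) (m : R4) (d : ℝ) : Set R4 := {p | p ∈ spaceForm ε ∧ form ε p m = d}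

/-- The condition on `m`, `d` for `B[m,d]` to be a geodesic ball with center `m`. -/
def IsGeodesicBall (ε : ℝ) (m : R4) (d : ℝ) : Prop :=
  m ∈ spaceForm ε ∧ (ε = 1 → |d| < 1) ∧ (ε = -1 → d < -1)

/-- `γ` is a geodesic of `𝕄³(ε)`: it lies in `𝕄³(ε)` and its acceleration in `ℝ⁴_ε` is
orthogonal to the tangent spaces `{v : ⟨v, γ t⟩ = 0}` of `𝕄³(ε)`. -/
def IsGeodesic (ε : ℝ) (γ : ℝ → R4) : Prop :=
  ContDiff ℝ 2 γ ∧ (∀ t, γ t ∈ spaceForm ε) ∧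
    ∀ t v, form ε v (γ t) = 0 → form ε (deriv (deriv γ) t) v = 0

/-- The trace of the (complete) geodesic of `𝕄³(ε)` with initial position `p` and initial
velocity `v`. -/
def geodesicTrace (ε : ℝ) (p v : R4) : Set R4 :=
  {q | ∃ γ : ℝ → R4, IsGeodesic ε γ ∧ γ 0 = p ∧ deriv γ 0 = v ∧ ∃ t, γ t = q}

/-- The geodesic `{x₁ = x₂ = 0} ∩ 𝕄³(ε)`. -/
def rotationAxis (ε : ℝ) : Set R4 := {p | p ∈ spaceForm ε ∧ p 0 = 0 ∧ p 1 = 0}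

/-! ### Parametrized surfaces `f(s,θ)` -/

/-- The partial derivative `f_s`. -/
def partialS (f : ℝ → ℝ → R4) (s θ : ℝ) : R4 := deriv (fun t => f t θ) s

/-- The partial derivative `f_θ`. -/
def partialT (f : ℝ → ℝ → R4) (s θ : ℝ) : R4 := deriv (fun t => f s t) θ

/-- `N` is an (analytic) unit normal field, in `𝕄³(ε)`, of the surface `f` on `I × ℝ`. -/
def IsUnitNormal (ε : ℝ) (f N : ℝ → ℝ → R4) (I : Set ℝ) : Prop :=
  AnalyticOnNhd ℝ (fun q : ℝ × ℝ => N q.1 q.2) (I ×ˢ univ) ∧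
  ∀ s ∈ I, ∀ θ, form ε (N s θ) (N s θ) = 1 ∧ form ε (N s θ) (f s θ) = 0 ∧
    form ε (N s θ) (partialS f s θ) = 0 ∧ form ε (N s θ) (partialT f s θ) = 0

/-- The mean curvature `(L G - 2 M F + P E) / (2 (E G - F²))` of `f` with respect to the unit
normal `N`, where `E, F, G` and `L, M, P` are the coefficients of the first and second
fundamental forms. -/
def meanCurvature (ε : ℝ) (f N : ℝ → ℝ → R4) (s θ : ℝ) : ℝ :=
  let E := form ε (partialS f s θ) (partialS f s θ)
  let F := form ε (partialS f s θ) (partialT f s θ)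
  let G := form ε (partialT f s θ) (partialT f s θ)
  let L := form ε (partialS (partialS f) s θ) (N s θ)
  let M := form ε (partialS (partialT f) s θ) (N s θ)
  let P := form ε (partialT (partialT f) s θ) (N s θ)
  (L * G - 2 * M * F + P * E) / (2 * (E * G - F ^ 2))

/-- The `s`-curves are curvature lines on `I × ℝ`, with principal curvature `κ(s)` with respect
to the unit normal `N` (Rodrigues' formula `N_s = -κ f_s`). -/
def IsProfilePrincipalCurvature (f N : ℝ → ℝ → R4) (I : Set ℝ) (κ : ℝ → ℝ) : Prop :=
  ∀ s ∈ I, ∀ θ, partialS N s θ = -(κ s) • partialS f s θ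

/-- `f`, restricted to `[-s₀,s₀] × ℝ/2πℤ`, is a compact embedded (analytic) annulus: it is
well defined on the quotient and an injective immersion there. -/
def IsEmbeddedAnnulus (f : ℝ → ℝ → R4) (s₀ : ℝ) : Prop :=
  0 < s₀ ∧
  (∀ s θ, f s (θ + 2 * π) = f s θ) ∧
  AnalyticOnNhd ℝ (fun q : ℝ × ℝ => f q.1 q.2) (Icc (-s₀) s₀ ×ˢ univ) ∧
  (∀ s ∈ Icc (-s₀) s₀, ∀ θ, LinearIndependent ℝ ![partialS f s θ, partialT f s θ]) ∧
  ∀ s ∈ Icc (-s₀) s₀, ∀ s' ∈ Icc (-s₀) s₀, ∀ θ θ' : ℝ, f s θ = f s' θ' →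
    s = s' ∧ (θ : Real.Angle) = (θ' : Real.Angle)

/-- At the point `f(s,θ)` the surface `f` and the totally umbilic sphere `S[m,d]` through that
point are orthogonal in `𝕄³(ε)`: every normal vector `n` of the former is orthogonal to every
normal vector `ν` of the latter, whose tangent plane is `{v : ⟨v, f(s,θ)⟩ = ⟨v, m⟩ = 0}`. -/
def MeetsOrthogonally (ε : ℝ) (f : ℝ → ℝ → R4) (s θ : ℝ) (m : R4) : Prop :=
  ∀ n ν : R4,
    form ε n (f s θ) = 0 → form ε n (partialS f s θ) = 0 → form ε n (partialT f s θ) = 0 →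
    form ε ν (f s θ) = 0 →
    (∀ v, form ε v (f s θ) = 0 → form ε v m = 0 → form ε ν v = 0) →
    form ε n ν = 0

/-- The annulus `f([-s₀,s₀] × ℝ/2πℤ)` has free boundary in the geodesic ball `B[m,d]`: it is
contained in the ball, and it meets the boundary sphere orthogonally along its two boundary
curves. -/
def HasFreeBoundary (ε : ℝ) (f : ℝ → ℝ → R4) (s₀ : ℝ) (m : R4) (d : ℝ) : Prop :=
  IsGeodesicBall ε m d ∧
  (∀ s ∈ Icc (-s₀) s₀, ∀ θ, f s θ ∈ ball ε m d) ∧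
  ∀ s, s = -s₀ ∨ s = s₀ → ∀ θ, f s θ ∈ sphere ε m d ∧ MeetsOrthogonally ε f s θ m

/-! ### The rotational surfaces `𝒮(ε,H,δ)` -/

/-- `μ = √(H² + ε)`. -/
def mu (ε H : ℝ) : ℝ := √(H ^ 2 + ε)

/-- The polynomial `h(x) = x² - ε x⁴ - (H x² - δ)²`. -/
def hPoly (ε H δ r : ℝ) : ℝ := r ^ 2 - ε * r ^ 4 - (H * r ^ 2 - δ) ^ 2

/-- `x` is a nonconstant (positive) analytic solution of `x'² = h(x)/x²`, with `x(0)` the smallest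
positive root of `h`. -/
def IsProfile (ε H δ : ℝ) (x : ℝ → ℝ) : Prop :=
  AnalyticOnNhd ℝ x univ ∧ (∀ s, 0 < x s) ∧
  (∀ s, (deriv x s) ^ 2 = hPoly ε H δ (x s) / (x s) ^ 2) ∧
  IsLeast {r | 0 < r ∧ hPoly ε H δ r = 0} (x 0) ∧
  ∃ s, x s ≠ x 0

/-- The solution `x(s)`. -/
def profile (ε H δ : ℝ) : ℝ → ℝ := Classical.epsilon (IsProfile ε H δ)

/-- `φ(s) = ∫₀ˢ (δ - H x²) / (x (1 - ε x²))`. -/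
def phase (ε H δ s : ℝ) : ℝ :=
  ∫ t in (0 : ℝ)..s, (δ - H * profile ε H δ t ^ 2) /
    (profile ε H δ t * (1 - ε * profile ε H δ t ^ 2))

/-- The surface `ψ(s,θ)`, written with trigonometric functions of `φ` in `𝕊³` and hyperbolic
functions of `φ` in `ℍ³`. -/
def psi (ε H δ : ℝ) (s θ : ℝ) : R4 :=
  ![profile ε H δ s * cos θ,
    -(profile ε H δ s * sin θ),
    √(1 - ε * profile ε H δ s ^ 2) *
      (if ε = 1 then sin (phase ε H δ s) else sinh (phase ε H δ s)),
    √(1 - ε * profile ε H δ s ^ 2) *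
      (if ε = 1 then cos (phase ε H δ s) else cosh (phase ε H δ s))]

/-- The fourth coordinate `x₄(s)` of the profile curve `ψ(s,0)`. -/
def x4 (ε H δ s : ℝ) : ℝ := psi ε H δ s 0 3

/-- The parameters `(H,δ)` with `H ≥ 0`, `δ > 0` and, in `𝕊³`, `δ < (H + μ)/2`. -/
def params (ε : ℝ) : Set (ℝ × ℝ) :=
  {p | 0 ≤ p.1 ∧ 0 < p.2 ∧ (ε = 1 → p.2 < (p.1 + mu ε p.1) / 2)}

/-- `q` is a point with positive fourth coordinate in which the rotation axis meets the geodesic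
`Γ_s` with initial conditions `ψ(s,0)`, `ψ_s(s,0)`. -/
def IsAxisPoint (ε H δ s : ℝ) (q : R4) : Prop :=
  q ∈ rotationAxis ε ∧
  q ∈ geodesicTrace ε (psi ε H δ s 0) (partialS (psi ε H δ) s 0) ∧ 0 < q 3

end RotationalCMC

end

/-! Put u = x² and c = H² + ε. The profile equation becomes (u'/2)² = q(u) with q(u) = -c u² + (1 +
2Hδ) u - δ², so u'' is affine in u and u = u_min + D sn², where D² is the discriminant of q and sn
solves y'' = -c y with y(0) = 0, y'(0) = 1. Only the angle φ remains an integral; it is analytic in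
(H, δ, D, s). Everything takes place on the half period around 0, where cn > 0 and u increases with
|s|.

Rodrigues' formula N_s = -κ ψ_s holds with κ = H + δ/x². It yields the mean curvature H, and κ
decreases because x² increases. The free boundary condition is governed by `cross` = x₁x₃' - x₁'x₃:
where it vanishes and x' ≠ 0, the vector x ψ_s - x' ψ is a nonzero multiple of e₄, so every normal
of the surface is orthogonal to e₄ and is tangent to the sphere about e₄. The fourth coordinate of N
is -ε `cross`, so Rodrigues gives `cross`' = ε κ x₄' (`hasDerivAt_cross`). As long as δ - H x² > 0
and, in the sphere, φ < π/2 (`InRegion`), ε x₄' is negative. Hence `cross` is strictly decreasing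
there and has at most one zero, which is simple. The monotonicity of ε x₄ also puts the annulus
inside the ball; embeddedness follows from the monotonicity of x² in |s| and the sign of x₃.

For existence, `cross` is positive at the waist s = 0, and one needs a point where it is negative.
If φ reaches π/2 in the sphere, this happens there. If x² reaches δ/H, it happens there too; this
covers δ < H in the sphere and H > 0 in hyperbolic space. For H = 0 in hyperbolic space the growth
of x decides. For δ ≥ H in the sphere, φ plus the angle of the tangent is compared with an explicit
primitive of δ/x² that tends to π/2 at the end of the half period.

Analytic dependence is the implicit function theorem at the simple zero, combined with uniqueness in
the region. At the flat tori D = 0 the function `cross` is a positive constant times the cosine of a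
linear function, and its sign change at the first zero persists for nearby parameters. Finally, the
third coordinate of the axis point is -`cross` divided by a positive norm, so its behaviour at the
free boundary parameter is read off from `cross`. -/

namespace RotationalCMC

/-! ### Solutions of `y'' = -c y` -/

/-- The endomorphism `(a, b) ↦ (b, -c a)` of the plane. -/
def oscillator (c : ℝ) : (ℝ × ℝ) →L[ℝ] (ℝ × ℝ) :=
  (ContinuousLinearMap.inl ℝ ℝ ℝ).comp (ContinuousLinearMap.snd ℝ ℝ ℝ) +
    c • -((ContinuousLinearMap.inr ℝ ℝ ℝ).comp (ContinuousLinearMap.fst ℝ ℝ ℝ))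

/-- The solution of `y'' = -c y` with `y(0) = 0`, `y'(0) = 1`. -/
noncomputable def sn (c t : ℝ) : ℝ := (NormedSpace.exp (t • oscillator c) (0, 1)).1

/-- The solution of `y'' = -c y` with `y(0) = 1`, `y'(0) = 0`. -/
noncomputable def cn (c t : ℝ) : ℝ := (NormedSpace.exp (t • oscillator c) (1, 0)).1

theorem oscillator_apply (c a b : ℝ) : oscillator c (a, b) = (b, -(c * a)) := by
  simp [oscillator]

/-- The exponential gives joint analyticity in (c, t) for all signs of c at once. In hyperbolic
space c = H² - 1 changes sign at H = 1, where a definition by cases (sine, identity, hyperbolic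
sine) would have to be glued. -/
theorem analyticAt_exp_oscillator (q : ℝ × ℝ) :
    AnalyticAt ℝ (fun q : ℝ × ℝ => NormedSpace.exp (q.2 • oscillator q.1)) q := by
  refine (NormedSpace.exp_analytic (𝕂 := ℝ) (q.2 • oscillator q.1)).comp_of_eq
    (f := fun q : ℝ × ℝ => q.2 • oscillator q.1) ?_ rfl
  refine analyticAt_snd.smul ?_
  exact analyticAt_const.add (analyticAt_fst.smul analyticAt_const)

theorem analyticAt_exp_oscillator_apply (v : ℝ × ℝ) (q : ℝ × ℝ) :
    AnalyticAt ℝ (fun q : ℝ × ℝ => (NormedSpace.exp (q.2 • oscillator q.1) v).1) q := by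
  have h := ((ContinuousLinearMap.fst ℝ ℝ ℝ).comp
    (ContinuousLinearMap.apply ℝ (ℝ × ℝ) v)).analyticAt
    (NormedSpace.exp (q.2 • oscillator q.1))
  exact h.comp_of_eq (analyticAt_exp_oscillator q) rfl

theorem analyticAt_sn_uncurry (q : ℝ × ℝ) : AnalyticAt ℝ (fun q : ℝ × ℝ => sn q.1 q.2) q :=
  analyticAt_exp_oscillator_apply (0, 1) q

theorem analyticAt_cn_uncurry (q : ℝ × ℝ) : AnalyticAt ℝ (fun q : ℝ × ℝ => cn q.1 q.2) q :=
  analyticAt_exp_oscillator_apply (1, 0) q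

theorem hasDerivAt_exp_oscillator_apply (c t : ℝ) (v : ℝ × ℝ) :
    HasDerivAt (fun t : ℝ => (NormedSpace.exp (t • oscillator c) v).1)
      (NormedSpace.exp (t • oscillator c) (oscillator c v)).1 t := by
  have h := hasDerivAt_exp_smul_const (𝕂 := ℝ) (oscillator c) t
  have h2 := ((ContinuousLinearMap.fst ℝ ℝ ℝ).comp
    (ContinuousLinearMap.apply ℝ (ℝ × ℝ) v)).hasFDerivAt.comp_hasDerivAt t h
  exact h2

theorem hasDerivAt_sn (c t : ℝ) : HasDerivAt (sn c) (cn c t) t := by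
  have h := hasDerivAt_exp_oscillator_apply c t (0, 1)
  rw [oscillator_apply, mul_zero, neg_zero] at h
  exact h

theorem hasDerivAt_cn (c t : ℝ) : HasDerivAt (cn c) (-(c * sn c t)) t := by
  have h := hasDerivAt_exp_oscillator_apply c t (1, 0)
  rw [oscillator_apply] at h
  have e : ((0 : ℝ), -(c * 1)) = (-c) • ((0 : ℝ), (1 : ℝ)) := by simp
  rw [e, map_smul, Prod.smul_fst, smul_eq_mul, neg_mul] at h
  exact h

@[simp] theorem sn_zero (c : ℝ) : sn c 0 = 0 := by simp [sn]

@[simp] theorem cn_zero (c : ℝ) : cn c 0 = 1 := by simp [cn]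

theorem eq_of_forall_hasDerivAt_zero {f : ℝ → ℝ} (h : ∀ t, HasDerivAt f 0 t) (t : ℝ) :
    f t = f 0 :=
  is_const_of_deriv_eq_zero (fun t => (h t).differentiableAt) (fun t => (h t).deriv) t 0

theorem cn_sq_add (c t : ℝ) : cn c t ^ 2 + c * sn c t ^ 2 = 1 := by
  have := eq_of_forall_hasDerivAt_zero (f := fun t => cn c t ^ 2 + c * sn c t ^ 2) (fun t => by
    have h := ((hasDerivAt_cn c t).pow 2).add (((hasDerivAt_sn c t).pow 2).const_mul c)
    convert! h using 1
    simp; ring) t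
  simpa using this

/-- Every solution of `y' = z`, `z' = -c y` is the expected combination of `cn` and `sn`. -/
theorem eq_cn_add_sn {c : ℝ} {y z : ℝ → ℝ} (hy : ∀ t, HasDerivAt y (z t) t)
    (hz : ∀ t, HasDerivAt z (-(c * y t)) t) (t : ℝ) :
    y t = y 0 * cn c t + z 0 * sn c t ∧ z t = z 0 * cn c t - c * y 0 * sn c t := by
  -- Transporting (y, z) back to time 0 by the inverse flow gives two constants of motion, this one
  -- and `h2`.
  have h1 := eq_of_forall_hasDerivAt_zero (f := fun t => y t * cn c t - z t * sn c t) (fun t => by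
    convert! ((hy t).mul (hasDerivAt_cn c t)).sub ((hz t).mul (hasDerivAt_sn c t)) using 1
    ring) t
  have h2 := eq_of_forall_hasDerivAt_zero (f := fun t => c * (y t * sn c t) + z t * cn c t)
    (fun t => by
    convert! (((hy t).mul (hasDerivAt_sn c t)).const_mul c).add
      ((hz t).mul (hasDerivAt_cn c t)) using 1
    ring) t
  simp only [sn_zero, cn_zero] at h1 h2
  have h3 := cn_sq_add c t
  constructor
  · linear_combination cn c t * h1 + sn c t * h2 - y t * h3
  · linear_combination cn c t * h2 - c * sn c t * h1 - z t * h3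

theorem sn_cn_eq_of_hasDerivAt {c : ℝ} {y z : ℝ → ℝ} (hy : ∀ t, HasDerivAt y (z t) t)
    (hz : ∀ t, HasDerivAt z (-(c * y t)) t) (h0 : y 0 = 0) (h1 : z 0 = 1) (t : ℝ) :
    sn c t = y t ∧ cn c t = z t := by
  have := eq_cn_add_sn hy hz t
  simp only [h0, h1] at this
  constructor <;> linarith [this.1, this.2]

theorem neg_sn_cn_neg (c t : ℝ) : sn c t = -sn c (-t) ∧ cn c t = cn c (-t) := by
  refine sn_cn_eq_of_hasDerivAt (c := c) (y := fun t => -sn c (-t)) (z := fun t => cn c (-t))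
    (fun t => ?_) (fun t => ?_) (by simp) (by simp) t
  · convert! ((hasDerivAt_sn c (-t)).comp t (hasDerivAt_neg t)).neg using 1
    ring
  · convert! (hasDerivAt_cn c (-t)).comp t (hasDerivAt_neg t) using 1
    ring

theorem sn_neg (c t : ℝ) : sn c (-t) = -sn c t := by linarith [(neg_sn_cn_neg c t).1]

theorem cn_neg (c t : ℝ) : cn c (-t) = cn c t := (neg_sn_cn_neg c t).2.symm

theorem sn_cn_of_pos {c : ℝ} (hc : 0 < c) (t : ℝ) :
    sn c t = sin (√c * t) / √c ∧ cn c t = cos (√c * t) := by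
  have h0 : √c ≠ 0 := (sqrt_pos.2 hc).ne'
  have hs : √c ^ 2 = c := sq_sqrt hc.le
  have hl : ∀ t, HasDerivAt (fun t => √c * t) √c t := fun t => by
    simpa using (hasDerivAt_id t).const_mul √c
  refine sn_cn_eq_of_hasDerivAt (y := fun t => sin (√c * t) / √c) (z := fun t => cos (√c * t))
    (fun t => ?_) (fun t => ?_) (by simp) (by simp) t
  · convert! ((hl t).sin).div_const √c using 1
    field_simp
  · convert! (hl t).cos using 1
    field_simp
    rw [hs]

theorem sn_cn_zero_left (t : ℝ) : sn 0 t = t ∧ cn 0 t = 1 :=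
  sn_cn_eq_of_hasDerivAt (y := fun t => t) (z := fun _ => 1)
    (fun t => hasDerivAt_id t) (fun t => by simpa using hasDerivAt_const t (1 : ℝ)) rfl rfl t

theorem sn_cn_of_neg {c : ℝ} (hc : c < 0) (t : ℝ) :
    sn c t = sinh (√(-c) * t) / √(-c) ∧ cn c t = cosh (√(-c) * t) := by
  have hc' : 0 < -c := by linarith
  have h0 : √(-c) ≠ 0 := (sqrt_pos.2 hc').ne'
  have hs : √(-c) ^ 2 = -c := sq_sqrt hc'.le
  have hl : ∀ t, HasDerivAt (fun t => √(-c) * t) √(-c) t := fun t => by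
    simpa using (hasDerivAt_id t).const_mul √(-c)
  refine sn_cn_eq_of_hasDerivAt (y := fun t => sinh (√(-c) * t) / √(-c))
    (z := fun t => cosh (√(-c) * t)) (fun t => ?_) (fun t => ?_) (by simp) (by simp) t
  · convert! ((hl t).sinh).div_const √(-c) using 1
    field_simp
  · convert! (hl t).cosh using 1
    field_simp
    rw [hs]; ring

/-! ### The half period -/

/-- The interval around `0` on which `cn c` is positive. -/
def halfPeriod (c : ℝ) : Set ℝ := {t | c * t ^ 2 < π ^ 2 / 4}

theorem zero_mem_halfPeriod (c : ℝ) : (0 : ℝ) ∈ halfPeriod c := by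
  have := pi_pos
  simp only [halfPeriod, mem_ofPred_eq]
  nlinarith [sq_nonneg π, mul_pos this this]

theorem neg_mem_halfPeriod {c t : ℝ} (h : t ∈ halfPeriod c) : -t ∈ halfPeriod c := by
  simpa [halfPeriod] using h

theorem isOpen_halfPeriod (c : ℝ) : IsOpen (halfPeriod c) :=
  isOpen_lt (by fun_prop) (by fun_prop)

theorem mem_halfPeriod_of_sq_le {c s t : ℝ} (hs : s ∈ halfPeriod c) (h : t ^ 2 ≤ s ^ 2) :
    t ∈ halfPeriod c := by
  have h0 := zero_mem_halfPeriod c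
  simp only [halfPeriod, mem_ofPred_eq] at *
  rcases le_or_gt 0 c with hc | hc
  · exact lt_of_le_of_lt (mul_le_mul_of_nonneg_left h hc) hs
  · nlinarith [sq_nonneg t]

theorem mem_halfPeriod_of_mem_Icc {c s t : ℝ} (hs : s ∈ halfPeriod c) (h : t ∈ Icc (-s) s) :
    t ∈ halfPeriod c :=
  mem_halfPeriod_of_sq_le hs (sq_le_sq' h.1 h.2)

theorem ordConnected_halfPeriod (c : ℝ) : (halfPeriod c).OrdConnected := by
  refine ⟨fun a ha b hb t ht => ?_⟩
  rcases le_total 0 t with h | h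
  · exact mem_halfPeriod_of_sq_le hb (by nlinarith [ht.2])
  · exact mem_halfPeriod_of_sq_le ha (by nlinarith [ht.1])

theorem abs_lt_of_mem_halfPeriod {c t : ℝ} (hc : 0 < c) (ht : t ∈ halfPeriod c) :
    |√c * t| < π / 2 := by
  apply abs_lt_of_sq_lt_sq _ (by positivity)
  rw [mul_pow, sq_sqrt hc.le]
  simp only [halfPeriod, mem_ofPred_eq] at ht
  nlinarith

theorem cn_pos {c t : ℝ} (ht : t ∈ halfPeriod c) : 0 < cn c t := by
  rcases lt_trichotomy c 0 with hc | rfl | hc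
  · rw [(sn_cn_of_neg hc t).2]; exact cosh_pos _
  · rw [(sn_cn_zero_left t).2]; exact one_pos
  · rw [(sn_cn_of_pos hc t).2]
    have := abs_lt.1 (abs_lt_of_mem_halfPeriod hc ht)
    exact cos_pos_of_mem_Ioo ⟨by linarith [this.1], this.2⟩

theorem sn_pos {c t : ℝ} (ht : t ∈ halfPeriod c) (h0 : 0 < t) : 0 < sn c t := by
  have hm : StrictMonoOn (sn c) (Icc 0 t) := by
    refine strictMonoOn_of_deriv_pos (convex_Icc 0 t)
      (fun x _ => (hasDerivAt_sn c x).continuousAt.continuousWithinAt) (fun x hx => ?_)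
    rw [interior_Icc] at hx
    rw [(hasDerivAt_sn c x).deriv]
    exact cn_pos (mem_halfPeriod_of_mem_Icc ht ⟨by linarith [hx.1], hx.2.le⟩)
  simpa using hm (left_mem_Icc.2 h0.le) (right_mem_Icc.2 h0.le) h0

/-- This is used to reach a prescribed value of x² inside the half period. For c > 0 the strict
bound y < 1/√c keeps the time before the quarter turn of the sine; for c ≤ 0 the function is
unbounded and the half period is the whole line. -/
theorem exists_sn_eq {c y : ℝ} (hy : 0 ≤ y) (h : c * y ^ 2 < 1) :
    ∃ t ∈ halfPeriod c, 0 ≤ t ∧ sn c t = y := by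
  rcases lt_trichotomy c 0 with hc | rfl | hc
  · have h0 : 0 < √(-c) := sqrt_pos.2 (by linarith)
    refine ⟨arsinh (√(-c) * y) / √(-c), ?_, ?_, ?_⟩
    · have := zero_mem_halfPeriod c
      simp only [halfPeriod, mem_ofPred_eq] at *
      nlinarith [sq_nonneg (arsinh (√(-c) * y) / √(-c))]
    · exact div_nonneg (arsinh_nonneg_iff.2 (by positivity)) h0.le
    · rw [(sn_cn_of_neg hc _).1, mul_div_cancel₀ _ h0.ne', sinh_arsinh]
      field_simp
  · refine ⟨y, ?_, hy, (sn_cn_zero_left y).1⟩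
    have := zero_mem_halfPeriod 0
    simpa [halfPeriod] using this
  · have h0 : 0 < √c := sqrt_pos.2 hc
    have h1 : √c * y < 1 := by
      apply lt_of_pow_lt_pow_left₀ 2 (by norm_num)
      rw [mul_pow, sq_sqrt hc.le, one_pow]; exact h
    have h2 : 0 ≤ √c * y := by positivity
    refine ⟨arcsin (√c * y) / √c, ?_, ?_, ?_⟩
    · have h3 : arcsin (√c * y) < π / 2 := arcsin_lt_pi_div_two.2 h1
      have h4 : 0 ≤ arcsin (√c * y) := arcsin_nonneg.2 h2
      simp only [halfPeriod, mem_ofPred_eq]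
      rw [div_pow, sq_sqrt hc.le, mul_div_cancel₀ _ hc.ne']
      nlinarith
    · exact div_nonneg (arcsin_nonneg.2 h2) h0.le
    · rw [(sn_cn_of_pos hc _).1, mul_div_cancel₀ _ h0.ne', sin_arcsin (by linarith) h1.le]
      field_simp

/-! ### Integrals of analytic functions depending on parameters -/

section ParametricIntegral

variable {E : Type*} [NormedAddCommGroup E] [NormedSpace ℝ E]

/-- The linear map `(y, t) ↦ (y, τ t)`. -/
noncomputable def scaleSnd (E : Type*) [NormedAddCommGroup E] [NormedSpace ℝ E] (τ : ℝ) :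
    (E × ℝ) →L[ℝ] (E × ℝ) :=
  (ContinuousLinearMap.inl ℝ E ℝ).comp (ContinuousLinearMap.fst ℝ E ℝ) +
    τ • (ContinuousLinearMap.inr ℝ E ℝ).comp (ContinuousLinearMap.snd ℝ E ℝ)

theorem scaleSnd_apply (τ : ℝ) (v : E × ℝ) : scaleSnd E τ v = (v.1, τ * v.2) := by
  simp [scaleSnd]

theorem norm_scaleSnd_apply_le {τ : ℝ} (hτ : τ ∈ Icc (0 : ℝ) 1) (v : E × ℝ) :
    ‖scaleSnd E τ v‖ ≤ ‖v‖ := by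
  rw [scaleSnd_apply, Prod.norm_mk, Prod.norm_def]
  refine max_le_max le_rfl ?_
  rw [norm_mul, Real.norm_of_nonneg hτ.1]
  exact mul_le_of_le_one_left (norm_nonneg _) hτ.2

theorem norm_scaleSnd_le {τ : ℝ} (hτ : τ ∈ Icc (0 : ℝ) 1) : ‖scaleSnd E τ‖ ≤ 1 :=
  ContinuousLinearMap.opNorm_le_bound _ zero_le_one fun v => by
    simpa using norm_scaleSnd_apply_le hτ v

theorem continuous_compContinuousLinearMap_scaleSnd {n : ℕ}
    (g : ContinuousMultilinearMap ℝ (fun _ : Fin n => E × ℝ) ℝ) :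
    Continuous fun τ : ℝ => g.compContinuousLinearMap fun _ => scaleSnd E τ := by
  have h : Continuous fun τ : ℝ => (fun _ : Fin n => scaleSnd E τ) := by
    refine continuous_pi fun _ => ?_
    unfold scaleSnd
    fun_prop
  exact (ContinuousMultilinearMap.compContinuousLinearMapLRight (E := fun _ : Fin n => E × ℝ)
    g).cont.comp h

/-- The power series of `(y, t) ↦ ∫ τ in 0..1, F (y, τ t)`, in terms of that of `F`. -/
noncomputable def averagedSeries (p : FormalMultilinearSeries ℝ (E × ℝ) ℝ) :
    FormalMultilinearSeries ℝ (E × ℝ) ℝ :=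
  fun n => ∫ τ in (0 : ℝ)..1, (p n).compContinuousLinearMap fun _ => scaleSnd E τ

/-- Scaling the second variable by τ ∈ [0, 1] is a contraction, so averaging does not shrink the
radius of convergence. -/
theorem norm_averagedSeries_le (p : FormalMultilinearSeries ℝ (E × ℝ) ℝ) (n : ℕ) :
    ‖averagedSeries p n‖ ≤ ‖p n‖ := by
  have h : ∀ τ ∈ uIoc (0 : ℝ) 1,
      ‖(p n).compContinuousLinearMap fun _ => scaleSnd E τ‖ ≤ ‖p n‖ := by
    intro τ hτ
    rw [uIoc_of_le zero_le_one] at hτ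
    refine (ContinuousMultilinearMap.norm_compContinuousLinearMap_le _ _).trans ?_
    refine mul_le_of_le_one_right (norm_nonneg _) ?_
    exact Finset.prod_le_one (fun _ _ => norm_nonneg _)
      fun _ _ => norm_scaleSnd_le (Ioc_subset_Icc_self hτ)
  have h2 := intervalIntegral.norm_integral_le_of_norm_le_const h
  rwa [sub_zero, abs_one, mul_one] at h2

theorem averagedSeries_apply (p : FormalMultilinearSeries ℝ (E × ℝ) ℝ) (n : ℕ) (v : E × ℝ) :
    averagedSeries p n (fun _ => v) = ∫ τ in (0 : ℝ)..1, p n fun _ => scaleSnd E τ v := by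
  have h := (ContinuousMultilinearMap.apply ℝ (fun _ : Fin n => E × ℝ) ℝ
    (fun _ => v)).intervalIntegral_comp_comm
    ((continuous_compContinuousLinearMap_scaleSnd (p n)).intervalIntegrable (μ :=
      MeasureTheory.volume) 0 1)
  exact h.symm

/-- The series is integrated term by term, dominated by ∑ ‖p n‖ ‖v‖ⁿ, uniformly in τ. -/
theorem hasSum_averagedSeries {F : E × ℝ → ℝ} {p : FormalMultilinearSeries ℝ (E × ℝ) ℝ}
    {z : E × ℝ} {r : ENNReal} (hF : HasFPowerSeriesOnBall F p z r) {v : E × ℝ}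
    (hv : v ∈ Metric.eball (0 : E × ℝ) r) :
    HasSum (fun n => averagedSeries p n fun _ => v)
      (∫ τ in (0 : ℝ)..1, F (z + scaleSnd E τ v)) := by
  simp only [averagedSeries_apply]
  rw [Metric.mem_eball, edist_zero_right] at hv
  have hsum : Summable fun n => ‖p n‖ * ‖v‖ ^ n :=
    p.summable_norm_mul_pow (r := ‖v‖₊) (lt_of_lt_of_le hv hF.r_le)
  have hmeas : ∀ n, MeasureTheory.AEStronglyMeasurable (fun τ => p n fun _ => scaleSnd E τ v)
      (MeasureTheory.volume.restrict (uIoc (0 : ℝ) 1)) := by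
    intro n
    refine Continuous.aestronglyMeasurable ?_
    refine (p n).cont.comp (continuous_pi fun _ => ?_)
    simp only [scaleSnd_apply]
    fun_prop
  have hbound : ∀ n, ∀ τ ∈ uIoc (0 : ℝ) 1,
      ‖p n fun _ => scaleSnd E τ v‖ ≤ ‖p n‖ * ‖v‖ ^ n := by
    intro n τ hτ
    rw [uIoc_of_le zero_le_one] at hτ
    refine ((p n).le_opNorm _).trans (mul_le_mul_of_nonneg_left ?_ (norm_nonneg _))
    simp only [Finset.prod_const, Finset.card_univ, Fintype.card_fin]
    exact pow_le_pow_left₀ (norm_nonneg _) (norm_scaleSnd_apply_le (Ioc_subset_Icc_self hτ) v) n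
  have hlim : ∀ τ ∈ uIoc (0 : ℝ) 1,
      HasSum (fun n => p n fun _ => scaleSnd E τ v) (F (z + scaleSnd E τ v)) := by
    intro τ hτ
    rw [uIoc_of_le zero_le_one] at hτ
    refine hF.hasSum ?_
    rw [Metric.mem_eball, edist_zero_right]
    refine lt_of_le_of_lt ?_ hv
    rw [← ofReal_norm, ← ofReal_norm]
    exact ENNReal.ofReal_le_ofReal (norm_scaleSnd_apply_le (Ioc_subset_Icc_self hτ) v)
  exact intervalIntegral.hasSum_integral_of_dominated_convergence
    (fun n _ => ‖p n‖ * ‖v‖ ^ n) hmeas (fun n => Filter.Eventually.of_forall (hbound n))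
    (Filter.Eventually.of_forall fun _ _ => hsum) intervalIntegrable_const
    (Filter.Eventually.of_forall hlim)

theorem hasFPowerSeriesOnBall_averaged {F : E × ℝ → ℝ} {p : FormalMultilinearSeries ℝ (E × ℝ) ℝ}
    {z : E × ℝ} {r : ENNReal} (hF : HasFPowerSeriesOnBall F p z r) :
    HasFPowerSeriesOnBall (fun w : E × ℝ => ∫ τ in (0 : ℝ)..1, F (z + scaleSnd E τ (w - z)))
      (averagedSeries p) z r where
  r_le := hF.r_le.trans (FormalMultilinearSeries.radius_le_of_le (norm_averagedSeries_le p))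
  r_pos := hF.r_pos
  hasSum := by
    intro v hv
    simpa only [add_sub_cancel_left] using hasSum_averagedSeries hF hv

/-- The substitution t = t₀ + τ (w.2 - t₀) turns the integral into w.2 - t₀ times an average over τ
∈ [0, 1], whose power series is known. -/
theorem analyticAt_integral_of_base {F : E × ℝ → ℝ} {y₀ : E} {t₀ : ℝ}
    (hF : AnalyticAt ℝ F (y₀, t₀)) :
    AnalyticAt ℝ (fun w : E × ℝ => ∫ t in t₀..w.2, F (w.1, t)) (y₀, t₀) := by
  obtain ⟨p, r, hp⟩ := hF
  have h := (hasFPowerSeriesOnBall_averaged hp).analyticAt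
  have h2 : AnalyticAt ℝ (fun w : E × ℝ => w.2 - t₀) (y₀, t₀) :=
    analyticAt_snd.sub analyticAt_const
  refine (h2.mul h).congr (Filter.Eventually.of_forall fun w => ?_)
  have e := intervalIntegral.smul_integral_comp_add_mul (a := 0) (b := 1)
    (fun t => F (w.1, t)) (w.2 - t₀) t₀
  simp only [smul_eq_mul, mul_zero, add_zero, mul_one, add_sub_cancel] at e
  simp only [Pi.mul_apply, ← e, scaleSnd_apply]
  congr 1
  refine intervalIntegral.integral_congr fun τ _ => ?_
  simp [mul_comm]

theorem eventually_continuousAt_of_analyticAt {F : E × ℝ → ℝ} {y₀ : E} {t₀ : ℝ}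
    (hF : AnalyticAt ℝ F (y₀, t₀)) :
    ∃ e > 0, ∀ᶠ y in 𝓝 y₀, ∀ t ∈ Metric.ball t₀ e, ContinuousAt (fun t => F (y, t)) t := by
  obtain ⟨e, he, h⟩ := Metric.eventually_nhds_iff_ball.1 hF.eventually_continuousAt
  refine ⟨e, he, ?_⟩
  filter_upwards [Metric.ball_mem_nhds y₀ he] with y hy t ht
  have : (y, t) ∈ Metric.ball (y₀, t₀) e := by
    rw [← ball_prod_same]; exact ⟨hy, ht⟩
  exact ContinuousAt.comp (f := fun t : ℝ => (y, t)) (h _ this) (by fun_prop)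

/-- The integral of an analytic function over an interval along which it is analytic depends
analytically on the parameters and on the upper limit. -/
theorem analyticAt_integral {F : E × ℝ → ℝ} {y₀ : E} {s : Set ℝ} (hs : IsPreconnected s)
    (hF : ∀ t ∈ s, AnalyticAt ℝ F (y₀, t)) {a b : ℝ} (ha : a ∈ s) (hb : b ∈ s) :
    AnalyticAt ℝ (fun w : E × ℝ => ∫ t in a..w.2, F (w.1, t)) (y₀, b) := by
  -- The local statement is propagated along the preconnected set by chaining short intervals.
  -- Integrability for nearby parameters belongs to the relation because adding adjacent integrals
  -- requires it.
  let P : ℝ → ℝ → Prop := fun a b =>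
    AnalyticAt ℝ (fun y => ∫ t in a..b, F (y, t)) y₀ ∧
      ∀ᶠ y in 𝓝 y₀, IntervalIntegrable (fun t => F (y, t)) MeasureTheory.volume a b
  have hint : ∀ t₀ ∈ s, ∃ e > 0, ∀ᶠ y in 𝓝 y₀, ∀ t ∈ Metric.ball t₀ e,
      IntervalIntegrable (fun t => F (y, t)) MeasureTheory.volume t₀ t := by
    intro t₀ ht₀
    obtain ⟨e, he, h⟩ := eventually_continuousAt_of_analyticAt (hF t₀ ht₀)
    refine ⟨e, he, ?_⟩
    filter_upwards [h] with y hy t ht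
    refine ContinuousOn.intervalIntegrable fun u hu => (hy u ?_).continuousWithinAt
    rw [Real.ball_eq_Ioo] at ht ⊢
    exact (ordConnected_Ioo.uIcc_subset (by constructor <;> linarith) ht) hu
  have hP : P a b := by
    refine hs.induction₂ P (fun t₀ ht₀ => ?_) ?_ ?_ ha hb
    · obtain ⟨e, he, h⟩ := hint t₀ ht₀
      refine nhdsWithin_le_nhds ?_
      have h1 := (analyticAt_integral_of_base (hF t₀ ht₀)).eventually_analyticAt
      have h2 : Filter.Tendsto (fun t : ℝ => (y₀, t)) (𝓝 t₀) (𝓝 (y₀, t₀)) :=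
        Continuous.tendsto (by fun_prop) t₀
      filter_upwards [h2.eventually h1, Metric.ball_mem_nhds t₀ he] with t ht hte
      refine ⟨?_, h.mono fun y hy => hy t hte⟩
      exact ht.comp_of_eq (f := fun y : E => (y, t)) (analyticAt_id.prod analyticAt_const) rfl
    · rintro a b c - - - ⟨h1, h2⟩ ⟨h3, h4⟩
      refine ⟨(h1.add h3).congr ?_, ?_⟩
      · filter_upwards [h2, h4] with y hy hy'
        exact intervalIntegral.integral_add_adjacent_intervals hy hy'
      · filter_upwards [h2, h4] with y hy hy'
        exact hy.trans hy'
    · rintro a b - - ⟨h1, h2⟩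
      refine ⟨h1.neg.congr (Filter.Eventually.of_forall fun y => ?_), h2.mono fun y hy => hy.symm⟩
      exact (intervalIntegral.integral_symm a b).symm
  obtain ⟨e, he, h⟩ := hint b hb
  have h1 : AnalyticAt ℝ (fun w : E × ℝ => ∫ t in a..b, F (w.1, t)) (y₀, b) :=
    hP.1.comp_of_eq (f := fun w : E × ℝ => w.1) analyticAt_fst rfl
  refine (h1.add (analyticAt_integral_of_base (hF b hb))).congr ?_
  have hfst : Filter.Tendsto (fun w : E × ℝ => w.1) (𝓝 (y₀, b)) (𝓝 y₀) := continuous_fst.tendsto _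
  have hsnd : Filter.Tendsto (fun w : E × ℝ => w.2) (𝓝 (y₀, b)) (𝓝 b) := continuous_snd.tendsto _
  filter_upwards [hfst.eventually h, hfst.eventually hP.2,
    hsnd.eventually (Metric.ball_mem_nhds b he)] with w h3 h4 h5
  exact intervalIntegral.integral_add_adjacent_intervals h4 (h3 w.2 h5)

end ParametricIntegral

theorem analyticAt_sqrt_comp {E : Type*} [NormedAddCommGroup E] [NormedSpace ℝ E] {f : E → ℝ}
    {x : E} (hf : AnalyticAt ℝ f x) (h : 0 < f x) : AnalyticAt ℝ (fun y => √(f y)) x :=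
  ((contDiffAt_sqrt (n := ⊤) h.ne').analyticAt).comp_of_eq hf rfl

/-! ### The explicit solution -/

/-- The constant `H² + ε = μ²`. -/
def freq (ε H : ℝ) : ℝ := H ^ 2 + ε

/-- The minimum `x_m²` of `x²`, in terms of the square root `D` of the discriminant. -/
noncomputable def radSqMin (H δ D : ℝ) : ℝ := 2 * δ ^ 2 / (1 + 2 * H * δ + D)

/-- The function `x²`. -/
noncomputable def radSq (ε H δ D t : ℝ) : ℝ := radSqMin H δ D + D * sn (freq ε H) t ^ 2

/-- The function `x x'`. -/
noncomputable def halfDer (ε H D t : ℝ) : ℝ := D * (sn (freq ε H) t * cn (freq ε H) t)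

/-- The function `δ - H x²`. -/
noncomputable def tilt (ε H δ D t : ℝ) : ℝ := δ - H * radSq ε H δ D t

/-- The square root of the discriminant of `h`, as a polynomial in `x²`. -/
noncomputable def disc (ε H δ : ℝ) : ℝ := √(1 + 4 * H * δ - 4 * ε * δ ^ 2)

/-- Parameters for which `x²` has the expected properties; `D = 0` is allowed. -/
structure Admissible (ε H δ D : ℝ) : Prop where
  sign : ε = 1 ∨ ε = -1
  H_nonneg : 0 ≤ H
  δ_pos : 0 < δ
  D_nonneg : 0 ≤ D
  D_sq : D ^ 2 = 1 + 4 * H * δ - 4 * ε * δ ^ 2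

namespace Admissible

variable {ε H δ D : ℝ} (A : Admissible ε H δ D)
include A

theorem denom_pos : 0 < 1 + 2 * H * δ + D := by
  have := mul_nonneg A.H_nonneg A.δ_pos.le
  linarith [A.D_nonneg]

theorem radSqMin_pos : 0 < radSqMin H δ D :=
  div_pos (by have := A.δ_pos; positivity) A.denom_pos

/-- D is the derivative of q(u) = -c u² + (1 + 2Hδ) u - δ² at its root `radSqMin`. The root is
written with the rationalised quadratic formula, which does not divide by c and so survives H² + ε =
0. -/
theorem D_eq : D = 1 + 2 * H * δ - 2 * freq ε H * radSqMin H δ D := by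
  have h := A.denom_pos.ne'
  unfold radSqMin freq
  field_simp
  linear_combination A.D_sq

theorem δ_sq_eq : δ ^ 2 = (1 + 2 * H * δ) * radSqMin H δ D - freq ε H * radSqMin H δ D ^ 2 := by
  have h := A.denom_pos.ne'
  have h2 : radSqMin H δ D * (1 + 2 * H * δ + D) = 2 * δ ^ 2 := div_mul_cancel₀ _ h
  linear_combination (-1 / 2) * h2 + radSqMin H δ D / 2 * A.D_eq

theorem tilt_zero_pos : 0 < tilt ε H δ D 0 := by
  have h := A.denom_pos
  have h' := h.ne'
  have : tilt ε H δ D 0 = δ * (1 + D) / (1 + 2 * H * δ + D) := by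
    have e : radSqMin H δ D * (1 + 2 * H * δ + D) = 2 * δ ^ 2 := div_mul_cancel₀ _ h'
    rw [eq_div_iff h']
    simp only [tilt, radSq, sn_zero]
    linear_combination -H * e
  rw [this]
  have := A.δ_pos
  have := A.D_nonneg
  positivity

theorem radSq_pos (t : ℝ) : 0 < radSq ε H δ D t := by
  have := A.radSqMin_pos
  have := A.D_nonneg
  unfold radSq
  positivity

theorem halfDer_sq (t : ℝ) : halfDer ε H D t ^ 2 =
    -freq ε H * radSq ε H δ D t ^ 2 + (1 + 2 * H * δ) * radSq ε H δ D t - δ ^ 2 := by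
  have h1 := A.D_eq
  have h2 := A.δ_sq_eq
  have h3 := cn_sq_add (freq ε H) t
  unfold halfDer radSq
  generalize sn (freq ε H) t = s at *
  generalize cn (freq ε H) t = k at *
  generalize freq ε H = c at *
  generalize radSqMin H δ D = a at *
  linear_combination D ^ 2 * s ^ 2 * h3 + D * s ^ 2 * h1 + h2

/-- Rearranged, the first order equation exhibits x²(1 - εx²) as a sum of two squares. This is the
unit speed relation: it makes `dirCos` and `dirSin` the cosine and sine of an angle, and it forces 1
- εx² to be positive. -/
theorem radSq_mul (t : ℝ) : radSq ε H δ D t * (1 - ε * radSq ε H δ D t) =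
    halfDer ε H D t ^ 2 + tilt ε H δ D t ^ 2 := by
  rw [A.halfDer_sq t, tilt, freq]
  ring

theorem hasDerivAt_halfDer (t : ℝ) : HasDerivAt (halfDer ε H D)
    (1 + 2 * H * δ - 2 * freq ε H * radSq ε H δ D t) t := by
  have h1 := A.D_eq
  have h3 := cn_sq_add (freq ε H) t
  have h := (((hasDerivAt_sn (freq ε H) t).mul (hasDerivAt_cn (freq ε H) t)).const_mul D)
  convert! h using 1
  unfold radSq
  linear_combination -h1 - D * h3

theorem one_sub_pos {t : ℝ} (ht : t ∈ halfPeriod (freq ε H)) : 0 < 1 - ε * radSq ε H δ D t := by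
  have h := A.radSq_mul t
  have hu := A.radSq_pos t
  refine pos_of_mul_pos_right (a := radSq ε H δ D t) ?_ hu.le
  rw [h]
  -- The sum of squares could vanish only where x x' = 0. On the half period this forces x² to equal
  -- its minimum, and there δ - H x² > 0.
  by_cases h0 : halfDer ε H D t = 0
  · have hr : radSq ε H δ D t = radSq ε H δ D 0 := by
      have hc := cn_pos ht
      simp only [halfDer, mul_eq_zero, hc.ne', or_false] at h0
      rcases h0 with h0 | h0 <;> simp [radSq, h0]
    have : tilt ε H δ D t = tilt ε H δ D 0 := by simp only [tilt, hr]
    have := A.tilt_zero_pos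
    have : 0 < tilt ε H δ D t := by linarith
    positivity
  · positivity

end Admissible

theorem hasDerivAt_radSq (ε H δ D t : ℝ) :
    HasDerivAt (radSq ε H δ D) (2 * halfDer ε H D t) t := by
  have h := (((hasDerivAt_sn (freq ε H) t).pow 2).const_mul D).const_add (radSqMin H δ D)
  convert! h using 1
  simp [halfDer]; ring

theorem hasDerivAt_tilt (ε H δ D t : ℝ) :
    HasDerivAt (tilt ε H δ D) (-(2 * H * halfDer ε H D t)) t := by
  convert! ((hasDerivAt_radSq ε H δ D t).const_mul H).const_sub δ using 1
  ring

theorem radSq_neg (ε H δ D t : ℝ) : radSq ε H δ D (-t) = radSq ε H δ D t := by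
  simp [radSq, sn_neg]

theorem tilt_neg (ε H δ D t : ℝ) : tilt ε H δ D (-t) = tilt ε H δ D t := by
  simp [tilt, radSq_neg]

theorem halfDer_neg (ε H D t : ℝ) : halfDer ε H D (-t) = -halfDer ε H D t := by
  simp [halfDer, sn_neg, cn_neg]

theorem disc_sq_pos {ε H δ : ℝ} (hε : ε = 1 ∨ ε = -1) (h : (H, δ) ∈ params ε) :
    0 < 1 + 4 * H * δ - 4 * ε * δ ^ 2 := by
  obtain ⟨hH, hδ, h1⟩ := h
  simp only at hH hδ h1
  have hp := mul_nonneg hH hδ.le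
  rcases hε with rfl | rfl
  · have h2 := h1 rfl
    unfold mu at h2
    have h3 : √(H ^ 2 + 1) ^ 2 = H ^ 2 + 1 := sq_sqrt (by positivity)
    have h4 : 0 ≤ √(H ^ 2 + 1) := sqrt_nonneg _
    generalize √(H ^ 2 + 1) = m at *
    have h5 : H < m := by nlinarith
    -- In the sphere the discriminant factors as (μ - (2δ - H))(μ + (2δ - H)); it vanishes exactly
    -- on the boundary curve δ = (H + μ)/2 when δ > 0.
    nlinarith [mul_pos (show 0 < m - (2 * δ - H) by linarith) (show 0 < m + (2 * δ - H) by linarith)]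
  · nlinarith [mul_pos hδ hδ]

theorem disc_pos {ε H δ : ℝ} (hε : ε = 1 ∨ ε = -1) (h : (H, δ) ∈ params ε) :
    0 < disc ε H δ :=
  sqrt_pos.2 (disc_sq_pos hε h)

theorem admissible_disc {ε H δ : ℝ} (hε : ε = 1 ∨ ε = -1) (h : (H, δ) ∈ params ε) :
    Admissible ε H δ (disc ε H δ) where
  sign := hε
  H_nonneg := h.1
  δ_pos := h.2.1
  D_nonneg := (disc_pos hε h).le
  D_sq := sq_sqrt (disc_sq_pos hε h).le

/-! ### Analyticity in all variables -/

section Analytic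

variable {E : Type*} [NormedAddCommGroup E] [NormedSpace ℝ E] {H δ D t : E → ℝ} {x : E}

theorem analyticAt_sn_comp {c t : E → ℝ} (hc : AnalyticAt ℝ c x) (ht : AnalyticAt ℝ t x) :
    AnalyticAt ℝ (fun y => sn (c y) (t y)) x :=
  (analyticAt_sn_uncurry (c x, t x)).comp_of_eq (f := fun y => (c y, t y)) (hc.prod ht) rfl

theorem analyticAt_cn_comp {c t : E → ℝ} (hc : AnalyticAt ℝ c x) (ht : AnalyticAt ℝ t x) :
    AnalyticAt ℝ (fun y => cn (c y) (t y)) x :=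
  (analyticAt_cn_uncurry (c x, t x)).comp_of_eq (f := fun y => (c y, t y)) (hc.prod ht) rfl

theorem analyticAt_radSq_comp (ε : ℝ) (hH : AnalyticAt ℝ H x) (hδ : AnalyticAt ℝ δ x)
    (hD : AnalyticAt ℝ D x) (ht : AnalyticAt ℝ t x) (h : 1 + 2 * H x * δ x + D x ≠ 0) :
    AnalyticAt ℝ (fun y => radSq ε (H y) (δ y) (D y) (t y)) x := by
  unfold radSq radSqMin freq
  refine AnalyticAt.add ?_ (hD.mul ((analyticAt_sn_comp ?_ ht).pow 2))
  · exact (analyticAt_const.mul (hδ.pow 2)).div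
      ((analyticAt_const.add ((analyticAt_const.mul hH).mul hδ)).add hD) h
  · exact (hH.pow 2).add analyticAt_const

theorem analyticAt_tilt_comp (ε : ℝ) (hH : AnalyticAt ℝ H x) (hδ : AnalyticAt ℝ δ x)
    (hD : AnalyticAt ℝ D x) (ht : AnalyticAt ℝ t x) (h : 1 + 2 * H x * δ x + D x ≠ 0) :
    AnalyticAt ℝ (fun y => tilt ε (H y) (δ y) (D y) (t y)) x :=
  hδ.sub (hH.mul (analyticAt_radSq_comp ε hH hδ hD ht h))

theorem analyticAt_halfDer_comp (ε : ℝ) (hH : AnalyticAt ℝ H x)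
    (hD : AnalyticAt ℝ D x) (ht : AnalyticAt ℝ t x) :
    AnalyticAt ℝ (fun y => halfDer ε (H y) (D y) (t y)) x := by
  unfold halfDer freq
  have hc : AnalyticAt ℝ (fun y => H y ^ 2 + ε) x := (hH.pow 2).add analyticAt_const
  exact hD.mul ((analyticAt_sn_comp hc ht).mul (analyticAt_cn_comp hc ht))

end Analytic

/-! ### Existence and uniqueness of the profile -/

theorem hPoly_eq (ε H δ r : ℝ) :
    hPoly ε H δ r = -freq ε H * (r ^ 2) ^ 2 + (1 + 2 * H * δ) * r ^ 2 - δ ^ 2 := by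
  unfold hPoly freq; ring

theorem Admissible.hasDerivAt_sqrt_radSq {ε H δ D : ℝ} (A : Admissible ε H δ D) (t : ℝ) :
    HasDerivAt (fun t => √(radSq ε H δ D t)) (halfDer ε H D t / √(radSq ε H δ D t)) t := by
  convert! (hasDerivAt_radSq ε H δ D t).sqrt (A.radSq_pos t).ne' using 1
  ring

theorem Admissible.isLeast_sqrt_radSq_zero {ε H δ D : ℝ} (A : Admissible ε H δ D) (hD : 0 < D) :
    IsLeast {r | 0 < r ∧ hPoly ε H δ r = 0} √(radSq ε H δ D 0) := by
  have ha := A.radSqMin_pos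
  have h1 := A.D_eq
  have h2 := A.δ_sq_eq
  have hb := mul_nonneg A.H_nonneg A.δ_pos.le
  simp only [radSq, sn_zero, ne_eq, OfNat.ofNat_ne_zero, not_false_eq_true, zero_pow, mul_zero,
    add_zero]
  constructor
  · refine ⟨sqrt_pos.2 ha, ?_⟩
    rw [hPoly_eq, sq_sqrt ha.le]
    linear_combination -h2
  · rintro r ⟨hr, h⟩
    rw [hPoly_eq] at h
    refine sqrt_le_iff.2 ⟨hr.le, ?_⟩
    by_contra! hlt
    have hv : 0 < r ^ 2 := by positivity
    generalize radSqMin H δ D = a at *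
    generalize r ^ 2 = v at *
    generalize freq ε H = c at *
    -- Factorisation of q at its root a. The second root a + D/c exceeds a for c > 0 and is negative
    -- for c < 0, since the product of the roots is δ²/c.
    have h3 : (v - a) * (D - c * (v - a)) = 0 := by linear_combination h + (v - a) * h1 + h2
    have h4 : D - c * (v - a) = 0 := by
      rcases mul_eq_zero.1 h3 with h | h
      · linarith
      · exact h
    rcases le_or_gt 0 c with hc | hc
    · nlinarith
    · nlinarith

theorem Admissible.isProfile_sqrt_radSq {ε H δ D : ℝ} (A : Admissible ε H δ D) (hD : 0 < D) :
    IsProfile ε H δ fun t => √(radSq ε H δ D t) := by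
  refine ⟨fun t _ => ?_, fun t => sqrt_pos.2 (A.radSq_pos t), fun t => ?_,
    A.isLeast_sqrt_radSq_zero hD, ?_⟩
  · exact analyticAt_sqrt_comp (analyticAt_radSq_comp ε analyticAt_const analyticAt_const
      analyticAt_const analyticAt_id A.denom_pos.ne') (A.radSq_pos t)
  · rw [(A.hasDerivAt_sqrt_radSq t).deriv, hPoly_eq, sq_sqrt (A.radSq_pos t).le, div_pow,
      A.halfDer_sq t, sq_sqrt (A.radSq_pos t).le]
  -- Any time with sn ≠ 0 shows nonconstancy; the value 1/(1 + |c|) is attained whatever c is.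
  · obtain ⟨t, -, ht, hs⟩ := exists_sn_eq (c := freq ε H) (y := 1 / (1 + |freq ε H|))
      (by positivity) (by
        have h1 : (0:ℝ) < 1 + |freq ε H| := by positivity
        rw [div_pow, one_pow, mul_one_div, div_lt_one (by positivity)]
        nlinarith [le_abs_self (freq ε H), abs_nonneg (freq ε H)])
    refine ⟨t, fun h => ?_⟩
    rw [sqrt_inj (A.radSq_pos t).le (A.radSq_pos 0).le] at h
    simp only [radSq, hs, sn_zero] at h
    have : (0:ℝ) < 1 / (1 + |freq ε H|) := by positivity
    have : 0 < D * (1 / (1 + |freq ε H|)) ^ 2 := by positivity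
    nlinarith

/-- The first order equation alone does not have unique solutions at the waist. With m = x x',
differentiating m² = q(x²) gives m (m' - q'(x²)) = 0. Analyticity makes one factor vanish
identically, and m ≡ 0 is excluded because x is not constant. What remains is a linear second order
problem: the difference to `radSq` solves y'' = -4c y with zero data. -/
theorem IsProfile.sq_eq_radSq {ε H δ D : ℝ} (A : Admissible ε H δ D) (hD : 0 < D) {x : ℝ → ℝ}
    (hx : IsProfile ε H δ x) (t : ℝ) : x t ^ 2 = radSq ε H δ D t := by
  obtain ⟨han, hpos, hode, hleast, s₁, hs₁⟩ := hx
  have hx0 : x 0 ^ 2 = radSq ε H δ D 0 := by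
    rw [hleast.unique (A.isLeast_sqrt_radSq_zero hD), sq_sqrt (A.radSq_pos 0).le]
  have hdx : ∀ t, HasDerivAt x (deriv x t) t := fun t =>
    (han t (mem_univ t)).differentiableAt.hasDerivAt
  have han' : AnalyticOnNhd ℝ (deriv x) univ := han.deriv
  have hdx' : ∀ t, HasDerivAt (deriv x) (deriv (deriv x) t) t := fun t =>
    (han' t (mem_univ t)).differentiableAt.hasDerivAt
  let m : ℝ → ℝ := fun t => x t * deriv x t
  let m' : ℝ → ℝ := fun t => deriv x t * deriv x t + x t * deriv (deriv x) t
  have hm : ∀ t, HasDerivAt m (m' t) t := fun t => (hdx t).mul (hdx' t)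
  have hu : ∀ t, HasDerivAt (fun t => x t ^ 2) (2 * m t) t := fun t => by
    convert! (hdx t).pow 2 using 1
    simp [m]; ring
  have hsq : ∀ t, m t ^ 2 = -freq ε H * (x t ^ 2) ^ 2 + (1 + 2 * H * δ) * x t ^ 2 - δ ^ 2 := by
    intro t
    have h := hode t
    rw [eq_div_iff (pow_pos (hpos t) 2).ne', hPoly_eq] at h
    rw [← h]; simp only [m]; ring
  have hprod : ∀ t, m t * (m' t - (1 + 2 * H * δ - 2 * freq ε H * x t ^ 2)) = 0 := by
    intro t
    have h1 : HasDerivAt (fun t => m t ^ 2) (2 * m t * m' t) t := by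
      convert! (hm t).pow 2 using 1
      simp
    have h2 : HasDerivAt
        (fun t => -freq ε H * (x t ^ 2) ^ 2 + (1 + 2 * H * δ) * x t ^ 2 - δ ^ 2)
        (2 * m t * (1 + 2 * H * δ - 2 * freq ε H * x t ^ 2)) t := by
      convert! ((((hu t).pow 2).const_mul (-freq ε H)).add
        ((hu t).const_mul (1 + 2 * H * δ))).sub_const (δ ^ 2) using 1
      simp; ring
    rw [← funext hsq] at h2
    linear_combination (1 / 2) * h1.unique h2
  have hanm : AnalyticOnNhd ℝ m univ := han.mul han'
  have hanr : AnalyticOnNhd ℝ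
      (fun t => m' t - (1 + 2 * H * δ - 2 * freq ε H * x t ^ 2)) univ :=
    ((han'.mul han').add (han.mul han'.deriv)).sub
      (analyticOnNhd_const.sub (analyticOnNhd_const.mul (han.pow 2)))
  have hm' : ∀ t, m' t = 1 + 2 * H * δ - 2 * freq ε H * x t ^ 2 := by
    rcases AnalyticOnNhd.eq_zero_or_eq_zero_of_mul_eq_zero hanm hanr
      (fun t _ => hprod t) isPreconnected_univ with h | h
    · exfalso
      have h0 : ∀ t, HasDerivAt x 0 t := fun t => by
        have h1 : x t * deriv x t = 0 := h t (mem_univ t)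
        have h2 : deriv x t = 0 := (mul_eq_zero.1 h1).resolve_left (hpos t).ne'
        rw [← h2]; exact hdx t
      exact hs₁ (eq_of_forall_hasDerivAt_zero h0 s₁)
    · exact fun t => sub_eq_zero.1 (h t (mem_univ t))
  have hm0 : m 0 = 0 := by
    have h1 := hsq 0
    rw [hx0, ← A.halfDer_sq 0] at h1
    simpa [halfDer] using h1
  have hy : ∀ t, HasDerivAt (fun t => x t ^ 2 - radSq ε H δ D t)
      (2 * (m t - halfDer ε H D t)) t := fun t => by
    convert! (hu t).sub (hasDerivAt_radSq ε H δ D t) using 1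
    ring
  have hz : ∀ t, HasDerivAt (fun t => 2 * (m t - halfDer ε H D t))
      (-((4 * freq ε H) * (x t ^ 2 - radSq ε H δ D t))) t := fun t => by
    convert! ((hm t).sub (A.hasDerivAt_halfDer t)).const_mul 2 using 1
    rw [hm' t]; ring
  have h := (eq_cn_add_sn hy hz t).1
  simp only [hx0, hm0, halfDer, sn_zero] at h
  linarith

theorem Admissible.existsUnique_isProfile {ε H δ D : ℝ} (A : Admissible ε H δ D) (hD : 0 < D) :
    ∃! x : ℝ → ℝ, IsProfile ε H δ x := by
  refine ⟨_, A.isProfile_sqrt_radSq hD, fun y hy => funext fun t => ?_⟩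
  rw [← hy.sq_eq_radSq A hD t, sqrt_sq (hy.2.1 t).le]

theorem profile_eq {ε H δ : ℝ} (hε : ε = 1 ∨ ε = -1) (h : (H, δ) ∈ params ε) (t : ℝ) :
    profile ε H δ t = √(radSq ε H δ (disc ε H δ) t) := by
  have A := admissible_disc hε h
  have hD := disc_pos hε h
  have hp : IsProfile ε H δ (profile ε H δ) :=
    Classical.epsilon_spec (p := IsProfile ε H δ) ⟨_, A.isProfile_sqrt_radSq hD⟩
  rw [← hp.sq_eq_radSq A hD t, sqrt_sq (hp.2.1 t).le]

/-! ### Trigonometric functions of `𝕄²(ε)` -/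

/-- `sin` if `ε = 1`, and `sinh` otherwise. -/
noncomputable def gs (ε t : ℝ) : ℝ := if ε = 1 then sin t else sinh t

/-- `cos` if `ε = 1`, and `cosh` otherwise. -/
noncomputable def gc (ε t : ℝ) : ℝ := if ε = 1 then cos t else cosh t

theorem gs_one (t : ℝ) : gs 1 t = sin t := if_pos rfl
theorem gc_one (t : ℝ) : gc 1 t = cos t := if_pos rfl
theorem gs_neg_one (t : ℝ) : gs (-1) t = sinh t := if_neg (by norm_num)
theorem gc_neg_one (t : ℝ) : gc (-1) t = cosh t := if_neg (by norm_num)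

@[simp] theorem gs_zero (ε : ℝ) : gs ε 0 = 0 := by simp [gs]
@[simp] theorem gc_zero (ε : ℝ) : gc ε 0 = 1 := by simp [gc]
theorem gs_neg (ε t : ℝ) : gs ε (-t) = -gs ε t := by unfold gs; split_ifs <;> simp
theorem gc_neg (ε t : ℝ) : gc ε (-t) = gc ε t := by unfold gc; split_ifs <;> simp

theorem gc_sq_add {ε : ℝ} (hε : ε = 1 ∨ ε = -1) (t : ℝ) : gc ε t ^ 2 + ε * gs ε t ^ 2 = 1 := by
  rcases hε with rfl | rfl
  · rw [gc_one, gs_one]; linarith [cos_sq_add_sin_sq t]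
  · rw [gc_neg_one, gs_neg_one]; linarith [cosh_sq_sub_sinh_sq t]

theorem hasDerivAt_gs {ε : ℝ} (hε : ε = 1 ∨ ε = -1) (t : ℝ) : HasDerivAt (gs ε) (gc ε t) t := by
  rcases hε with rfl | rfl
  · rw [gc_one, funext gs_one]; exact hasDerivAt_sin t
  · rw [gc_neg_one, funext gs_neg_one]; exact hasDerivAt_sinh t

theorem hasDerivAt_gc {ε : ℝ} (hε : ε = 1 ∨ ε = -1) (t : ℝ) :
    HasDerivAt (gc ε) (-(ε * gs ε t)) t := by
  rcases hε with rfl | rfl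
  · rw [gs_one, funext gc_one, one_mul]; exact hasDerivAt_cos t
  · rw [gs_neg_one, funext gc_neg_one, neg_one_mul, neg_neg]; exact hasDerivAt_cosh t

theorem analyticAt_gs (ε t : ℝ) : AnalyticAt ℝ (gs ε) t := by
  unfold gs; split_ifs
  · exact analyticAt_sin
  · exact analyticAt_sinh

theorem analyticAt_gc (ε t : ℝ) : AnalyticAt ℝ (gc ε) t := by
  unfold gc; split_ifs
  · exact analyticAt_cos
  · exact analyticAt_cosh

/-! ### The profile curve and its frame -/

/-- The function `x`. -/
noncomputable def rad (ε H δ D t : ℝ) : ℝ := √(radSq ε H δ D t)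

/-- The function `√(1 - ε x²)`. -/
noncomputable def hgt (ε H δ D t : ℝ) : ℝ := √(1 - ε * radSq ε H δ D t)

/-- The cosine of the angle between the profile curve and the direction `∂/∂x`. -/
noncomputable def dirCos (ε H δ D t : ℝ) : ℝ :=
  halfDer ε H D t / (rad ε H δ D t * hgt ε H δ D t)

/-- The sine of the angle between the profile curve and the direction `∂/∂x`. -/
noncomputable def dirSin (ε H δ D t : ℝ) : ℝ :=
  tilt ε H δ D t / (rad ε H δ D t * hgt ε H δ D t)

/-- The angle `φ`. -/
noncomputable def angle (ε H δ D s : ℝ) : ℝ :=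
  ∫ t in (0 : ℝ)..s, tilt ε H δ D t / (rad ε H δ D t * (1 - ε * radSq ε H δ D t))

/-- The principal curvature `H + δ / x²` of the profile curves. -/
noncomputable def curv (ε H δ D t : ℝ) : ℝ := H + δ / radSq ε H δ D t

/-- The function `x₁ x₃' - x₁' x₃`, which vanishes where the tangent geodesic of the profile curve
meets the rotation axis in `e₄`. -/
noncomputable def cross (ε H δ D t : ℝ) : ℝ :=
  dirSin ε H δ D t * rad ε H δ D t * gc ε (angle ε H δ D t) -
    dirCos ε H δ D t * gs ε (angle ε H δ D t)

namespace Admissible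

variable {ε H δ D : ℝ} (A : Admissible ε H δ D) {t : ℝ}
include A

theorem sign_sq : ε ^ 2 = 1 := by rcases A.sign with rfl | rfl <;> norm_num

theorem rad_pos (t : ℝ) : 0 < rad ε H δ D t := sqrt_pos.2 (A.radSq_pos t)

theorem rad_sq (t : ℝ) : rad ε H δ D t ^ 2 = radSq ε H δ D t := sq_sqrt (A.radSq_pos t).le

theorem hgt_pos (ht : t ∈ halfPeriod (freq ε H)) : 0 < hgt ε H δ D t := sqrt_pos.2 (A.one_sub_pos ht)

theorem hgt_sq (ht : t ∈ halfPeriod (freq ε H)) :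
    hgt ε H δ D t ^ 2 = 1 - ε * rad ε H δ D t ^ 2 := by
  rw [A.rad_sq]; exact sq_sqrt (A.one_sub_pos ht).le

theorem halfDer_eq (ht : t ∈ halfPeriod (freq ε H)) :
    halfDer ε H D t = dirCos ε H δ D t * rad ε H δ D t * hgt ε H δ D t := by
  have := (A.rad_pos t).ne'
  have := (A.hgt_pos ht).ne'
  unfold dirCos
  field_simp

theorem tilt_eq (ht : t ∈ halfPeriod (freq ε H)) :
    tilt ε H δ D t = dirSin ε H δ D t * rad ε H δ D t * hgt ε H δ D t := by
  have := (A.rad_pos t).ne'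
  have := (A.hgt_pos ht).ne'
  unfold dirSin
  field_simp

theorem dirCos_sq_add (ht : t ∈ halfPeriod (freq ε H)) :
    dirCos ε H δ D t ^ 2 + dirSin ε H δ D t ^ 2 = 1 := by
  have h1 := (A.rad_pos t).ne'
  have h2 := (A.hgt_pos ht).ne'
  have h := A.radSq_mul t
  rw [A.halfDer_eq ht, A.tilt_eq ht, ← A.rad_sq, ← A.hgt_sq ht] at h
  have h3 : rad ε H δ D t ^ 2 * hgt ε H δ D t ^ 2 ≠ 0 := by positivity
  apply mul_left_cancel₀ h3
  linear_combination -h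

theorem hasDerivAt_rad (ht : t ∈ halfPeriod (freq ε H)) :
    HasDerivAt (rad ε H δ D) (dirCos ε H δ D t * hgt ε H δ D t) t := by
  have h1 := (A.rad_pos t).ne'
  convert! A.hasDerivAt_sqrt_radSq t using 1
  rw [A.halfDer_eq ht]
  unfold rad at *
  field_simp

theorem hasDerivAt_hgt (ht : t ∈ halfPeriod (freq ε H)) :
    HasDerivAt (hgt ε H δ D) (-(ε * dirCos ε H δ D t * rad ε H δ D t)) t := by
  have h1 := (A.hgt_pos ht).ne'
  convert! (((hasDerivAt_radSq ε H δ D t).const_mul ε).const_sub 1).sqrt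
    (A.one_sub_pos ht).ne' using 1
  rw [A.halfDer_eq ht]
  unfold hgt at *
  field_simp

/-- The angular velocity of the frame of the profile curve. -/
theorem hasDerivAt_dirCos (ht : t ∈ halfPeriod (freq ε H)) :
    HasDerivAt (dirCos ε H δ D) (dirSin ε H δ D t *
      ((1 - 2 * ε * rad ε H δ D t ^ 2) * dirSin ε H δ D t / (rad ε H δ D t * hgt ε H δ D t)
        + 2 * H)) t := by
  have h1 := (A.rad_pos t).ne'
  have h2 := (A.hgt_pos ht).ne'
  have h3 := A.dirCos_sq_add ht
  have h4 := A.hgt_sq ht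
  have h5 := A.tilt_eq ht
  rw [tilt, ← A.rad_sq] at h5
  convert! (A.hasDerivAt_halfDer t).div ((A.hasDerivAt_rad ht).mul (A.hasDerivAt_hgt ht))
    (mul_ne_zero h1 h2) using 1
  rw [← A.rad_sq, A.halfDer_eq ht, freq]
  simp only [Pi.mul_apply]
  generalize rad ε H δ D t = x at *
  generalize hgt ε H δ D t = y at *
  generalize dirCos ε H δ D t = a at *
  generalize dirSin ε H δ D t = b at *
  -- Eliminating δ leaves a rational identity in x, y, a, b modulo a² + b² = 1 and y² = 1 - εx².
  obtain rfl : δ = b * x * y + H * x ^ 2 := by linarith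
  field_simp
  grind

theorem hasDerivAt_dirSin (ht : t ∈ halfPeriod (freq ε H)) :
    HasDerivAt (dirSin ε H δ D) (-(dirCos ε H δ D t *
      ((1 - 2 * ε * rad ε H δ D t ^ 2) * dirSin ε H δ D t / (rad ε H δ D t * hgt ε H δ D t)
        + 2 * H))) t := by
  have h1 := (A.rad_pos t).ne'
  have h2 := (A.hgt_pos ht).ne'
  have h4 := A.hgt_sq ht
  convert! (hasDerivAt_tilt ε H δ D t).div ((A.hasDerivAt_rad ht).mul (A.hasDerivAt_hgt ht))
    (mul_ne_zero h1 h2) using 1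
  rw [A.halfDer_eq ht, A.tilt_eq ht]
  simp only [Pi.mul_apply]
  generalize rad ε H δ D t = x at *
  generalize hgt ε H δ D t = y at *
  generalize dirCos ε H δ D t = a at *
  generalize dirSin ε H δ D t = b at *
  field_simp
  grind

/-- The principal curvature along the parallels is -`dirSin` · `hgt` / `rad`; the two principal
curvatures add up to 2H. -/
theorem curv_eq (ht : t ∈ halfPeriod (freq ε H)) :
    curv ε H δ D t = 2 * H + dirSin ε H δ D t * hgt ε H δ D t / rad ε H δ D t := by
  have h1 := (A.rad_pos t).ne'
  have h5 := A.tilt_eq ht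
  rw [tilt, ← A.rad_sq] at h5
  unfold curv
  rw [← A.rad_sq]
  field_simp
  linear_combination h5

theorem curv_pos (t : ℝ) : 0 < curv ε H δ D t := by
  have := A.H_nonneg
  have := div_pos A.δ_pos (A.radSq_pos t)
  unfold curv
  linarith

end Admissible

/-! ### Analyticity of the angle -/

section Analytic

variable {E : Type*} [NormedAddCommGroup E] [NormedSpace ℝ E] {H δ D t : E → ℝ} {x : E}

theorem analyticAt_rad_comp (ε : ℝ) (A : Admissible ε (H x) (δ x) (D x)) (hH : AnalyticAt ℝ H x)
    (hδ : AnalyticAt ℝ δ x) (hD : AnalyticAt ℝ D x) (ht : AnalyticAt ℝ t x) :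
    AnalyticAt ℝ (fun y => rad ε (H y) (δ y) (D y) (t y)) x :=
  analyticAt_sqrt_comp (analyticAt_radSq_comp ε hH hδ hD ht A.denom_pos.ne') (A.radSq_pos _)

theorem analyticAt_hgt_comp (ε : ℝ) (A : Admissible ε (H x) (δ x) (D x)) (hH : AnalyticAt ℝ H x)
    (hδ : AnalyticAt ℝ δ x) (hD : AnalyticAt ℝ D x) (ht : AnalyticAt ℝ t x)
    (hx : t x ∈ halfPeriod (freq ε (H x))) :
    AnalyticAt ℝ (fun y => hgt ε (H y) (δ y) (D y) (t y)) x :=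
  analyticAt_sqrt_comp (analyticAt_const.sub (analyticAt_const.mul
    (analyticAt_radSq_comp ε hH hδ hD ht A.denom_pos.ne'))) (A.one_sub_pos hx)

theorem analyticAt_dirCos_comp (ε : ℝ) (A : Admissible ε (H x) (δ x) (D x))
    (hH : AnalyticAt ℝ H x) (hδ : AnalyticAt ℝ δ x) (hD : AnalyticAt ℝ D x)
    (ht : AnalyticAt ℝ t x) (hx : t x ∈ halfPeriod (freq ε (H x))) :
    AnalyticAt ℝ (fun y => dirCos ε (H y) (δ y) (D y) (t y)) x :=
  (analyticAt_halfDer_comp ε hH hD ht).div ((analyticAt_rad_comp ε A hH hδ hD ht).mul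
    (analyticAt_hgt_comp ε A hH hδ hD ht hx)) (mul_pos (A.rad_pos _) (A.hgt_pos hx)).ne'

theorem analyticAt_dirSin_comp (ε : ℝ) (A : Admissible ε (H x) (δ x) (D x))
    (hH : AnalyticAt ℝ H x) (hδ : AnalyticAt ℝ δ x) (hD : AnalyticAt ℝ D x)
    (ht : AnalyticAt ℝ t x) (hx : t x ∈ halfPeriod (freq ε (H x))) :
    AnalyticAt ℝ (fun y => dirSin ε (H y) (δ y) (D y) (t y)) x :=
  (analyticAt_tilt_comp ε hH hδ hD ht A.denom_pos.ne').div
    ((analyticAt_rad_comp ε A hH hδ hD ht).mul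
    (analyticAt_hgt_comp ε A hH hδ hD ht hx)) (mul_pos (A.rad_pos _) (A.hgt_pos hx)).ne'

/-- D is kept as an independent variable although only D = `disc ε H δ` occurs on the surfaces. The
square root `disc` is not differentiable at the flat tori, whereas the angle stays analytic in (H,
δ, D) up to D = 0, so continuity of `disc` is enough for the limit. -/
theorem analyticAt_angle {ε H δ D t : ℝ} (A : Admissible ε H δ D)
    (ht : t ∈ halfPeriod (freq ε H)) :
    AnalyticAt ℝ (fun q : (ℝ × ℝ × ℝ) × ℝ => angle ε q.1.1 q.1.2.1 q.1.2.2 q.2)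
      ((H, δ, D), t) := by
  refine analyticAt_integral (E := ℝ × ℝ × ℝ) (y₀ := (H, δ, D))
    (F := fun q => tilt ε q.1.1 q.1.2.1 q.1.2.2 q.2 / (rad ε q.1.1 q.1.2.1 q.1.2.2 q.2 *
      (1 - ε * radSq ε q.1.1 q.1.2.1 q.1.2.2 q.2)))
    (s := halfPeriod (freq ε H)) (ordConnected_halfPeriod _).isPreconnected (fun s hs => ?_)
    (zero_mem_halfPeriod _) ht
  have h1 : AnalyticAt ℝ (fun q : (ℝ × ℝ × ℝ) × ℝ => q.1.1) ((H, δ, D), s) :=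
    analyticAt_fst.comp_of_eq analyticAt_fst rfl
  have h2 : AnalyticAt ℝ (fun q : (ℝ × ℝ × ℝ) × ℝ => q.1.2.1) ((H, δ, D), s) :=
    analyticAt_fst.comp_of_eq (analyticAt_snd.comp_of_eq analyticAt_fst rfl) rfl
  have h3 : AnalyticAt ℝ (fun q : (ℝ × ℝ × ℝ) × ℝ => q.1.2.2) ((H, δ, D), s) :=
    analyticAt_snd.comp_of_eq (analyticAt_snd.comp_of_eq analyticAt_fst rfl) rfl
  have h4 : AnalyticAt ℝ (fun q : (ℝ × ℝ × ℝ) × ℝ => q.2) ((H, δ, D), s) := analyticAt_snd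
  refine (analyticAt_tilt_comp ε h1 h2 h3 h4 A.denom_pos.ne').div
    ((analyticAt_rad_comp ε A h1 h2 h3 h4).mul (analyticAt_const.sub (analyticAt_const.mul
      (analyticAt_radSq_comp ε h1 h2 h3 h4 A.denom_pos.ne')))) ?_
  exact (mul_pos (A.rad_pos s) (A.one_sub_pos hs)).ne'

theorem analyticAt_angle_comp (ε : ℝ) (A : Admissible ε (H x) (δ x) (D x))
    (hH : AnalyticAt ℝ H x) (hδ : AnalyticAt ℝ δ x) (hD : AnalyticAt ℝ D x)
    (ht : AnalyticAt ℝ t x) (hx : t x ∈ halfPeriod (freq ε (H x))) :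
    AnalyticAt ℝ (fun y => angle ε (H y) (δ y) (D y) (t y)) x :=
  (analyticAt_angle A hx).comp_of_eq (f := fun y => ((H y, δ y, D y), t y))
    ((hH.prod (hδ.prod hD)).prod ht) rfl

theorem analyticAt_gs_angle_comp (ε : ℝ) (A : Admissible ε (H x) (δ x) (D x))
    (hH : AnalyticAt ℝ H x) (hδ : AnalyticAt ℝ δ x) (hD : AnalyticAt ℝ D x)
    (ht : AnalyticAt ℝ t x) (hx : t x ∈ halfPeriod (freq ε (H x))) :
    AnalyticAt ℝ (fun y => gs ε (angle ε (H y) (δ y) (D y) (t y))) x :=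
  (analyticAt_gs ε _).comp_of_eq (analyticAt_angle_comp ε A hH hδ hD ht hx) rfl

theorem analyticAt_gc_angle_comp (ε : ℝ) (A : Admissible ε (H x) (δ x) (D x))
    (hH : AnalyticAt ℝ H x) (hδ : AnalyticAt ℝ δ x) (hD : AnalyticAt ℝ D x)
    (ht : AnalyticAt ℝ t x) (hx : t x ∈ halfPeriod (freq ε (H x))) :
    AnalyticAt ℝ (fun y => gc ε (angle ε (H y) (δ y) (D y) (t y))) x :=
  (analyticAt_gc ε _).comp_of_eq (analyticAt_angle_comp ε A hH hδ hD ht hx) rfl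

theorem analyticAt_cross_comp (ε : ℝ) (A : Admissible ε (H x) (δ x) (D x))
    (hH : AnalyticAt ℝ H x) (hδ : AnalyticAt ℝ δ x) (hD : AnalyticAt ℝ D x)
    (ht : AnalyticAt ℝ t x) (hx : t x ∈ halfPeriod (freq ε (H x))) :
    AnalyticAt ℝ (fun y => cross ε (H y) (δ y) (D y) (t y)) x :=
  (((analyticAt_dirSin_comp ε A hH hδ hD ht hx).mul (analyticAt_rad_comp ε A hH hδ hD ht)).mul
    (analyticAt_gc_angle_comp ε A hH hδ hD ht hx)).sub
    ((analyticAt_dirCos_comp ε A hH hδ hD ht hx).mul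
    (analyticAt_gs_angle_comp ε A hH hδ hD ht hx))

end Analytic

/-! ### Symmetry under s ↦ -s and derivative of the angle -/

@[simp] theorem angle_zero (ε H δ D : ℝ) : angle ε H δ D 0 = 0 := by simp [angle]

theorem rad_neg (ε H δ D t : ℝ) : rad ε H δ D (-t) = rad ε H δ D t := by
  simp only [rad, radSq_neg]

theorem hgt_neg (ε H δ D t : ℝ) : hgt ε H δ D (-t) = hgt ε H δ D t := by
  simp only [hgt, radSq_neg]

theorem dirCos_neg (ε H δ D t : ℝ) : dirCos ε H δ D (-t) = -dirCos ε H δ D t := by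
  simp only [dirCos, halfDer_neg, rad_neg, hgt_neg, neg_div]

theorem dirSin_neg (ε H δ D t : ℝ) : dirSin ε H δ D (-t) = dirSin ε H δ D t := by
  simp only [dirSin, tilt_neg, rad_neg, hgt_neg]

theorem angle_neg (ε H δ D t : ℝ) : angle ε H δ D (-t) = -angle ε H δ D t := by
  have h := intervalIntegral.integral_comp_neg (a := 0) (b := t)
    (fun t => tilt ε H δ D t / (rad ε H δ D t * (1 - ε * radSq ε H δ D t)))
  simp only [tilt_neg, rad_neg, radSq_neg, neg_zero] at h
  rw [angle, angle, h, intervalIntegral.integral_symm]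

theorem cross_neg (ε H δ D t : ℝ) : cross ε H δ D (-t) = cross ε H δ D t := by
  simp only [cross, dirSin_neg, dirCos_neg, rad_neg, angle_neg, gs_neg, gc_neg]
  ring

namespace Admissible

variable {ε H δ D : ℝ} (A : Admissible ε H δ D) {t : ℝ}
include A

theorem hasDerivAt_angle (ht : t ∈ halfPeriod (freq ε H)) :
    HasDerivAt (angle ε H δ D) (dirSin ε H δ D t / hgt ε H δ D t) t := by
  have hc : ContinuousOn
      (fun t => tilt ε H δ D t / (rad ε H δ D t * (1 - ε * radSq ε H δ D t)))
      (halfPeriod (freq ε H)) := by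
    intro s hs
    refine ContinuousAt.continuousWithinAt ?_
    refine (hasDerivAt_tilt ε H δ D s).continuousAt.div
      ((A.hasDerivAt_rad hs).continuousAt.mul ?_)
      (mul_pos (A.rad_pos s) (A.one_sub_pos hs)).ne'
    exact continuousAt_const.sub
      (continuousAt_const.mul (hasDerivAt_radSq ε H δ D s).continuousAt)
  have hsub : uIcc 0 t ⊆ halfPeriod (freq ε H) :=
    (ordConnected_halfPeriod _).uIcc_subset (zero_mem_halfPeriod _) ht
  have h := intervalIntegral.integral_hasDerivAt_right (hc.mono hsub).intervalIntegrable
    (hc.stronglyMeasurableAtFilter (isOpen_halfPeriod _) t ht)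
    (hc.continuousAt ((isOpen_halfPeriod _).mem_nhds ht))
  convert! h using 1
  have h1 := (A.rad_pos t).ne'
  have h2 := (A.hgt_pos ht).ne'
  rw [A.tilt_eq ht, ← A.rad_sq, ← A.hgt_sq ht]
  field_simp

theorem hasDerivAt_gs_angle (ht : t ∈ halfPeriod (freq ε H)) :
    HasDerivAt (fun t => gs ε (angle ε H δ D t))
      (gc ε (angle ε H δ D t) * (dirSin ε H δ D t / hgt ε H δ D t)) t :=
  (hasDerivAt_gs A.sign _).comp t (A.hasDerivAt_angle ht)

theorem hasDerivAt_gc_angle (ht : t ∈ halfPeriod (freq ε H)) :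
    HasDerivAt (fun t => gc ε (angle ε H δ D t))
      (-(ε * gs ε (angle ε H δ D t)) * (dirSin ε H δ D t / hgt ε H δ D t)) t :=
  (hasDerivAt_gc A.sign _).comp t (A.hasDerivAt_angle ht)

end Admissible

/-! ### Position, velocity and normal of the profile curve -/

/-- The third coordinate of the profile curve. -/
noncomputable def pos3 (ε H δ D t : ℝ) : ℝ := hgt ε H δ D t * gs ε (angle ε H δ D t)

/-- The fourth coordinate of the profile curve. -/
noncomputable def pos4 (ε H δ D t : ℝ) : ℝ := hgt ε H δ D t * gc ε (angle ε H δ D t)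

/-- The first coordinate of the velocity of the profile curve. -/
noncomputable def vel1 (ε H δ D t : ℝ) : ℝ := dirCos ε H δ D t * hgt ε H δ D t

/-- The third coordinate of the velocity of the profile curve. -/
noncomputable def vel3 (ε H δ D t : ℝ) : ℝ :=
  -(ε * (dirCos ε H δ D t * rad ε H δ D t * gs ε (angle ε H δ D t))) +
    dirSin ε H δ D t * gc ε (angle ε H δ D t)

/-- The fourth coordinate of the velocity of the profile curve. -/
noncomputable def vel4 (ε H δ D t : ℝ) : ℝ :=
  -(ε * (dirCos ε H δ D t * rad ε H δ D t * gc ε (angle ε H δ D t) +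
    dirSin ε H δ D t * gs ε (angle ε H δ D t)))

/-- The first coordinate of the unit normal of the profile curve. -/
noncomputable def nor1 (ε H δ D t : ℝ) : ℝ := dirSin ε H δ D t * hgt ε H δ D t

/-- The third coordinate of the unit normal of the profile curve. -/
noncomputable def nor3 (ε H δ D t : ℝ) : ℝ :=
  -(ε * (dirSin ε H δ D t * rad ε H δ D t * gs ε (angle ε H δ D t)) +
    dirCos ε H δ D t * gc ε (angle ε H δ D t))

/-- The fourth coordinate of the unit normal of the profile curve. -/
noncomputable def nor4 (ε H δ D t : ℝ) : ℝ := -(ε * cross ε H δ D t)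

namespace Admissible

variable {ε H δ D : ℝ} (A : Admissible ε H δ D) {t : ℝ}
include A

theorem hasDerivAt_pos3 (ht : t ∈ halfPeriod (freq ε H)) :
    HasDerivAt (pos3 ε H δ D) (vel3 ε H δ D t) t := by
  have h2 := (A.hgt_pos ht).ne'
  convert! (A.hasDerivAt_hgt ht).mul (A.hasDerivAt_gs_angle ht) using 1
  unfold vel3
  field_simp

theorem hasDerivAt_pos4 (ht : t ∈ halfPeriod (freq ε H)) :
    HasDerivAt (pos4 ε H δ D) (vel4 ε H δ D t) t := by
  have h2 := (A.hgt_pos ht).ne'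
  convert! (A.hasDerivAt_hgt ht).mul (A.hasDerivAt_gc_angle ht) using 1
  unfold vel4
  field_simp
  ring

theorem hasDerivAt_nor1 (ht : t ∈ halfPeriod (freq ε H)) :
    HasDerivAt (nor1 ε H δ D) (-(curv ε H δ D t * vel1 ε H δ D t)) t := by
  have h1 := (A.rad_pos t).ne'
  have h2 := (A.hgt_pos ht).ne'
  have h4 := A.hgt_sq ht
  convert! (A.hasDerivAt_dirSin ht).mul (A.hasDerivAt_hgt ht) using 1
  rw [A.curv_eq ht, vel1]
  generalize rad ε H δ D t = x at *
  generalize hgt ε H δ D t = y at *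
  generalize dirCos ε H δ D t = a at *
  generalize dirSin ε H δ D t = b at *
  field_simp
  grind

/-- This is Rodrigues' formula for the fourth coordinate of the normal, which is -ε `cross`. Since
the curvature is positive, the monotonicity of `cross` is reduced to the sign of x₄'. -/
theorem hasDerivAt_cross (ht : t ∈ halfPeriod (freq ε H)) :
    HasDerivAt (cross ε H δ D) (ε * (curv ε H δ D t * vel4 ε H δ D t)) t := by
  have h1 := (A.rad_pos t).ne'
  have h2 := (A.hgt_pos ht).ne'
  have h4 := A.hgt_sq ht
  have h5 := A.sign_sq
  convert! (((A.hasDerivAt_dirSin ht).mul (A.hasDerivAt_rad ht)).mul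
    (A.hasDerivAt_gc_angle ht)).sub
    ((A.hasDerivAt_dirCos ht).mul (A.hasDerivAt_gs_angle ht)) using 1
  rw [A.curv_eq ht, vel4]
  simp only [Pi.mul_apply]
  generalize rad ε H δ D t = x at *
  generalize hgt ε H δ D t = y at *
  generalize dirCos ε H δ D t = a at *
  generalize dirSin ε H δ D t = b at *
  generalize gs ε (angle ε H δ D t) = S at *
  generalize gc ε (angle ε H δ D t) = C at *
  field_simp
  grind

theorem hasDerivAt_nor3 (ht : t ∈ halfPeriod (freq ε H)) :
    HasDerivAt (nor3 ε H δ D) (-(curv ε H δ D t * vel3 ε H δ D t)) t := by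
  have h1 := (A.rad_pos t).ne'
  have h2 := (A.hgt_pos ht).ne'
  have h4 := A.hgt_sq ht
  have h5 := A.sign_sq
  convert! (((((A.hasDerivAt_dirSin ht).mul (A.hasDerivAt_rad ht)).mul
    (A.hasDerivAt_gs_angle ht)).const_mul ε).add
    ((A.hasDerivAt_dirCos ht).mul (A.hasDerivAt_gc_angle ht))).neg using 1
  rw [A.curv_eq ht, vel3]
  simp only [Pi.mul_apply]
  generalize rad ε H δ D t = x at *
  generalize hgt ε H δ D t = y at *
  generalize dirCos ε H δ D t = a at *
  generalize dirSin ε H δ D t = b at *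
  generalize gs ε (angle ε H δ D t) = S at *
  generalize gc ε (angle ε H δ D t) = C at *
  field_simp
  grind

theorem hasDerivAt_nor4 (ht : t ∈ halfPeriod (freq ε H)) :
    HasDerivAt (nor4 ε H δ D) (-(curv ε H δ D t * vel4 ε H δ D t)) t := by
  convert! ((A.hasDerivAt_cross ht).const_mul ε).neg using 1
  linear_combination curv ε H δ D t * vel4 ε H δ D t * A.sign_sq

theorem pos_pos (ht : t ∈ halfPeriod (freq ε H)) :
    rad ε H δ D t * rad ε H δ D t + pos3 ε H δ D t * pos3 ε H δ D t +
      ε * (pos4 ε H δ D t * pos4 ε H δ D t) = ε := by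
  have h4 := A.hgt_sq ht
  have h5 := A.sign_sq
  have h6 := gc_sq_add A.sign (angle ε H δ D t)
  unfold pos3 pos4
  grind

theorem vel_pos (ht : t ∈ halfPeriod (freq ε H)) :
    vel1 ε H δ D t * rad ε H δ D t + vel3 ε H δ D t * pos3 ε H δ D t +
      ε * (vel4 ε H δ D t * pos4 ε H δ D t) = 0 := by
  have h4 := A.hgt_sq ht
  have h5 := A.sign_sq
  have h6 := gc_sq_add A.sign (angle ε H δ D t)
  unfold pos3 pos4 vel1 vel3 vel4
  grind

theorem vel_vel (ht : t ∈ halfPeriod (freq ε H)) :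
    vel1 ε H δ D t * vel1 ε H δ D t + vel3 ε H δ D t * vel3 ε H δ D t +
      ε * (vel4 ε H δ D t * vel4 ε H δ D t) = 1 := by
  have h3 := A.dirCos_sq_add ht
  have h4 := A.hgt_sq ht
  have h5 := A.sign_sq
  have h6 := gc_sq_add A.sign (angle ε H δ D t)
  unfold vel1 vel3 vel4
  grind

theorem nor_nor (ht : t ∈ halfPeriod (freq ε H)) :
    nor1 ε H δ D t * nor1 ε H δ D t + nor3 ε H δ D t * nor3 ε H δ D t +
      ε * (nor4 ε H δ D t * nor4 ε H δ D t) = 1 := by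
  have h3 := A.dirCos_sq_add ht
  have h4 := A.hgt_sq ht
  have h5 := A.sign_sq
  have h6 := gc_sq_add A.sign (angle ε H δ D t)
  unfold nor1 nor3 nor4 cross
  grind

theorem nor_pos (ht : t ∈ halfPeriod (freq ε H)) :
    nor1 ε H δ D t * rad ε H δ D t + nor3 ε H δ D t * pos3 ε H δ D t +
      ε * (nor4 ε H δ D t * pos4 ε H δ D t) = 0 := by
  have h4 := A.hgt_sq ht
  have h5 := A.sign_sq
  have h6 := gc_sq_add A.sign (angle ε H δ D t)
  unfold pos3 pos4 nor1 nor3 nor4 cross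
  grind

theorem nor_vel (ht : t ∈ halfPeriod (freq ε H)) :
    nor1 ε H δ D t * vel1 ε H δ D t + nor3 ε H δ D t * vel3 ε H δ D t +
      ε * (nor4 ε H δ D t * vel4 ε H δ D t) = 0 := by
  have h4 := A.hgt_sq ht
  have h5 := A.sign_sq
  have h6 := gc_sq_add A.sign (angle ε H δ D t)
  unfold vel1 vel3 vel4 nor1 nor3 nor4 cross
  grind

/-- The vector x ψ_s - x' ψ spans the part of the plane of ψ and ψ_s whose first two coordinates
vanish. Its third and fourth coordinates, here and in `rad_vel4_sub`, are `cross` and `nor3`; they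
decide orthogonality to the sphere and locate the axis point. -/
theorem rad_vel3_sub (ht : t ∈ halfPeriod (freq ε H)) :
    rad ε H δ D t * vel3 ε H δ D t - vel1 ε H δ D t * pos3 ε H δ D t = cross ε H δ D t := by
  have h4 := A.hgt_sq ht
  unfold pos3 vel1 vel3 cross
  grind

theorem rad_vel4_sub (ht : t ∈ halfPeriod (freq ε H)) :
    rad ε H δ D t * vel4 ε H δ D t - vel1 ε H δ D t * pos4 ε H δ D t = nor3 ε H δ D t := by
  have h4 := A.hgt_sq ht
  unfold pos4 vel1 vel4 nor3
  grind

/-- At a zero of `cross` this fixes the sign of `nor3`, and shows that x ψ_s - x' ψ is a nonzero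
multiple of e₄ as soon as `dirCos` ≠ 0. -/
theorem nor3_mul_gc (h : cross ε H δ D t = 0) :
    nor3 ε H δ D t * gc ε (angle ε H δ D t) = -dirCos ε H δ D t := by
  have h6 := gc_sq_add A.sign (angle ε H δ D t)
  unfold cross at h
  unfold nor3
  linear_combination -ε * gs ε (angle ε H δ D t) * h - dirCos ε H δ D t * h6

end Admissible

/-! ### The surface -/

/-- The vector `(p cos θ, -p sin θ, q, r)`. -/
noncomputable def rotVec (p q r θ : ℝ) : R4 := ![p * cos θ, -(p * sin θ), q, r]

theorem form_rotVec (ε p q r p' q' r' θ : ℝ) :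
    form ε (rotVec p q r θ) (rotVec p' q' r' θ) = p * p' + q * q' + ε * (r * r') := by
  simp only [form, rotVec, Matrix.cons_val]
  linear_combination p * p' * (cos_sq_add_sin_sq θ)

theorem form_comm (ε : ℝ) (u v : R4) : form ε u v = form ε v u := by
  unfold form; ring

theorem hasDerivAt_rotVec {p q r : ℝ → ℝ} {p' q' r' s : ℝ} (hp : HasDerivAt p p' s)
    (hq : HasDerivAt q q' s) (hr : HasDerivAt r r' s) (θ : ℝ) :
    HasDerivAt (fun t => rotVec (p t) (q t) (r t) θ) (rotVec p' q' r' θ) s := by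
  rw [hasDerivAt_pi]
  intro i
  fin_cases i
  · exact hp.mul_const _
  · exact (hp.mul_const _).neg
  · exact hq
  · exact hr

theorem analyticAt_rotVec {p q r : ℝ → ℝ} {z : ℝ × ℝ} (hp : AnalyticAt ℝ p z.1)
    (hq : AnalyticAt ℝ q z.1) (hr : AnalyticAt ℝ r z.1) :
    AnalyticAt ℝ (fun z : ℝ × ℝ => rotVec (p z.1) (q z.1) (r z.1) z.2) z := by
  have hp' : AnalyticAt ℝ (fun z : ℝ × ℝ => p z.1) z := hp.comp_of_eq analyticAt_fst rfl
  have hc : AnalyticAt ℝ (fun z : ℝ × ℝ => cos z.2) z :=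
    analyticAt_cos.comp_of_eq analyticAt_snd rfl
  have hs : AnalyticAt ℝ (fun z : ℝ × ℝ => sin z.2) z :=
    analyticAt_sin.comp_of_eq analyticAt_snd rfl
  rw [analyticAt_pi_iff]
  intro i
  fin_cases i
  · exact hp'.mul hc
  · exact (hp'.mul hs).neg
  · exact hq.comp_of_eq analyticAt_fst rfl
  · exact hr.comp_of_eq analyticAt_fst rfl

theorem psi_eq {ε H δ : ℝ} (hε : ε = 1 ∨ ε = -1) (h : (H, δ) ∈ params ε) (s θ : ℝ) :
    psi ε H δ s θ = rotVec (rad ε H δ (disc ε H δ) s) (pos3 ε H δ (disc ε H δ) s)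
      (pos4 ε H δ (disc ε H δ) s) θ := by
  have A := admissible_disc hε h
  have h1 : ∀ t, profile ε H δ t = rad ε H δ (disc ε H δ) t := profile_eq hε h
  have h2 : phase ε H δ s = angle ε H δ (disc ε H δ) s := by
    unfold phase angle
    refine intervalIntegral.integral_congr fun t _ => ?_
    simp only [h1, A.rad_sq, tilt]
  simp only [psi, h1, h2, A.rad_sq]
  rfl

/-- The unit normal of the rotational surface. -/
noncomputable def normalField (ε H δ : ℝ) (s θ : ℝ) : R4 :=
  rotVec (nor1 ε H δ (disc ε H δ) s) (nor3 ε H δ (disc ε H δ) s) (nor4 ε H δ (disc ε H δ) s) θ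

section Surface

variable {ε H δ : ℝ} (hε : ε = 1 ∨ ε = -1) (h : (H, δ) ∈ params ε) {s : ℝ}
include hε h

theorem partialS_psi (hs : s ∈ halfPeriod (freq ε H)) (θ : ℝ) :
    partialS (psi ε H δ) s θ = rotVec (vel1 ε H δ (disc ε H δ) s) (vel3 ε H δ (disc ε H δ) s)
      (vel4 ε H δ (disc ε H δ) s) θ := by
  have A := admissible_disc hε h
  unfold partialS
  simp only [psi_eq hε h]
  exact (hasDerivAt_rotVec (A.hasDerivAt_rad hs) (A.hasDerivAt_pos3 hs)
    (A.hasDerivAt_pos4 hs) θ).deriv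

theorem partialT_psi (s θ : ℝ) :
    partialT (psi ε H δ) s θ = ![-(rad ε H δ (disc ε H δ) s * sin θ),
      -(rad ε H δ (disc ε H δ) s * cos θ), 0, 0] := by
  unfold partialT
  simp only [psi_eq hε h]
  refine HasDerivAt.deriv (hasDerivAt_pi.2 fun i => ?_)
  fin_cases i
  · simpa [rotVec] using (hasDerivAt_cos θ).const_mul (rad ε H δ (disc ε H δ) s)
  · simpa [rotVec] using! ((hasDerivAt_sin θ).const_mul (rad ε H δ (disc ε H δ) s)).neg
  · exact hasDerivAt_const _ _
  · exact hasDerivAt_const _ _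

theorem partialT_partialT_psi (s θ : ℝ) :
    partialT (partialT (psi ε H δ)) s θ = ![-(rad ε H δ (disc ε H δ) s * cos θ),
      rad ε H δ (disc ε H δ) s * sin θ, 0, 0] := by
  unfold partialT
  refine HasDerivAt.deriv (hasDerivAt_pi.2 fun i => ?_)
  have e : ∀ t, deriv (fun t => psi ε H δ s t) t = ![-(rad ε H δ (disc ε H δ) s * sin t),
      -(rad ε H δ (disc ε H δ) s * cos t), 0, 0] := partialT_psi hε h s
  simp only [e]
  fin_cases i
  · simpa using! ((hasDerivAt_sin θ).const_mul (rad ε H δ (disc ε H δ) s)).neg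
  · simpa using! ((hasDerivAt_cos θ).const_mul (rad ε H δ (disc ε H δ) s)).neg
  · exact hasDerivAt_const _ _
  · exact hasDerivAt_const _ _

theorem partialS_normalField (hs : s ∈ halfPeriod (freq ε H)) (θ : ℝ) :
    partialS (normalField ε H δ) s θ =
      -(curv ε H δ (disc ε H δ) s) • partialS (psi ε H δ) s θ := by
  have A := admissible_disc hε h
  rw [partialS_psi hε h hs]
  unfold partialS normalField
  rw [(hasDerivAt_rotVec (A.hasDerivAt_nor1 hs) (A.hasDerivAt_nor3 hs)
    (A.hasDerivAt_nor4 hs) θ).deriv]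
  ext i
  fin_cases i <;> simp [rotVec] <;> ring

theorem form_partialS_psi_self (hs : s ∈ halfPeriod (freq ε H)) (θ : ℝ) :
    form ε (partialS (psi ε H δ) s θ) (partialS (psi ε H δ) s θ) = 1 := by
  rw [partialS_psi hε h hs, form_rotVec, (admissible_disc hε h).vel_vel hs]

theorem form_partialT_psi_self (s θ : ℝ) :
    form ε (partialT (psi ε H δ) s θ) (partialT (psi ε H δ) s θ) =
      rad ε H δ (disc ε H δ) s ^ 2 := by
  rw [partialT_psi hε h]
  simp only [form, Matrix.cons_val]
  linear_combination rad ε H δ (disc ε H δ) s ^ 2 * (cos_sq_add_sin_sq θ)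

theorem form_partialT_psi_rotVec (p q r s θ : ℝ) :
    form ε (rotVec p q r θ) (partialT (psi ε H δ) s θ) = 0 := by
  rw [partialT_psi hε h]
  simp only [form, rotVec, Matrix.cons_val]
  ring

theorem analyticAt_pos_curve (hs : s ∈ halfPeriod (freq ε H)) :
    AnalyticAt ℝ (rad ε H δ (disc ε H δ)) s ∧ AnalyticAt ℝ (pos3 ε H δ (disc ε H δ)) s ∧
      AnalyticAt ℝ (pos4 ε H δ (disc ε H δ)) s := by
  have A := admissible_disc hε h
  have h1 := analyticAt_rad_comp (H := fun _ => H) (δ := fun _ => δ) (D := fun _ => disc ε H δ)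
    (t := fun t => t) (x := s) ε A
    analyticAt_const analyticAt_const analyticAt_const analyticAt_id
  have h2 := analyticAt_hgt_comp (H := fun _ => H) (δ := fun _ => δ) (D := fun _ => disc ε H δ)
    (t := fun t => t) (x := s) ε A
    analyticAt_const analyticAt_const analyticAt_const analyticAt_id hs
  have h3 := analyticAt_gs_angle_comp (H := fun _ => H) (δ := fun _ => δ)
    (D := fun _ => disc ε H δ) (t := fun t => t) (x := s) ε A
    analyticAt_const analyticAt_const analyticAt_const analyticAt_id hs
  have h4 := analyticAt_gc_angle_comp (H := fun _ => H) (δ := fun _ => δ)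
    (D := fun _ => disc ε H δ) (t := fun t => t) (x := s) ε A
    analyticAt_const analyticAt_const analyticAt_const analyticAt_id hs
  exact ⟨h1, h2.mul h3, h2.mul h4⟩

theorem analyticAt_nor_curve (hs : s ∈ halfPeriod (freq ε H)) :
    AnalyticAt ℝ (nor1 ε H δ (disc ε H δ)) s ∧ AnalyticAt ℝ (nor3 ε H δ (disc ε H δ)) s ∧
      AnalyticAt ℝ (nor4 ε H δ (disc ε H δ)) s := by
  have A := admissible_disc hε h
  have h1 := analyticAt_rad_comp (H := fun _ => H) (δ := fun _ => δ) (D := fun _ => disc ε H δ)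
    (t := fun t => t) (x := s) ε A
    analyticAt_const analyticAt_const analyticAt_const analyticAt_id
  have h2 := analyticAt_hgt_comp (H := fun _ => H) (δ := fun _ => δ) (D := fun _ => disc ε H δ)
    (t := fun t => t) (x := s) ε A
    analyticAt_const analyticAt_const analyticAt_const analyticAt_id hs
  have h3 := analyticAt_gs_angle_comp (H := fun _ => H) (δ := fun _ => δ)
    (D := fun _ => disc ε H δ) (t := fun t => t) (x := s) ε A
    analyticAt_const analyticAt_const analyticAt_const analyticAt_id hs
  have h4 := analyticAt_gc_angle_comp (H := fun _ => H) (δ := fun _ => δ)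
    (D := fun _ => disc ε H δ) (t := fun t => t) (x := s) ε A
    analyticAt_const analyticAt_const analyticAt_const analyticAt_id hs
  have h5 := analyticAt_dirSin_comp (H := fun _ => H) (δ := fun _ => δ)
    (D := fun _ => disc ε H δ) (t := fun t => t) (x := s) ε A
    analyticAt_const analyticAt_const analyticAt_const analyticAt_id hs
  have h6 := analyticAt_dirCos_comp (H := fun _ => H) (δ := fun _ => δ)
    (D := fun _ => disc ε H δ) (t := fun t => t) (x := s) ε A
    analyticAt_const analyticAt_const analyticAt_const analyticAt_id hs
  have h7 := analyticAt_cross_comp (H := fun _ => H) (δ := fun _ => δ)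
    (D := fun _ => disc ε H δ) (t := fun t => t) (x := s) ε A
    analyticAt_const analyticAt_const analyticAt_const analyticAt_id hs
  exact ⟨h5.mul h2, ((analyticAt_const.mul ((h5.mul h1).mul h3)).add (h6.mul h4)).neg,
    (analyticAt_const.mul h7).neg⟩

theorem analyticAt_psi (hs : s ∈ halfPeriod (freq ε H)) (θ : ℝ) :
    AnalyticAt ℝ (fun q : ℝ × ℝ => psi ε H δ q.1 q.2) (s, θ) := by
  obtain ⟨h1, h2, h3⟩ := analyticAt_pos_curve hε h hs
  simp only [psi_eq hε h]
  exact analyticAt_rotVec (z := (s, θ)) h1 h2 h3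

theorem isUnitNormal_normalField {I : Set ℝ} (hI : I ⊆ halfPeriod (freq ε H)) :
    IsUnitNormal ε (psi ε H δ) (normalField ε H δ) I := by
  have A := admissible_disc hε h
  refine ⟨?_, fun s hs θ => ⟨?_, ?_, ?_, ?_⟩⟩
  · rintro ⟨s, θ⟩ ⟨hs, -⟩
    obtain ⟨h1, h2, h3⟩ := analyticAt_nor_curve hε h (hI hs)
    exact analyticAt_rotVec (z := (s, θ)) h1 h2 h3
  · rw [normalField, form_rotVec, A.nor_nor (hI hs)]
  · rw [normalField, psi_eq hε h, form_rotVec, A.nor_pos (hI hs)]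
  · rw [normalField, partialS_psi hε h (hI hs), form_rotVec, A.nor_vel (hI hs)]
  · exact form_partialT_psi_rotVec hε h _ _ _ _ _

/-- Differentiating ⟨ψ_s, N⟩ = 0 and inserting Rodrigues' formula gives the coefficient without
computing ψ_ss. -/
theorem form_partialS_partialS_psi (hs : s ∈ halfPeriod (freq ε H)) (θ : ℝ) :
    form ε (partialS (partialS (psi ε H δ)) s θ) (normalField ε H δ s θ) =
      curv ε H δ (disc ε H δ) s := by
  have A := admissible_disc hε h
  have hnhds := (isOpen_halfPeriod (freq ε H)).mem_nhds hs
  have hd : ∀ t ∈ halfPeriod (freq ε H),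
      HasDerivAt (fun t => psi ε H δ t θ) (partialS (psi ε H δ) t θ) t := fun t ht => by
    have := (analyticAt_psi hε h ht θ).comp_of_eq (f := fun t : ℝ => (t, θ))
      (analyticAt_id.prod analyticAt_const) rfl
    exact this.differentiableAt.hasDerivAt
  have han : AnalyticAt ℝ (fun t => psi ε H δ t θ) s :=
    (analyticAt_psi hε h hs θ).comp_of_eq (f := fun t : ℝ => (t, θ))
      (analyticAt_id.prod analyticAt_const) rfl
  have hdd : HasDerivAt (fun t => partialS (psi ε H δ) t θ)
      (partialS (partialS (psi ε H δ)) s θ) s :=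
    (han.deriv.differentiableAt).hasDerivAt
  have hn := hasDerivAt_rotVec (A.hasDerivAt_nor1 hs) (A.hasDerivAt_nor3 hs)
    (A.hasDerivAt_nor4 hs) θ
  have hdi := hasDerivAt_pi.1 hdd
  have hni := hasDerivAt_pi.1 hn
  have key : HasDerivAt (fun t => form ε (partialS (psi ε H δ) t θ) (normalField ε H δ t θ))
      (form ε (partialS (partialS (psi ε H δ)) s θ) (normalField ε H δ s θ) +
        form ε (partialS (psi ε H δ) s θ) (rotVec
          (-(curv ε H δ (disc ε H δ) s * vel1 ε H δ (disc ε H δ) s))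
          (-(curv ε H δ (disc ε H δ) s * vel3 ε H δ (disc ε H δ) s))
          (-(curv ε H δ (disc ε H δ) s * vel4 ε H δ (disc ε H δ) s)) θ)) s := by
    convert! ((((hdi 0).mul (hni 0)).add ((hdi 1).mul (hni 1))).add
      ((hdi 2).mul (hni 2))).add (((hdi 3).mul (hni 3)).const_mul ε) using 1
    simp only [form, normalField]
    ring
  have hzero : (fun t => form ε (partialS (psi ε H δ) t θ) (normalField ε H δ t θ)) =ᶠ[𝓝 s]
      fun _ => 0 := by
    filter_upwards [hnhds] with t ht
    rw [form_comm, normalField, partialS_psi hε h ht, form_rotVec, A.nor_vel ht]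
  have := key.unique ((hasDerivAt_const s (0 : ℝ)).congr_of_eventuallyEq hzero)
  rw [partialS_psi hε h hs, form_rotVec] at this
  linear_combination this + curv ε H δ (disc ε H δ) s * A.vel_vel hs

theorem meanCurvature_psi (hs : s ∈ halfPeriod (freq ε H)) (θ : ℝ) :
    meanCurvature ε (psi ε H δ) (normalField ε H δ) s θ = H := by
  have A := admissible_disc hε h
  have h1 := (A.rad_pos s).ne'
  have hP : form ε (partialT (partialT (psi ε H δ)) s θ) (normalField ε H δ s θ) =
      -(rad ε H δ (disc ε H δ) s * nor1 ε H δ (disc ε H δ) s) := by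
    rw [partialT_partialT_psi hε h]
    simp only [form, normalField, rotVec, Matrix.cons_val]
    linear_combination -(rad ε H δ (disc ε H δ) s * nor1 ε H δ (disc ε H δ) s) *
      cos_sq_add_sin_sq θ
  have hF : form ε (partialS (psi ε H δ) s θ) (partialT (psi ε H δ) s θ) = 0 := by
    rw [partialS_psi hε h hs, form_partialT_psi_rotVec hε h]
  simp only [meanCurvature]
  rw [hP, hF, form_partialS_psi_self hε h hs, form_partialT_psi_self hε h,
    form_partialS_partialS_psi hε h hs, A.curv_eq hs, nor1]
  field_simp
  ring

theorem isProfilePrincipalCurvature_psi {I : Set ℝ} (hI : I ⊆ halfPeriod (freq ε H)) :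
    IsProfilePrincipalCurvature (psi ε H δ) (normalField ε H δ) I (curv ε H δ (disc ε H δ)) :=
  fun _ hs θ => partialS_normalField hε h (hI hs) θ

theorem linearIndependent_partials (hs : s ∈ halfPeriod (freq ε H)) (θ : ℝ) :
    LinearIndependent ℝ ![partialS (psi ε H δ) s θ, partialT (psi ε H δ) s θ] := by
  have A := admissible_disc hε h
  rw [LinearIndependent.pair_iff]
  intro a b hab
  have hadd : ∀ w : R4, a * form ε (partialS (psi ε H δ) s θ) w +
      b * form ε (partialT (psi ε H δ) s θ) w = 0 := by
    intro w
    have : form ε (a • partialS (psi ε H δ) s θ + b • partialT (psi ε H δ) s θ) w = 0 := by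
      rw [hab]; simp [form]
    rw [← this]
    simp only [form, Pi.add_apply, Pi.smul_apply, smul_eq_mul]
    ring
  have hF : form ε (partialS (psi ε H δ) s θ) (partialT (psi ε H δ) s θ) = 0 := by
    rw [partialS_psi hε h hs, form_partialT_psi_rotVec hε h]
  have e1 := hadd (partialS (psi ε H δ) s θ)
  have e2 := hadd (partialT (psi ε H δ) s θ)
  rw [form_partialS_psi_self hε h hs, form_comm ε (partialT (psi ε H δ) s θ), hF] at e1
  rw [form_partialT_psi_self hε h, hF] at e2
  refine ⟨by linarith, ?_⟩
  have := pow_ne_zero 2 (A.rad_pos s).ne'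
  simpa [this] using e2

theorem psi_mem_spaceForm (hs : s ∈ halfPeriod (freq ε H)) (θ : ℝ) :
    psi ε H δ s θ ∈ spaceForm ε := by
  have A := admissible_disc hε h
  rw [psi_eq hε h]
  refine ⟨by rw [form_rotVec, A.pos_pos hs], ?_⟩
  rintro rfl
  simp only [rotVec, Matrix.cons_val, pos4, gc_neg_one]
  exact mul_pos (A.hgt_pos hs) (cosh_pos _)

theorem meetsOrthogonally_psi (hs : s ∈ halfPeriod (freq ε H))
    (hc : cross ε H δ (disc ε H δ) s = 0) (hn : dirCos ε H δ (disc ε H δ) s ≠ 0) (θ : ℝ) :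
    MeetsOrthogonally ε (psi ε H δ) s θ e4 := by
  have A := admissible_disc hε h
  intro n ν h1 h2 _ _ h5
  have h3 : nor3 ε H δ (disc ε H δ) s ≠ 0 := fun h0 => hn (by
    have := A.nor3_mul_gc hc
    rw [h0, zero_mul] at this
    linarith)
  have hε0 : ε ≠ 0 := by rcases hε with rfl | rfl <;> norm_num
  -- The normal n is orthogonal to ψ and ψ_s, hence to x ψ_s - x' ψ, which is a multiple of e₄ up to
  -- the factor `nor3` ≠ 0. So n is tangent to the sphere about e₄.
  have hn4 : n 3 = 0 := by
    have e1 := A.rad_vel3_sub hs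
    have e2 := A.rad_vel4_sub hs
    rw [psi_eq hε h] at h1
    rw [partialS_psi hε h hs] at h2
    simp only [form, rotVec, Matrix.cons_val] at h1 h2
    have : ε * n 3 * nor3 ε H δ (disc ε H δ) s = 0 := by
      rw [hc] at e1
      rw [← e2]
      linear_combination rad ε H δ (disc ε H δ) s * h2 - vel1 ε H δ (disc ε H δ) s * h1 - n 2 * e1
    simpa [hε0, h3] using this
  have h6 : form ε n e4 = 0 := by simp [form, e4, hn4]
  rw [form_comm]
  exact h5 n h1 h6

end Surface

/-! ### Monotonicity on half a period -/

theorem halfDer_pos {ε H D t : ℝ} (hD : 0 < D) (ht : t ∈ halfPeriod (freq ε H)) (h0 : 0 < t) :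
    0 < halfDer ε H D t :=
  mul_pos hD (mul_pos (sn_pos ht h0) (cn_pos ht))

theorem radSq_lt {ε H δ D s t : ℝ} (hD : 0 < D) (ht : t ∈ halfPeriod (freq ε H)) (hs : 0 ≤ s) (hst : s < t) :
    radSq ε H δ D s < radSq ε H δ D t := by
  have hm : StrictMonoOn (radSq ε H δ D) (Icc 0 t) := by
    refine strictMonoOn_of_deriv_pos (convex_Icc 0 t)
      (fun x _ => (hasDerivAt_radSq ε H δ D x).continuousAt.continuousWithinAt) (fun x hx => ?_)
    rw [interior_Icc] at hx
    rw [(hasDerivAt_radSq ε H δ D x).deriv]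
    have := halfDer_pos hD
      (mem_halfPeriod_of_mem_Icc ht ⟨by linarith [hx.1, hx.2], hx.2.le⟩) hx.1
    linarith
  exact hm ⟨hs, hst.le⟩ (right_mem_Icc.2 (hs.trans hst.le)) hst

namespace Admissible

variable {ε H δ D : ℝ} (A : Admissible ε H δ D) {s t : ℝ}
include A

theorem tilt_pos_of_le (ht : t ∈ halfPeriod (freq ε H)) (h0 : 0 < tilt ε H δ D t) (hs : 0 ≤ s)
    (hst : s ≤ t) : 0 < tilt ε H δ D s := by
  have hm : MonotoneOn (radSq ε H δ D) (Icc 0 t) := by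
    refine monotoneOn_of_deriv_nonneg (convex_Icc 0 t)
      (fun x _ => (hasDerivAt_radSq ε H δ D x).continuousAt.continuousWithinAt)
      (fun x _ => (hasDerivAt_radSq ε H δ D x).differentiableAt.differentiableWithinAt)
      (fun x hx => ?_)
    rw [interior_Icc] at hx
    rw [(hasDerivAt_radSq ε H δ D x).deriv]
    have hp := mem_halfPeriod_of_mem_Icc ht ⟨by linarith [hx.1, hx.2], hx.2.le⟩
    have := mul_nonneg A.D_nonneg (mul_pos (sn_pos hp hx.1) (cn_pos hp)).le
    unfold halfDer
    linarith
  have h1 := hm ⟨hs, hst⟩ (right_mem_Icc.2 (hs.trans hst)) hst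
  have := mul_le_mul_of_nonneg_left h1 A.H_nonneg
  unfold tilt at *
  linarith

theorem dirSin_pos_iff (ht : t ∈ halfPeriod (freq ε H)) :
    0 < dirSin ε H δ D t ↔ 0 < tilt ε H δ D t :=
  div_pos_iff_of_pos_right (mul_pos (A.rad_pos t) (A.hgt_pos ht))

theorem dirCos_pos (hD : 0 < D) (ht : t ∈ halfPeriod (freq ε H)) (h0 : 0 < t) :
    0 < dirCos ε H δ D t :=
  div_pos (halfDer_pos hD ht h0) (mul_pos (A.rad_pos t) (A.hgt_pos ht))

/-- The angle increases as long as `δ - H x²` is positive. -/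
theorem angle_lt (ht : t ∈ halfPeriod (freq ε H)) (h0 : ∀ r ∈ Ioo 0 t, 0 < tilt ε H δ D r)
    (hs : 0 ≤ s) (hst : s < t) : angle ε H δ D s < angle ε H δ D t := by
  have hp : ∀ x ∈ Icc 0 t, x ∈ halfPeriod (freq ε H) := fun x hx =>
    mem_halfPeriod_of_mem_Icc ht ⟨by linarith [hx.1, hx.2], hx.2⟩
  have hm : StrictMonoOn (angle ε H δ D) (Icc 0 t) := by
    refine strictMonoOn_of_deriv_pos (convex_Icc 0 t)
      (fun x hx => (A.hasDerivAt_angle (hp x hx)).continuousAt.continuousWithinAt) (fun x hx => ?_)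
    rw [interior_Icc] at hx
    have hpx := hp x (Ioo_subset_Icc_self hx)
    rw [(A.hasDerivAt_angle hpx).deriv]
    exact div_pos ((A.dirSin_pos_iff hpx).2 (h0 x hx)) (A.hgt_pos hpx)
  exact hm ⟨hs, hst.le⟩ (right_mem_Icc.2 (hs.trans hst.le)) hst

theorem angle_pos (ht : t ∈ halfPeriod (freq ε H)) (h0 : ∀ r ∈ Ioo 0 t, 0 < tilt ε H δ D r)
    (hst : 0 < t) : 0 < angle ε H δ D t := by
  simpa using A.angle_lt ht h0 le_rfl hst

end Admissible

theorem gs_pos {ε φ : ℝ} (h0 : 0 < φ) (h1 : ε = 1 → φ < π) : 0 < gs ε φ := by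
  unfold gs
  split_ifs with hε
  · exact sin_pos_of_pos_of_lt_pi h0 (h1 hε)
  · exact sinh_pos_iff.2 h0

theorem gc_pos {ε φ : ℝ} (h0 : 0 ≤ φ) (h1 : ε = 1 → φ < π / 2) : 0 < gc ε φ := by
  unfold gc
  split_ifs with hε
  · exact cos_pos_of_mem_Ioo ⟨by linarith [pi_pos], h1 hε⟩
  · exact cosh_pos _

/-! ### The region where the parameter of the free boundary is unique -/

/-- The parameters `s` of the part of the profile curve on which `δ - H x² > 0` and, in the sphere,
the angle is less than `π / 2`. -/
structure InRegion (ε H δ D s : ℝ) : Prop where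
  pos : 0 < s
  half : s ∈ halfPeriod (freq ε H)
  tilt_pos : 0 < tilt ε H δ D s
  angle_lt : ε = 1 → angle ε H δ D s < π / 2

namespace InRegion

variable {ε H δ D : ℝ} {s t : ℝ}

theorem tilt_pos_of_le (R : InRegion ε H δ D t) (A : Admissible ε H δ D) (hs : 0 ≤ s)
    (hst : s ≤ t) : 0 < tilt ε H δ D s :=
  A.tilt_pos_of_le R.half R.tilt_pos hs hst

theorem mono (R : InRegion ε H δ D t) (A : Admissible ε H δ D) (hs : 0 < s) (hst : s ≤ t) :
    InRegion ε H δ D s := by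
  have hp := mem_halfPeriod_of_mem_Icc R.half ⟨by linarith [R.pos], hst⟩
  refine ⟨hs, hp, R.tilt_pos_of_le A hs.le hst, fun hε => ?_⟩
  rcases hst.eq_or_lt with rfl | hlt
  · exact R.angle_lt hε
  · exact (A.angle_lt R.half (fun r hr => R.tilt_pos_of_le A hr.1.le hr.2.le) hs.le hlt).trans
      (R.angle_lt hε)

theorem angle_pos (R : InRegion ε H δ D t) (A : Admissible ε H δ D) : 0 < angle ε H δ D t :=
  A.angle_pos R.half (fun _ hr => R.tilt_pos_of_le A hr.1.le hr.2.le) R.pos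

theorem gs_pos (R : InRegion ε H δ D t) (A : Admissible ε H δ D) :
    0 < gs ε (angle ε H δ D t) :=
  RotationalCMC.gs_pos (R.angle_pos A) fun hε => by linarith [R.angle_lt hε, pi_pos]

theorem gc_pos (R : InRegion ε H δ D t) (A : Admissible ε H δ D) :
    0 < gc ε (angle ε H δ D t) :=
  RotationalCMC.gc_pos (R.angle_pos A).le R.angle_lt

theorem dirSin_pos (R : InRegion ε H δ D t) (A : Admissible ε H δ D) : 0 < dirSin ε H δ D t :=
  (A.dirSin_pos_iff R.half).2 R.tilt_pos

/-- Both summands of -ε x₄' are positive in the region: the curve moves away from e₄. -/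
theorem vel4_neg (R : InRegion ε H δ D t) (A : Admissible ε H δ D) (hD : 0 < D) :
    ε * vel4 ε H δ D t < 0 := by
  have h1 := mul_pos (mul_pos (A.dirCos_pos hD R.half R.pos) (A.rad_pos t)) (R.gc_pos A)
  have h2 := mul_pos (R.dirSin_pos A) (R.gs_pos A)
  unfold vel4
  nlinarith [A.sign_sq]

theorem cross_deriv_neg (R : InRegion ε H δ D t) (A : Admissible ε H δ D) (hD : 0 < D) :
    ε * (curv ε H δ D t * vel4 ε H δ D t) < 0 := by
  have := mul_neg_of_pos_of_neg (A.curv_pos t) (R.vel4_neg A hD)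
  linarith

theorem half_of_mem_Icc (R : InRegion ε H δ D t) (hs : s ∈ Icc 0 t) :
    s ∈ halfPeriod (freq ε H) :=
  mem_halfPeriod_of_mem_Icc R.half ⟨by linarith [hs.1, R.pos], hs.2⟩

theorem strictAntiOn_cross (R : InRegion ε H δ D t) (A : Admissible ε H δ D) (hD : 0 < D) :
    StrictAntiOn (cross ε H δ D) (Icc 0 t) := by
  refine strictAntiOn_of_deriv_neg (convex_Icc 0 t) (fun x hx =>
    (A.hasDerivAt_cross (R.half_of_mem_Icc hx)).continuousAt.continuousWithinAt) (fun x hx => ?_)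
  rw [interior_Icc] at hx
  rw [(A.hasDerivAt_cross (R.half_of_mem_Icc (Ioo_subset_Icc_self hx))).deriv]
  exact (R.mono A hx.1 hx.2.le).cross_deriv_neg A hD

theorem strictAntiOn_pos4 (R : InRegion ε H δ D t) (A : Admissible ε H δ D) (hD : 0 < D) :
    StrictAntiOn (fun s => ε * pos4 ε H δ D s) (Icc 0 t) := by
  have hd : ∀ x ∈ Icc 0 t, HasDerivAt (fun s => ε * pos4 ε H δ D s) (ε * vel4 ε H δ D x) x :=
    fun x hx => (A.hasDerivAt_pos4 (R.half_of_mem_Icc hx)).const_mul ε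
  refine strictAntiOn_of_deriv_neg (convex_Icc 0 t) (fun x hx =>
    (hd x hx).continuousAt.continuousWithinAt) (fun x hx => ?_)
  rw [interior_Icc] at hx
  rw [(hd x (Ioo_subset_Icc_self hx)).deriv]
  exact (R.mono A hx.1 hx.2.le).vel4_neg A hD

theorem eq_of_cross_eq_zero (R : InRegion ε H δ D t) (A : Admissible ε H δ D) (hD : 0 < D)
    (R' : InRegion ε H δ D s) (ht : cross ε H δ D t = 0) (hs : cross ε H δ D s = 0) : s = t := by
  rcases lt_trichotomy s t with h | h | h
  · have := R.strictAntiOn_cross A hD ⟨R'.pos.le, h.le⟩ (right_mem_Icc.2 R.pos.le) h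
    linarith
  · exact h
  · have := R'.strictAntiOn_cross A hD ⟨R.pos.le, h.le⟩ (right_mem_Icc.2 R'.pos.le) h
    linarith

end InRegion

/-! ### Existence of the free boundary parameter -/

namespace Admissible

variable {ε H δ D : ℝ} (A : Admissible ε H δ D) {s t : ℝ}
include A

theorem cross_zero_pos : 0 < cross ε H δ D 0 := by
  have h0 := zero_mem_halfPeriod (freq ε H)
  have h1 := (A.dirSin_pos_iff h0).2 A.tilt_zero_pos
  have h2 : dirCos ε H δ D 0 = 0 := by simp [dirCos, halfDer]
  simp only [cross, angle_zero, gs_zero, gc_zero, h2]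
  have := mul_pos h1 (A.rad_pos 0)
  linarith

theorem continuousOn_cross (ht : t ∈ halfPeriod (freq ε H)) (h0 : 0 < t) :
    ContinuousOn (cross ε H δ D) (Icc 0 t) := fun x hx =>
  (A.hasDerivAt_cross (mem_halfPeriod_of_mem_Icc ht
    ⟨by linarith [hx.1], hx.2⟩)).continuousAt.continuousWithinAt

theorem continuousOn_angle (ht : t ∈ halfPeriod (freq ε H)) (h0 : 0 < t) :
    ContinuousOn (angle ε H δ D) (Icc 0 t) := fun x hx =>
  (A.hasDerivAt_angle (mem_halfPeriod_of_mem_Icc ht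
    ⟨by linarith [hx.1], hx.2⟩)).continuousAt.continuousWithinAt

/-- The zero found by the intermediate value theorem lies strictly before t. So the endpoint may sit
on the boundary of the region, with δ - H x² = 0 or φ = π/2. -/
theorem exists_inRegion_of_angle_le (ht : t ∈ halfPeriod (freq ε H)) (h0 : 0 < t)
    (hw : ∀ r ∈ Ico 0 t, 0 < tilt ε H δ D r) (ha : ε = 1 → angle ε H δ D t ≤ π / 2)
    (hc : cross ε H δ D t < 0) : ∃ s, InRegion ε H δ D s ∧ cross ε H δ D s = 0 := by
  obtain ⟨s, hs, hs0⟩ := intermediate_value_Icc' h0.le (A.continuousOn_cross ht h0)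
    ⟨hc.le, A.cross_zero_pos.le⟩
  have hs1 : 0 < s := hs.1.lt_of_ne fun h => by
    rw [← h] at hs0
    exact A.cross_zero_pos.ne' hs0
  have hs2 : s < t := hs.2.lt_of_ne fun h => by
    rw [← h, hs0] at hc
    exact lt_irrefl _ hc
  refine ⟨s, ⟨hs1, mem_halfPeriod_of_mem_Icc ht ⟨by linarith, hs2.le⟩, hw s ⟨hs1.le, hs2⟩,
    fun hε => ?_⟩, hs0⟩
  exact (A.angle_lt ht (fun r hr => hw r ⟨hr.1.le, hr.2⟩) hs1.le hs2).trans_le (ha hε)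

/-- If φ exceeds π/2 in the sphere, it takes the value π/2 earlier, and there `cross` = -`dirCos` <
0. The sign of `cross` at t therefore matters only when φ(t) ≤ π/2. -/
theorem exists_inRegion_of_cross_neg (hD : 0 < D) (ht : t ∈ halfPeriod (freq ε H)) (h0 : 0 < t)
    (hw : ∀ r ∈ Ico 0 t, 0 < tilt ε H δ D r)
    (hc : (ε = 1 → angle ε H δ D t ≤ π / 2) → cross ε H δ D t < 0) :
    ∃ s, InRegion ε H δ D s ∧ cross ε H δ D s = 0 := by
  by_cases ha : ε = 1 → angle ε H δ D t ≤ π / 2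
  · exact A.exists_inRegion_of_angle_le ht h0 hw ha (hc ha)
  · push Not at ha
    obtain ⟨hε, ha⟩ := ha
    obtain ⟨r, hr, hr0⟩ := intermediate_value_Icc h0.le (A.continuousOn_angle ht h0)
      (show π / 2 ∈ Icc (angle ε H δ D 0) (angle ε H δ D t) by
        rw [angle_zero]; exact ⟨by positivity, ha.le⟩)
    have hr1 : 0 < r := hr.1.lt_of_ne fun h => by
      rw [← h, angle_zero] at hr0
      linarith [pi_pos]
    have hr2 : r < t := hr.2.lt_of_ne fun h => by
      rw [← h, hr0] at ha
      exact lt_irrefl _ ha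
    have hrp := mem_halfPeriod_of_mem_Icc ht ⟨by linarith, hr2.le⟩
    refine A.exists_inRegion_of_angle_le hrp hr1 (fun x hx => hw x ⟨hx.1, hx.2.trans hr2⟩)
      (fun _ => hr0.le) ?_
    have := A.dirCos_pos hD hrp hr1
    subst hε
    simp only [cross, hr0, gs_one, gc_one, cos_pi_div_two, sin_pi_div_two]
    linarith

/-- Where x² = δ/H one has `dirSin` = 0, so `cross` = -`dirCos` · `gs` of the angle, which is
negative. The hypothesis says q(δ/H) > 0, which means that this value of x² is attained inside the
half period. -/
theorem exists_inRegion_of_vertical (hD : 0 < D) (hH : 0 < H)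
    (hpos : 0 < δ / H - ε * (δ / H) ^ 2) :
    ∃ s, InRegion ε H δ D s ∧ cross ε H δ D s = 0 := by
  have h1 := A.D_eq
  have h2 := A.δ_sq_eq
  have h3 : radSqMin H δ D < δ / H := by
    have := A.tilt_zero_pos
    simp only [tilt, radSq, sn_zero] at this
    rw [lt_div_iff₀ hH]
    linarith
  have h4 : (δ / H - radSqMin H δ D) * (D - freq ε H * (δ / H - radSqMin H δ D)) =
      δ / H - ε * (δ / H) ^ 2 := by
    have e : H * (δ / H) = δ := mul_div_cancel₀ _ hH.ne'
    generalize δ / H = v at *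
    generalize radSqMin H δ D = a at *
    unfold freq at *
    linear_combination (v - a) * h1 + h2 + (δ - H * v) * e
  have h5 : 0 < D - freq ε H * (δ / H - radSqMin H δ D) :=
    pos_of_mul_pos_right (h4 ▸ hpos) (by linarith)
  have h6 : √((δ / H - radSqMin H δ D) / D) ^ 2 = (δ / H - radSqMin H δ D) / D :=
    sq_sqrt (div_nonneg (by linarith) hD.le)
  obtain ⟨t, ht, ht0, hts⟩ := exists_sn_eq (c := freq ε H)
    (y := √((δ / H - radSqMin H δ D) / D)) (sqrt_nonneg _) (by
      rw [h6, ← mul_div_assoc, div_lt_one hD]; linarith)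
  have hu : radSq ε H δ D t = δ / H := by
    unfold radSq
    rw [hts, h6, mul_div_cancel₀ _ hD.ne']; ring
  have ht1 : 0 < t := ht0.lt_of_ne fun h => by
    rw [← h] at hu
    simp only [radSq, sn_zero] at hu
    linarith
  have hw : ∀ r ∈ Ico 0 t, 0 < tilt ε H δ D r := fun r hr => by
    have := radSq_lt (δ := δ) hD ht hr.1 hr.2
    rw [hu, lt_div_iff₀ hH] at this
    unfold tilt
    linarith
  refine A.exists_inRegion_of_cross_neg hD ht ht1 hw fun ha => ?_
  have hb : dirSin ε H δ D t = 0 := by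
    unfold dirSin tilt
    rw [hu, mul_div_cancel₀ _ hH.ne', sub_self, zero_div]
  have h7 := A.angle_pos ht (fun r hr => hw r ⟨hr.1.le, hr.2⟩) ht1
  have h8 := mul_pos (A.dirCos_pos hD ht ht1) (gs_pos h7 fun hε => by linarith [ha hε, pi_pos])
  simp only [cross, hb]
  linarith

end Admissible

theorem exists_inRegion_of_minimal_hyperbolic {δ D : ℝ} (A : Admissible (-1) 0 δ D) (hD : 0 < D) :
    ∃ s, InRegion (-1) 0 δ D s ∧ cross (-1) 0 δ D s = 0 := by
  have hp : ∀ t, t ∈ halfPeriod (freq (-1) 0) := fun t => by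
    have := zero_mem_halfPeriod (freq (-1) 0)
    simp only [halfPeriod, freq, mem_ofPred_eq] at *
    nlinarith [sq_nonneg t]
  have hw : ∀ t, tilt (-1) 0 δ D t = δ := fun t => by simp [tilt]
  have hδ := A.δ_pos
  have hφ := A.angle_pos (hp 1) (fun r _ => by rw [hw r]; exact hδ) one_pos
  have hS : 0 < sinh (angle (-1) 0 δ D 1) := sinh_pos_iff.2 hφ
  set S₁ := sinh (angle (-1) 0 δ D 1) with hS₁
  -- Once u = x² exceeds K, the time is past 1, so sinh φ > S₁, and the leading term u² sinh² φ of
  -- (x x' sinh φ)² beats δ² u cosh² φ. The summand δ²/S₁² pays for the difference between cosh² and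
  -- sinh².
  set K := radSq (-1) 0 δ D 1 + 2 * δ ^ 2 + δ ^ 2 / S₁ ^ 2 + 1 with hK
  have hu1 := A.radSq_pos 1
  have hK0 : 0 < K := by positivity
  obtain ⟨t, ht, ht0, hts⟩ := exists_sn_eq (c := freq (-1) 0) (y := K / D + 1) (by positivity) (by
    simp only [freq]; nlinarith [sq_nonneg (K / D + 1)])
  have huK : K < radSq (-1) 0 δ D t := by
    have h1 := A.radSqMin_pos
    have h2 : 0 < K / D := by positivity
    have h3 : D * (K / D) = K := mul_div_cancel₀ _ hD.ne'
    unfold radSq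
    rw [hts]
    nlinarith [mul_pos hD h2, mul_pos hD (mul_pos h2 h2)]
  have ht1 : 1 < t := by
    by_contra! hle
    have : radSq (-1) 0 δ D t ≤ radSq (-1) 0 δ D 1 := by
      rcases hle.eq_or_lt with rfl | hlt
      · exact le_rfl
      · exact (radSq_lt hD (hp 1) ht0 hlt).le
    have : 0 < δ ^ 2 / S₁ ^ 2 := by positivity
    nlinarith
  have ht0 : 0 < t := by linarith
  refine A.exists_inRegion_of_cross_neg hD ht ht0 (fun r _ => by rw [hw r]; exact hδ) fun _ => ?_
  have hS2 : S₁ < sinh (angle (-1) 0 δ D t) :=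
    sinh_lt_sinh.2 (A.angle_lt ht (fun r _ => by rw [hw r]; exact hδ) zero_le_one ht1)
  have hC2 := cosh_sq (angle (-1) 0 δ D t)
  have hC0 := cosh_pos (angle (-1) 0 δ D t)
  have hm := A.halfDer_sq t
  have hm0 := halfDer_pos hD ht ht0
  have hx := A.rad_pos t
  have hy := A.hgt_pos ht
  have hx2 := A.rad_sq t
  have hlt : δ * rad (-1) 0 δ D t * cosh (angle (-1) 0 δ D t) <
      halfDer (-1) 0 D t * sinh (angle (-1) 0 δ D t) := by
    apply lt_of_pow_lt_pow_left₀ 2 (mul_pos hm0 (hS.trans hS2)).le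
    rw [mul_pow, mul_pow, mul_pow, hm, hx2, hC2]
    simp only [freq]
    have hdiv : δ ^ 2 / S₁ ^ 2 * S₁ ^ 2 = δ ^ 2 := div_mul_cancel₀ _ (by positivity)
    have hd0 : 0 < δ ^ 2 / S₁ ^ 2 := by positivity
    generalize δ ^ 2 / S₁ ^ 2 = d at *
    generalize sinh (angle (-1) 0 δ D t) = S at *
    generalize radSq (-1) 0 δ D t = u at *
    have hSS : S₁ ^ 2 < S ^ 2 := by nlinarith
    have hu : 1 < u := by nlinarith [sq_nonneg δ]
    have hk : u * (d + 2) ≤ u ^ 2 + u - δ ^ 2 - δ ^ 2 * u := by nlinarith [sq_nonneg δ]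
    have h1 : u * (d + 2) * S ^ 2 ≤ (u ^ 2 + u - δ ^ 2 - δ ^ 2 * u) * S ^ 2 :=
      mul_le_mul_of_nonneg_right hk (sq_nonneg S)
    have h2 : δ ^ 2 < (d + 2) * S ^ 2 := by nlinarith
    nlinarith [mul_lt_mul_of_pos_left h2 (show 0 < u by linarith)]
  simp only [cross, dirSin, dirCos, hw, gs_neg_one, gc_neg_one]
  have : δ / (rad (-1) 0 δ D t * hgt (-1) 0 δ D t) * rad (-1) 0 δ D t *
      cosh (angle (-1) 0 δ D t) - halfDer (-1) 0 D t / (rad (-1) 0 δ D t * hgt (-1) 0 δ D t) *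
      sinh (angle (-1) 0 δ D t) = (δ * rad (-1) 0 δ D t * cosh (angle (-1) 0 δ D t) -
      halfDer (-1) 0 D t * sinh (angle (-1) 0 δ D t)) /
      (rad (-1) 0 δ D t * hgt (-1) 0 δ D t) := by ring
  rw [this]
  exact div_neg_of_neg_of_pos (by linarith) (mul_pos hx hy)

/-! In the sphere, if `δ ≥ H`, the angle between the profile curve and its radial geodesic is
compared with a function whose limit at the half period is `π / 2`. -/

section Sphere

variable {H δ D : ℝ} (A : Admissible 1 H δ D) {s t : ℝ}
include A

theorem tilt_pos_of_le_delta (hHδ : H ≤ δ) (ht : t ∈ halfPeriod (freq 1 H)) :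
    0 < tilt 1 H δ D t := by
  have h1 := A.one_sub_pos ht
  have h2 := A.δ_pos
  have h3 := A.H_nonneg
  unfold tilt
  rcases h3.eq_or_lt with rfl | h3
  · linarith
  · nlinarith

theorem rad_lt_one (ht : t ∈ halfPeriod (freq 1 H)) : rad 1 H δ D t < 1 := by
  have h1 := A.one_sub_pos ht
  rw [rad, sqrt_lt' one_pos]
  linarith

/-- With a = u_min, the identity a u = (a cn)² + (δ sn)² makes this arctangent an explicit primitive
of δ/x². It tends to π/2 as cn tends to 0. -/
theorem hasDerivAt_arctan_comparison (ht : t ∈ halfPeriod (freq 1 H)) :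
    HasDerivAt (fun t => arctan (δ / radSqMin H δ D * (sn (freq 1 H) t / cn (freq 1 H) t)))
      (δ / radSq 1 H δ D t) t := by
  have hc := (cn_pos ht).ne'
  have h := (((hasDerivAt_sn (freq 1 H) t).div (hasDerivAt_cn (freq 1 H) t) hc).const_mul
    (δ / radSqMin H δ D)).arctan
  convert! h using 1
  have h1 := A.D_eq
  have h2 := A.δ_sq_eq
  have h3 := cn_sq_add (freq 1 H) t
  have h4 := A.radSqMin_pos
  have h5 := A.radSq_pos t
  have h6 : radSqMin H δ D * radSq 1 H δ D t = (radSqMin H δ D * cn (freq 1 H) t) ^ 2 +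
      (δ * sn (freq 1 H) t) ^ 2 := by
    unfold radSq
    generalize sn (freq 1 H) t = s at *
    generalize cn (freq 1 H) t = k at *
    generalize freq 1 H = c at *
    generalize radSqMin H δ D = a at *
    linear_combination a * s ^ 2 * h1 - s ^ 2 * h2 - a ^ 2 * h3
  have h8 : radSq 1 H δ D t = ((radSqMin H δ D * cn (freq 1 H) t) ^ 2 +
      (δ * sn (freq 1 H) t) ^ 2) / radSqMin H δ D := by
    rw [← h6]; field_simp
  have h9 : cn (freq 1 H) t * cn (freq 1 H) t -
      sn (freq 1 H) t * -(freq 1 H * sn (freq 1 H) t) = 1 := by linear_combination h3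
  have h10 : (radSqMin H δ D * cn (freq 1 H) t) ^ 2 + (δ * sn (freq 1 H) t) ^ 2 ≠ 0 := by
    rw [← h6]; positivity
  have h11 : 1 + (δ / radSqMin H δ D * (sn (freq 1 H) t / cn (freq 1 H) t)) ^ 2 =
      ((radSqMin H δ D * cn (freq 1 H) t) ^ 2 + (δ * sn (freq 1 H) t) ^ 2) /
        (radSqMin H δ D * cn (freq 1 H) t) ^ 2 := by
    field_simp
  simp only [Pi.div_apply]
  rw [h9, h11, h8]
  field_simp

/-- The derivative exceeds δ/x² because H ≥ 0, x < 1 and `dirSin` > 0. So φ plus the tangent angle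
outgrows the primitive of δ/x². -/
theorem hasDerivAt_angle_add_arctan (hHδ : H ≤ δ) (ht : t ∈ halfPeriod (freq 1 H)) :
    HasDerivAt (fun t => angle 1 H δ D t + arctan (dirCos 1 H δ D t / dirSin 1 H δ D t))
      (δ / radSq 1 H δ D t + H +
        (1 - rad 1 H δ D t) * dirSin 1 H δ D t / hgt 1 H δ D t) t := by
  have hb := ((A.dirSin_pos_iff ht).2 (tilt_pos_of_le_delta A hHδ ht)).ne'
  have h := (A.hasDerivAt_angle ht).add
    (((A.hasDerivAt_dirCos ht).div (A.hasDerivAt_dirSin ht) hb).arctan)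
  convert! h using 1
  have h1 := (A.rad_pos t).ne'
  have h2 := (A.hgt_pos ht).ne'
  have h3 := A.dirCos_sq_add ht
  have h4 := A.hgt_sq ht
  have h5 : δ / radSq 1 H δ D t = H + dirSin 1 H δ D t * hgt 1 H δ D t / rad 1 H δ D t := by
    have := A.curv_eq ht
    unfold curv at this
    linarith
  have h6 : 1 + (dirCos 1 H δ D t / dirSin 1 H δ D t) ^ 2 = 1 / dirSin 1 H δ D t ^ 2 := by
    field_simp
    linarith
  rw [h5]
  simp only [Pi.div_apply]
  rw [h6]
  generalize rad 1 H δ D t = x at *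
  generalize hgt 1 H δ D t = y at *
  generalize dirCos 1 H δ D t = a at *
  generalize dirSin 1 H δ D t = b at *
  field_simp
  grind

theorem exists_inRegion_of_le_delta (hD : 0 < D) (hHδ : H ≤ δ) :
    ∃ s, InRegion 1 H δ D s ∧ cross 1 H δ D s = 0 := by
  have hc : 0 < freq 1 H := by unfold freq; positivity
  have hc' : 0 < √(freq 1 H) := sqrt_pos.2 hc
  -- Times are parametrised by N = tan(√c t), so that letting N grow approaches the end of the half
  -- period.
  have hpt : ∀ N : ℝ, arctan N / √(freq 1 H) ∈ halfPeriod (freq 1 H) := fun N => by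
    have h1 := arctan_lt_pi_div_two N
    have h2 := neg_pi_div_two_lt_arctan N
    simp only [halfPeriod, mem_ofPred_eq]
    rw [div_pow, sq_sqrt hc.le, mul_div_cancel₀ _ hc.ne']
    nlinarith
  have hq : ∀ N : ℝ, sn (freq 1 H) (arctan N / √(freq 1 H)) /
      cn (freq 1 H) (arctan N / √(freq 1 H)) = N / √(freq 1 H) := fun N => by
    rw [(sn_cn_of_pos hc _).1, (sn_cn_of_pos hc _).2, mul_div_cancel₀ _ hc'.ne', div_right_comm,
      ← tan_eq_sin_div_cos, tan_arctan]
  let r : ℝ → ℝ := fun t => angle 1 H δ D t + arctan (dirCos 1 H δ D t / dirSin 1 H δ D t) -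
    arctan (δ / radSqMin H δ D * (sn (freq 1 H) t / cn (freq 1 H) t))
  have hr : ∀ t ∈ halfPeriod (freq 1 H), HasDerivAt r
      (H + (1 - rad 1 H δ D t) * dirSin 1 H δ D t / hgt 1 H δ D t) t := fun t ht => by
    convert! (hasDerivAt_angle_add_arctan A hHδ ht).sub (hasDerivAt_arctan_comparison A ht) using 1
    ring
  have hmono : ∀ t ∈ halfPeriod (freq 1 H), StrictMonoOn r (Icc 0 t) := fun t ht => by
    have hp : ∀ x ∈ Icc 0 t, x ∈ halfPeriod (freq 1 H) := fun x hx =>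
      mem_halfPeriod_of_mem_Icc ht ⟨by linarith [hx.1, hx.2], hx.2⟩
    refine strictMonoOn_of_deriv_pos (convex_Icc 0 t)
      (fun x hx => (hr x (hp x hx)).continuousAt.continuousWithinAt) (fun x hx => ?_)
    rw [interior_Icc] at hx
    have hpx := hp x (Ioo_subset_Icc_self hx)
    rw [(hr x hpx).deriv]
    have h1 := (A.dirSin_pos_iff hpx).2 (tilt_pos_of_le_delta A hHδ hpx)
    have h2 : 0 < 1 - rad 1 H δ D x := by linarith [rad_lt_one A hpx]
    have := div_pos (mul_pos h2 h1) (A.hgt_pos hpx)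
    linarith [A.H_nonneg]
  have hr0 : r 0 = 0 := by
    have : dirCos 1 H δ D 0 = 0 := by simp [dirCos, halfDer]
    simp [r, this]
  set s₀ := arctan 1 / √(freq 1 H) with hs₀
  have hs₀0 : 0 < s₀ := div_pos (arctan_pos.2 one_pos) hc'
  have hrs : 0 < r s₀ := by
    rw [← hr0]
    exact hmono s₀ (hpt 1) (left_mem_Icc.2 hs₀0.le) (right_mem_Icc.2 hs₀0.le) hs₀0
  -- The gap r is at least r(s₀) > 0 after s₀, so it suffices that the comparison function reaches
  -- π/2 - e. Capping e by 1 keeps π/2 - e in the range of the arctangent; N is then chosen large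
  -- enough for the time to be past s₀ and the comparison to reach this value.
  set e := min (r s₀) 1 with he
  have he0 : 0 < e := lt_min hrs one_pos
  have he1 : e ≤ 1 := min_le_right _ _
  set M := tan (π / 2 - e) with hM
  have hA : 0 < δ / radSqMin H δ D := div_pos A.δ_pos A.radSqMin_pos
  set N := max 1 (M / (δ / radSqMin H δ D) * √(freq 1 H)) with hN
  set t := arctan N / √(freq 1 H) with htd
  have ht : t ∈ halfPeriod (freq 1 H) := hpt N
  have hst : s₀ ≤ t := div_le_div_of_nonneg_right (arctan_le_arctan_iff.2 (le_max_left _ _)) hc'.le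
  have ht0 : 0 < t := hs₀0.trans_le hst
  have hMN : M ≤ δ / radSqMin H δ D * (sn (freq 1 H) t / cn (freq 1 H) t) := by
    rw [hq N]
    have := le_max_right 1 (M / (δ / radSqMin H δ D) * √(freq 1 H))
    rw [← hN, ← le_div_iff₀ hc', div_le_iff₀ hA] at this
    linarith
  have hkey : π / 2 ≤ angle 1 H δ D t + arctan (dirCos 1 H δ D t / dirSin 1 H δ D t) := by
    have h1 : r s₀ ≤ r t := (hmono t ht).monotoneOn ⟨hs₀0.le, hst⟩ (right_mem_Icc.2 ht0.le) hst
    have h2 : π / 2 - e ≤ arctan (δ / radSqMin H δ D * (sn (freq 1 H) t / cn (freq 1 H) t)) := by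
      rw [← arctan_tan (x := π / 2 - e) (by linarith [pi_gt_three]) (by linarith)]
      exact arctan_le_arctan_iff.2 hMN
    have h3 : e ≤ r s₀ := min_le_left _ _
    have h4 : r t = angle 1 H δ D t + arctan (dirCos 1 H δ D t / dirSin 1 H δ D t) -
      arctan (δ / radSqMin H δ D * (sn (freq 1 H) t / cn (freq 1 H) t)) := rfl
    linarith
  have hw : ∀ r ∈ Icc 0 t, 0 < tilt 1 H δ D r := fun x hx => tilt_pos_of_le_delta A hHδ
    (mem_halfPeriod_of_mem_Icc ht ⟨by linarith [hx.1], hx.2⟩)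
  refine A.exists_inRegion_of_cross_neg hD ht ht0 (fun x hx => hw x ⟨hx.1, hx.2.le⟩) fun ha => ?_
  have ha := ha rfl
  have hφ := A.angle_pos ht (fun x hx => hw x ⟨hx.1.le, hx.2.le⟩) ht0
  have hcos := A.dirCos_pos hD ht ht0
  simp only [cross, gs_one, gc_one]
  rcases ha.eq_or_lt with ha | ha
  · rw [ha, cos_pi_div_two, sin_pi_div_two]
    linarith
  · have hsin := (A.dirSin_pos_iff ht).2 (hw t (right_mem_Icc.2 ht0.le))
    have hS := sin_pos_of_pos_of_lt_pi hφ (by linarith [pi_pos])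
    have hC := cos_pos_of_mem_Ioo (x := angle 1 H δ D t) ⟨by linarith [pi_pos], ha⟩
    -- This is cot φ ≤ `dirCos`/`dirSin`, that is `dirSin` cos φ ≤ `dirCos` sin φ. The extra factor
    -- x < 1 in the first term of `cross` makes its negativity strict.
    have h1 : tan (π / 2 - angle 1 H δ D t) ≤ dirCos 1 H δ D t / dirSin 1 H δ D t := by
      rw [← tan_arctan (dirCos 1 H δ D t / dirSin 1 H δ D t)]
      have h2 := arctan_lt_pi_div_two (dirCos 1 H δ D t / dirSin 1 H δ D t)
      exact strictMonoOn_tan.monotoneOn ⟨by linarith [pi_pos], by linarith⟩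
        ⟨by linarith [pi_pos], h2⟩ (by linarith)
    rw [tan_pi_div_two_sub, tan_eq_sin_div_cos, inv_div, div_le_div_iff₀ hS hsin] at h1
    have h3 := mul_pos (mul_pos hsin hC) (show 0 < 1 - rad 1 H δ D t by linarith [rad_lt_one A ht])
    nlinarith

end Sphere

theorem exists_inRegion {ε H δ : ℝ} (hε : ε = 1 ∨ ε = -1) (h : (H, δ) ∈ params ε) :
    ∃ s, InRegion ε H δ (disc ε H δ) s ∧ cross ε H δ (disc ε H δ) s = 0 := by
  have A := admissible_disc hε h
  have hD := disc_pos hε h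
  rcases hε with rfl | rfl
  · rcases le_or_gt H δ with hle | hlt
    · exact exists_inRegion_of_le_delta A hD hle
    · have hH : 0 < H := A.δ_pos.trans hlt
      refine A.exists_inRegion_of_vertical hD hH ?_
      have h1 : 0 < δ / H := div_pos A.δ_pos hH
      have h2 : δ / H < 1 := (div_lt_one hH).2 hlt
      nlinarith
  · rcases A.H_nonneg.eq_or_lt with h0 | hH
    · subst h0
      exact exists_inRegion_of_minimal_hyperbolic A hD
    · refine A.exists_inRegion_of_vertical hD hH ?_
      have h1 : 0 < δ / H := div_pos A.δ_pos hH
      nlinarith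

/-- The free boundary parameter. -/
noncomputable def freeBoundaryParam (ε : ℝ) (p : ℝ × ℝ) : ℝ :=
  Classical.epsilon fun s => InRegion ε p.1 p.2 (disc ε p.1 p.2) s ∧
    cross ε p.1 p.2 (disc ε p.1 p.2) s = 0

theorem freeBoundaryParam_spec {ε H δ : ℝ} (hε : ε = 1 ∨ ε = -1) (h : (H, δ) ∈ params ε) :
    InRegion ε H δ (disc ε H δ) (freeBoundaryParam ε (H, δ)) ∧
      cross ε H δ (disc ε H δ) (freeBoundaryParam ε (H, δ)) = 0 :=
  Classical.epsilon_spec (p := fun s => InRegion ε H δ (disc ε H δ) s ∧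
    cross ε H δ (disc ε H δ) s = 0) (exists_inRegion hε h)

theorem freeBoundaryParam_eq {ε H δ s : ℝ} (hε : ε = 1 ∨ ε = -1) (h : (H, δ) ∈ params ε)
    (R : InRegion ε H δ (disc ε H δ) s) (hs : cross ε H δ (disc ε H δ) s = 0) :
    freeBoundaryParam ε (H, δ) = s := by
  obtain ⟨R', hs'⟩ := freeBoundaryParam_spec hε h
  exact R.eq_of_cross_eq_zero (admissible_disc hε h) (disc_pos hε h) R' hs hs'

/-! ### Embeddedness and the free boundary condition -/

section Surface

variable {ε H δ : ℝ} (hε : ε = 1 ∨ ε = -1) (h : (H, δ) ∈ params ε) {s₀ : ℝ}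
  (R : InRegion ε H δ (disc ε H δ) s₀)
include hε h R

theorem pos3_pos {s : ℝ} (hs : 0 < s) (hs' : s ≤ s₀) : 0 < pos3 ε H δ (disc ε H δ) s := by
  have A := admissible_disc hε h
  have R' := R.mono A hs hs'
  exact mul_pos (A.hgt_pos R'.half) (R'.gs_pos A)

/-- The first two coordinates determine x, hence |s| by monotonicity. The third coordinate is odd in
s and positive for s > 0, which fixes the sign; then the rotation angle is determined since x > 0.
-/
theorem isEmbeddedAnnulus_psi : IsEmbeddedAnnulus (psi ε H δ) s₀ := by
  have A := admissible_disc hε h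
  have hD := disc_pos hε h
  refine ⟨R.pos, fun s θ => ?_, ?_, fun s hs θ => ?_, ?_⟩
  · simp only [psi_eq hε h, rotVec, cos_add_two_pi, sin_add_two_pi]
  · rintro ⟨s, θ⟩ ⟨hs, -⟩
    exact analyticAt_psi hε h (mem_halfPeriod_of_mem_Icc R.half hs) θ
  · exact linearIndependent_partials hε h (mem_halfPeriod_of_mem_Icc R.half hs) θ
  · intro s hs s' hs' θ θ' heq
    rw [psi_eq hε h, psi_eq hε h] at heq
    have e0 : rad ε H δ (disc ε H δ) s * cos θ = rad ε H δ (disc ε H δ) s' * cos θ' :=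
      congrFun heq 0
    have e1 : -(rad ε H δ (disc ε H δ) s * sin θ) = -(rad ε H δ (disc ε H δ) s' * sin θ') :=
      congrFun heq 1
    have e2 : pos3 ε H δ (disc ε H δ) s = pos3 ε H δ (disc ε H δ) s' := congrFun heq 2
    have hr : radSq ε H δ (disc ε H δ) s = radSq ε H δ (disc ε H δ) s' := by
      rw [← A.rad_sq, ← A.rad_sq]
      have h1 := cos_sq_add_sin_sq θ
      have h2 := cos_sq_add_sin_sq θ'
      linear_combination (rad ε H δ (disc ε H δ) s * cos θ + rad ε H δ (disc ε H δ) s' * cos θ') *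
        e0 - (rad ε H δ (disc ε H δ) s * sin θ + rad ε H δ (disc ε H δ) s' * sin θ') * e1 -
        rad ε H δ (disc ε H δ) s ^ 2 * h1 + rad ε H δ (disc ε H δ) s' ^ 2 * h2
    have hra : ∀ x : ℝ, radSq ε H δ (disc ε H δ) |x| = radSq ε H δ (disc ε H δ) x := fun x => by
      rcases abs_choice x with hx | hx <;> rw [hx]
      exact radSq_neg _ _ _ _ _
    have habs_mem : ∀ x ∈ Icc (-s₀) s₀, |x| ∈ halfPeriod (freq ε H) := fun x hx =>
      mem_halfPeriod_of_mem_Icc R.half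
        ⟨by linarith [abs_nonneg x, R.pos], abs_le.2 hx⟩
    have habs : |s| = |s'| := by
      rcases lt_trichotomy |s| |s'| with hlt | he | hlt
      · have := radSq_lt (ε := ε) (H := H) (δ := δ) hD (habs_mem s' hs') (abs_nonneg s) hlt
        rw [hra, hra] at this
        linarith
      · exact he
      · have := radSq_lt (ε := ε) (H := H) (δ := δ) hD (habs_mem s hs) (abs_nonneg s') hlt
        rw [hra, hra] at this
        linarith
    have hneg : ∀ x, pos3 ε H δ (disc ε H δ) (-x) = -pos3 ε H δ (disc ε H δ) x := fun x => by
      simp only [pos3, hgt_neg, angle_neg, gs_neg]; ring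
    have hss : s = s' := by
      rcases abs_eq_abs.1 habs with he | he
      · exact he
      · rw [he, hneg] at e2
        rcases lt_trichotomy s' 0 with h0 | h0 | h0
        · have := pos3_pos hε h R (neg_pos.2 h0) (by linarith [hs'.1])
          rw [hneg] at this
          linarith
        · rw [he, h0, neg_zero]
        · have := pos3_pos hε h R h0 hs'.2
          linarith
    refine ⟨hss, ?_⟩
    rw [hss] at e0 e1
    have hx := (A.rad_pos s').ne'
    exact Real.Angle.cos_sin_inj (mul_left_cancel₀ hx e0) (mul_left_cancel₀ hx (neg_injective e1))

theorem pos4_pos : 0 < pos4 ε H δ (disc ε H δ) s₀ := by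
  have A := admissible_disc hε h
  exact mul_pos (A.hgt_pos R.half) (R.gc_pos A)

omit R in
theorem x4_eq (s : ℝ) : x4 ε H δ s = pos4 ε H δ (disc ε H δ) s := by
  rw [x4, psi_eq hε h]
  simp [rotVec]

omit R in
theorem form_psi_e4 (s θ : ℝ) : form ε (psi ε H δ s θ) e4 = ε * pos4 ε H δ (disc ε H δ) s := by
  rw [psi_eq hε h]
  simp [form, rotVec, e4]

theorem isGeodesicBall_x4 : IsGeodesicBall ε e4 (ε * x4 ε H δ s₀) := by
  have A := admissible_disc hε h
  have hr := A.radSq_pos s₀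
  have hy := A.hgt_pos R.half
  have hy2 := A.hgt_sq R.half
  rw [A.rad_sq] at hy2
  have hp := pos4_pos hε h R
  have hφ := R.angle_pos A
  rw [x4_eq hε h]
  refine ⟨⟨by simp [form, e4], fun _ => by simp [e4]⟩, ?_, ?_⟩
  · rintro rfl
    rw [one_mul, abs_of_pos hp]
    have : hgt 1 H δ (disc 1 H δ) s₀ < 1 := by nlinarith
    unfold pos4
    rw [gc_one]
    nlinarith [cos_le_one (angle 1 H δ (disc 1 H δ) s₀)]
  · rintro rfl
    have : 1 < hgt (-1) H δ (disc (-1) H δ) s₀ := by nlinarith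
    unfold pos4
    rw [gc_neg_one]
    nlinarith [one_le_cosh (angle (-1) H δ (disc (-1) H δ) s₀)]

theorem hasFreeBoundary_psi (hc : cross ε H δ (disc ε H δ) s₀ = 0) :
    HasFreeBoundary ε (psi ε H δ) s₀ e4 (ε * x4 ε H δ s₀) := by
  have A := admissible_disc hε h
  have hD := disc_pos hε h
  have hneg : ∀ x, pos4 ε H δ (disc ε H δ) (-x) = pos4 ε H δ (disc ε H δ) x := fun x => by
    simp only [pos4, hgt_neg, angle_neg, gc_neg]
  refine ⟨isGeodesicBall_x4 hε h R, fun s hs θ =>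
    ⟨psi_mem_spaceForm hε h (mem_halfPeriod_of_mem_Icc R.half hs) θ, ?_⟩, ?_⟩
  · rw [form_psi_e4 hε h, x4_eq hε h]
    have habs : pos4 ε H δ (disc ε H δ) |s| = pos4 ε H δ (disc ε H δ) s := by
      rcases abs_choice s with hx | hx <;> rw [hx]
      exact hneg s
    rw [← habs]
    exact (R.strictAntiOn_pos4 A hD).antitoneOn ⟨abs_nonneg s, abs_le.2 hs⟩
      (right_mem_Icc.2 R.pos.le) (abs_le.2 hs)
  · have hcos := A.dirCos_pos hD R.half R.pos
    rintro s (rfl | rfl) θ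
    · have hp := neg_mem_halfPeriod R.half
      refine ⟨⟨psi_mem_spaceForm hε h hp θ, ?_⟩,
        meetsOrthogonally_psi hε h hp (by rw [cross_neg, hc]) ?_ θ⟩
      · rw [form_psi_e4 hε h, x4_eq hε h, hneg]
      · rw [dirCos_neg]; linarith
    · exact ⟨⟨psi_mem_spaceForm hε h R.half θ, by rw [form_psi_e4 hε h, x4_eq hε h]⟩,
        meetsOrthogonally_psi hε h R.half hc hcos.ne' θ⟩

omit R in
theorem strictAntiOn_curv {b : ℝ} (hb : b ∈ halfPeriod (freq ε H)) :
    StrictAntiOn (curv ε H δ (disc ε H δ)) (Ico 0 b) := by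
  have A := admissible_disc hε h
  intro x hx y hy hxy
  have hy' := mem_halfPeriod_of_mem_Icc hb
    ⟨by linarith [hy.1, hy.2], hy.2.le⟩
  have := radSq_lt (ε := ε) (H := H) (δ := δ) (disc_pos hε h) hy' hx.1 hxy
  have := div_lt_div_of_pos_left A.δ_pos (A.radSq_pos x) this
  unfold curv
  linarith

end Surface

/-! ### Geodesics -/

theorem sn_cn_sign {ε : ℝ} (hε : ε = 1 ∨ ε = -1) (t : ℝ) : sn ε t = gs ε t ∧ cn ε t = gc ε t :=
  sn_cn_eq_of_hasDerivAt (hasDerivAt_gs hε) (hasDerivAt_gc hε) (gs_zero ε) (gc_zero ε) t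

theorem hasDerivAt_form (ε : ℝ) {u v : ℝ → R4} {u' v' : R4} {t : ℝ} (hu : HasDerivAt u u' t)
    (hv : HasDerivAt v v' t) :
    HasDerivAt (fun t => form ε (u t) (v t)) (form ε u' (v t) + form ε (u t) v') t := by
  have hu := hasDerivAt_pi.1 hu
  have hv := hasDerivAt_pi.1 hv
  convert! ((((hu 0).mul (hv 0)).add ((hu 1).mul (hv 1))).add
    ((hu 2).mul (hv 2))).add (((hu 3).mul (hv 3)).const_mul ε) using 1
  simp only [form]
  ring

/-- A geodesic with unit initial velocity is given by the standard formula. -/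
theorem IsGeodesic.eq_gc_add_gs {ε : ℝ} (hε : ε = 1 ∨ ε = -1) {γ : ℝ → R4}
    (hγ : IsGeodesic ε γ) (h1 : form ε (deriv γ 0) (deriv γ 0) = 1) (t : ℝ) :
    γ t = gc ε t • γ 0 + gs ε t • deriv γ 0 := by
  obtain ⟨hsm, hmem, hacc⟩ := hγ
  have hε2 : ε * ε = 1 := by rcases hε with rfl | rfl <;> norm_num
  have hsm' : ContDiff ℝ (1 + 1) γ := by simpa [one_add_one_eq_two] using hsm
  obtain ⟨hd, -, hsm1⟩ := contDiff_succ_iff_deriv.1 hsm'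
  have hv : ∀ t, HasDerivAt γ (deriv γ t) t := fun t => (hd t).hasDerivAt
  have ha : ∀ t, HasDerivAt (deriv γ) (deriv (deriv γ) t) t := fun t =>
    ((hsm1.differentiable one_ne_zero) t).hasDerivAt
  have hperp : ∀ t, form ε (deriv γ t) (γ t) = 0 := fun t => by
    have hc : (fun t => form ε (γ t) (γ t)) = fun _ => ε := funext fun t => (hmem t).1
    have := hasDerivAt_form ε (hv t) (hv t)
    rw [hc] at this
    have := this.unique (hasDerivAt_const t ε)
    rw [form_comm ε (γ t)] at this
    linarith
  have hunit : ∀ t, form ε (deriv γ t) (deriv γ t) = 1 := fun t => by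
    rw [← h1]
    refine eq_of_forall_hasDerivAt_zero (f := fun t => form ε (deriv γ t) (deriv γ t))
      (fun t => ?_) t
    have h2 := hacc t _ (hperp t)
    convert! hasDerivAt_form ε (ha t) (ha t) using 1
    rw [form_comm ε (deriv γ t), h2, add_zero]
  have hag : ∀ t, form ε (deriv (deriv γ) t) (γ t) = -1 := fun t => by
    have h2 := hasDerivAt_form ε (ha t) (hv t)
    have := h2.unique ((hasDerivAt_const t (0 : ℝ)).congr_of_eventuallyEq
      (Filter.Eventually.of_forall hperp))
    linarith [hunit t]
  -- The geodesic condition applies to tangent vectors, so the component of y along γ is removed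
  -- first. The result is γ'' = -ε γ tested against y, from which the coordinates are read off.
  have hay : ∀ t y, form ε (deriv (deriv γ) t) y = -(ε * form ε y (γ t)) := fun t y => by
    have h2 : form ε (y - (ε * form ε y (γ t)) • γ t) (γ t) = 0 := by
      have : form ε (y - (ε * form ε y (γ t)) • γ t) (γ t) =
          form ε y (γ t) - ε * form ε y (γ t) * form ε (γ t) (γ t) := by
        simp only [form, Pi.sub_apply, Pi.smul_apply, smul_eq_mul]; ring
      rw [this, (hmem t).1]
      linear_combination -form ε y (γ t) * hε2
    have h3 := hacc t _ h2
    have : form ε (deriv (deriv γ) t) (y - (ε * form ε y (γ t)) • γ t) =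
        form ε (deriv (deriv γ) t) y - ε * form ε y (γ t) * form ε (deriv (deriv γ) t) (γ t) := by
      simp only [form, Pi.sub_apply, Pi.smul_apply, smul_eq_mul]; ring
    rw [this, hag t] at h3
    linarith
  have hcoord : ∀ t i, deriv (deriv γ) t i = -(ε * γ t i) := fun t i => by
    have h2 := hay t (Pi.single i 1)
    fin_cases i
    · simpa [form, Pi.single_apply] using h2
    · simpa [form, Pi.single_apply] using h2
    · simpa [form, Pi.single_apply] using h2
    · simp only [form, Pi.single_apply, Fin.reduceFinMk, Fin.reduceEq, if_false, if_true, mul_zero,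
        zero_mul, zero_add, one_mul, mul_one] at h2
      simp only [Fin.reduceFinMk]
      linear_combination ε * h2 - (deriv (deriv γ) t 3 + ε * γ t 3) * hε2
  ext i
  have := (eq_cn_add_sn (c := ε) (y := fun t => γ t i) (z := fun t => deriv γ t i)
    (fun t => hasDerivAt_pi.1 (hv t) i) (fun t => by
      rw [← hcoord t i]; exact hasDerivAt_pi.1 (ha t) i) t).1
  rw [(sn_cn_sign hε t).1, (sn_cn_sign hε t).2] at this
  rw [this]
  simp only [Pi.add_apply, Pi.smul_apply, smul_eq_mul]
  ring

theorem isGeodesic_gc_add_gs {ε : ℝ} (hε : ε = 1 ∨ ε = -1) {p v : R4} (hp : p ∈ spaceForm ε)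
    (hpv : form ε v p = 0) (hv : form ε v v = 1) :
    IsGeodesic ε (fun t => gc ε t • p + gs ε t • v) ∧
      deriv (fun t => gc ε t • p + gs ε t • v) 0 = v := by
  have hε2 : ε * ε = 1 := by rcases hε with rfl | rfl <;> norm_num
  have hd : ∀ t, HasDerivAt (fun t => gc ε t • p + gs ε t • v)
      (-(ε * gs ε t) • p + gc ε t • v) t := fun t =>
    ((hasDerivAt_gc hε t).smul_const p).add ((hasDerivAt_gs hε t).smul_const v)
  have hd1 : deriv (fun t => gc ε t • p + gs ε t • v) =
      fun t => -(ε * gs ε t) • p + gc ε t • v := funext fun t => (hd t).deriv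
  have hdd : ∀ t, HasDerivAt (fun t => -(ε * gs ε t) • p + gc ε t • v)
      (-(ε * gc ε t) • p + -(ε * gs ε t) • v) t := fun t =>
    ((((hasDerivAt_gs hε t).const_mul ε).neg).smul_const p).add ((hasDerivAt_gc hε t).smul_const v)
  refine ⟨⟨?_, fun t => ⟨?_, ?_⟩, fun t y hy => ?_⟩, ?_⟩
  · have hgc : ContDiff ℝ 2 (gc ε) :=
      contDiff_iff_contDiffAt.2 fun t => (analyticAt_gc ε t).contDiffAt
    have hgs : ContDiff ℝ 2 (gs ε) :=
      contDiff_iff_contDiffAt.2 fun t => (analyticAt_gs ε t).contDiffAt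
    exact (hgc.smul contDiff_const).add (hgs.smul contDiff_const)
  · have hexp : form ε (gc ε t • p + gs ε t • v) (gc ε t • p + gs ε t • v) =
        gc ε t ^ 2 * form ε p p + 2 * gc ε t * gs ε t * form ε v p +
          gs ε t ^ 2 * form ε v v := by
      simp only [form, Pi.add_apply, Pi.smul_apply, smul_eq_mul]; ring
    rw [hexp, hpv, hv, hp.1]
    linear_combination ε * gc_sq_add hε t - gs ε t ^ 2 * hε2
  · rintro rfl
    have hp3 := hp.2 rfl
    have hp1 := hp.1
    simp only [form] at hp1 hpv hv
    -- Lagrange's identity for the spatial parts gives p₄² > v₄², and cosh > |sinh| then keeps the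
    -- curve on the upper sheet.
    have hlt : v 3 ^ 2 < p 3 ^ 2 := by
      have e1 : p 0 * p 0 + p 1 * p 1 + p 2 * p 2 = p 3 ^ 2 - 1 := by linarith
      have e2 : v 0 * v 0 + v 1 * v 1 + v 2 * v 2 = 1 + v 3 ^ 2 := by linarith
      have e3 : v 0 * p 0 + v 1 * p 1 + v 2 * p 2 = v 3 * p 3 := by linarith
      have lagrange : (p 0 * p 0 + p 1 * p 1 + p 2 * p 2) * (v 0 * v 0 + v 1 * v 1 + v 2 * v 2) -
          (v 0 * p 0 + v 1 * p 1 + v 2 * p 2) ^ 2 = (p 0 * v 1 - p 1 * v 0) ^ 2 +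
          (p 0 * v 2 - p 2 * v 0) ^ 2 + (p 1 * v 2 - p 2 * v 1) ^ 2 := by ring
      rw [e1, e2, e3] at lagrange
      nlinarith [sq_nonneg (p 0 * v 1 - p 1 * v 0), sq_nonneg (p 0 * v 2 - p 2 * v 0),
        sq_nonneg (p 1 * v 2 - p 2 * v 1)]
    have hc := cosh_pos t
    have hcs := cosh_sq t
    simp only [Pi.add_apply, Pi.smul_apply, smul_eq_mul, gc_neg_one, gs_neg_one]
    have : |sinh t * v 3| < cosh t * p 3 := by
      apply abs_lt_of_sq_lt_sq _ (mul_pos hc hp3).le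
      rw [mul_pow, mul_pow, hcs]
      nlinarith [sq_nonneg (sinh t), sq_nonneg (v 3)]
    linarith [(abs_lt.1 this).1]
  · rw [hd1, (hdd t).deriv]
    have : form ε (-(ε * gc ε t) • p + -(ε * gs ε t) • v) y =
        -ε * form ε y (gc ε t • p + gs ε t • v) := by
      simp only [form, Pi.add_apply, Pi.smul_apply, smul_eq_mul]; ring
    rw [this, hy, mul_zero]
  · rw [(hd 0).deriv]
    simp

theorem exists_gc_gs_eq {ε C S : ℝ} (hε : ε = 1 ∨ ε = -1) (hC : 0 < C)
    (h : C ^ 2 + ε * S ^ 2 = 1) : ∃ t, gc ε t = C ∧ gs ε t = S := by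
  rcases hε with rfl | rfl
  · refine ⟨arcsin S, ?_, ?_⟩
    · rw [gc_one, cos_arcsin, show 1 - S ^ 2 = C ^ 2 by linarith, sqrt_sq hC.le]
    · rw [gs_one, sin_arcsin] <;> nlinarith
  · refine ⟨arsinh S, ?_, ?_⟩
    · rw [gc_neg_one, cosh_arsinh, show 1 + S ^ 2 = C ^ 2 by linarith, sqrt_sq hC.le]
    · rw [gs_neg_one, sinh_arsinh]

theorem mem_geodesicTrace_iff {ε : ℝ} (hε : ε = 1 ∨ ε = -1) {p v q : R4} (hp : p ∈ spaceForm ε)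
    (hpv : form ε v p = 0) (hv : form ε v v = 1) :
    q ∈ geodesicTrace ε p v ↔ ∃ t, q = gc ε t • p + gs ε t • v := by
  constructor
  · rintro ⟨γ, hγ, rfl, rfl, t, rfl⟩
    exact ⟨t, hγ.eq_gc_add_gs hε hv t⟩
  · rintro ⟨t, rfl⟩
    obtain ⟨h1, h2⟩ := isGeodesic_gc_add_gs hε hp hpv hv
    exact ⟨_, h1, by simp, h2, t, rfl⟩

/-! ### The intersection of the tangent geodesics with the axis -/

/-- The square of the norm of `x' ψ - x ψ_s`, up to sign. -/
noncomputable def axisNormSq (ε H δ D t : ℝ) : ℝ := vel1 ε H δ D t ^ 2 + ε * rad ε H δ D t ^ 2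

/-- The point in which the tangent geodesic of the profile curve meets the rotation axis. -/
noncomputable def axisPoint (ε H δ D t : ℝ) : R4 :=
  ![0, 0, -cross ε H δ D t * (√(axisNormSq ε H δ D t))⁻¹,
    -nor3 ε H δ D t * (√(axisNormSq ε H δ D t))⁻¹]

/-- Both sides are ε times the square norm of x ψ_s - x' ψ. At a zero of `cross` it equals `nor3`²,
so the tangent geodesic meets the axis also in hyperbolic space. -/
theorem Admissible.axisNormSq_eq {ε H δ D t : ℝ} (A : Admissible ε H δ D)
    (ht : t ∈ halfPeriod (freq ε H)) :
    axisNormSq ε H δ D t = ε * cross ε H δ D t ^ 2 + nor3 ε H δ D t ^ 2 := by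
  have h3 := A.dirCos_sq_add ht
  have h4 := A.hgt_sq ht
  have h5 := A.sign_sq
  have h6 := gc_sq_add A.sign (angle ε H δ D t)
  unfold axisNormSq vel1 cross nor3
  grind

/-- A point C ψ + S ψ_s lies on the axis only if (C, S) is proportional to (x', -x). The relation C²
+ εS² = 1 fixes the factor up to sign, and `nor3` < 0 makes positivity of the fourth coordinate
select the sign. -/
theorem isAxisPoint_axisPoint {ε H δ s : ℝ} (hε : ε = 1 ∨ ε = -1) (h : (H, δ) ∈ params ε)
    (hs : s ∈ halfPeriod (freq ε H)) (h1 : 0 < vel1 ε H δ (disc ε H δ) s)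
    (h2 : nor3 ε H δ (disc ε H δ) s < 0) (h3 : 0 < axisNormSq ε H δ (disc ε H δ) s) :
    IsAxisPoint ε H δ s (axisPoint ε H δ (disc ε H δ) s) ∧
      ∀ q, IsAxisPoint ε H δ s q → q = axisPoint ε H δ (disc ε H δ) s := by
  have A := admissible_disc hε h
  have hx := A.rad_pos s
  have e1 := A.rad_vel3_sub hs
  have e2 := A.rad_vel4_sub hs
  have hp := psi_mem_spaceForm hε h hs 0
  have hpv : form ε (partialS (psi ε H δ) s 0) (psi ε H δ s 0) = 0 := by
    rw [psi_eq hε h, partialS_psi hε h hs, form_rotVec, A.vel_pos hs]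
  have hv := form_partialS_psi_self hε h hs 0
  have hmem : ∀ q, q ∈ geodesicTrace ε (psi ε H δ s 0) (partialS (psi ε H δ) s 0) ↔ ∃ t,
      q = ![gc ε t * rad ε H δ (disc ε H δ) s + gs ε t * vel1 ε H δ (disc ε H δ) s, 0,
        gc ε t * pos3 ε H δ (disc ε H δ) s + gs ε t * vel3 ε H δ (disc ε H δ) s,
        gc ε t * pos4 ε H δ (disc ε H δ) s + gs ε t * vel4 ε H δ (disc ε H δ) s] := by
    intro q
    rw [mem_geodesicTrace_iff hε hp hpv hv, psi_eq hε h, partialS_psi hε h hs]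
    refine exists_congr fun t => ?_
    have : ∀ p q r p' q' r' : ℝ, gc ε t • rotVec p q r 0 + gs ε t • rotVec p' q' r' 0 =
        ![gc ε t * p + gs ε t * p', 0, gc ε t * q + gs ε t * q', gc ε t * r + gs ε t * r'] := by
      intros
      ext i
      fin_cases i <;> simp [rotVec]
    rw [this]
  set g := √(axisNormSq ε H δ (disc ε H δ) s) with hg
  have hg0 : 0 < g := sqrt_pos.2 h3
  have hg2 : g ^ 2 = vel1 ε H δ (disc ε H δ) s ^ 2 + ε * rad ε H δ (disc ε H δ) s ^ 2 :=
    sq_sqrt h3.le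
  have hform : axisPoint ε H δ (disc ε H δ) s = ![0, 0, -cross ε H δ (disc ε H δ) s * g⁻¹,
    -nor3 ε H δ (disc ε H δ) s * g⁻¹] := rfl
  rw [hform]
  generalize disc ε H δ = D at *
  constructor
  · obtain ⟨t, ht1, ht2⟩ := exists_gc_gs_eq (C := vel1 ε H δ D s * g⁻¹)
      (S := -rad ε H δ D s * g⁻¹) hε (by positivity) (by
        field_simp
        linarith)
    have htr := (hmem ![0, 0, -cross ε H δ D s * g⁻¹, -nor3 ε H δ D s * g⁻¹]).2 ⟨t, by
      rw [ht1, ht2, ← e1, ← e2]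
      ext i
      fin_cases i <;> simp <;> ring⟩
    refine ⟨⟨?_, rfl, rfl⟩, htr, ?_⟩
    · obtain ⟨γ, hγ, -, -, t, ht⟩ := htr
      rw [← ht]
      exact hγ.2.1 t
    · exact mul_pos (by linarith) (inv_pos.2 hg0)
  · rintro q ⟨⟨-, hq0, -⟩, hq, hq3⟩
    obtain ⟨t, rfl⟩ := (hmem q).1 hq
    simp only [Matrix.cons_val] at hq0 hq3
    have hcs := gc_sq_add hε t
    generalize gc ε t = C at *
    generalize gs ε t = S at *
    set l := -S / rad ε H δ D s with hl
    have hS : S = -(l * rad ε H δ D s) := by rw [hl]; field_simp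
    have hC : C = l * vel1 ε H δ D s := by
      apply mul_right_cancel₀ hx.ne'
      rw [hS] at hq0
      linear_combination hq0
    have h4 : (l * g) ^ 2 = 1 := by
      rw [mul_pow, hg2, ← hcs, hS, hC]; ring
    have h5 : 0 < l := by
      have : C * pos4 ε H δ D s + S * vel4 ε H δ D s = l * -nor3 ε H δ D s := by
        rw [hS, hC, ← e2]; ring
      rw [this] at hq3
      exact pos_of_mul_pos_left hq3 (by linarith)
    have h6 : l * g = 1 := by
      have := mul_pos h5 hg0
      nlinarith
    have h7 : g⁻¹ = l := inv_eq_of_mul_eq_one_left h6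
    rw [h7, hS, hC, ← e1, ← e2]
    ext i
    fin_cases i <;> simp <;> ring

/-! ### Dependence of the free boundary parameter on `H` and `δ` -/

theorem analyticAt_disc {ε : ℝ} {p : ℝ × ℝ} (h : 0 < 1 + 4 * p.1 * p.2 - 4 * ε * p.2 ^ 2) :
    AnalyticAt ℝ (fun p : ℝ × ℝ => disc ε p.1 p.2) p :=
  analyticAt_sqrt_comp ((analyticAt_const.add ((analyticAt_const.mul analyticAt_fst).mul
    analyticAt_snd)).sub (analyticAt_const.mul (analyticAt_snd.pow 2))) h

theorem continuous_disc (ε : ℝ) : Continuous fun p : ℝ × ℝ => disc ε p.1 p.2 := by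
  unfold disc; fun_prop

/-- An analytic function of `(x, t)` with non-vanishing derivative in `t` has an analytic
implicit function. -/
theorem exists_analyticAt_implicit {f : (ℝ × ℝ) × ℝ → ℝ} {p : ℝ × ℝ} {s d : ℝ}
    (hf : AnalyticAt ℝ f (p, s)) (hd : HasDerivAt (fun t => f (p, t)) d s) (hd0 : d ≠ 0) :
    ∃ g : ℝ × ℝ → ℝ, AnalyticAt ℝ g p ∧ g p = s ∧ ∀ᶠ q in 𝓝 p, f (q, g q) = f (p, s) := by
  -- The exponent `⊤` is the analytic class, so the implicit function obtained is analytic and not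
  -- merely smooth.
  have hcd : ContDiffAt ℝ ⊤ f (p, s) := hf.contDiffAt
  have hinv : (fderiv ℝ f (p, s) ∘L .inr ℝ (ℝ × ℝ) ℝ).IsInvertible := by
    refine ⟨ContinuousLinearEquiv.unitsEquivAut ℝ (Units.mk0 d hd0), ?_⟩
    ext
    have h1 : HasDerivAt (fun t : ℝ => (p, t)) ((0 : ℝ × ℝ), (1 : ℝ)) s :=
      (hasDerivAt_const s p).prodMk (hasDerivAt_id s)
    have h2 := (hf.differentiableAt.hasFDerivAt).comp_hasDerivAt s h1
    have h3 : fderiv ℝ f (p, s) (0, 1) = d := h2.unique hd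
    simp [h3]
  refine ⟨hcd.implicitFunction WithTop.top_ne_zero hinv,
    (hcd.contDiffAt_implicitFunction WithTop.top_ne_zero hinv).analyticAt,
    hcd.implicitFunction_apply_self WithTop.top_ne_zero hinv,
    hcd.eventually_apply_implicitFunction WithTop.top_ne_zero hinv⟩

section Joint

variable {E : Type*} [TopologicalSpace E] {ε : ℝ} {H δ D t : E → ℝ} {x : E}

/-- Continuity in all parameters of the functions that define `InRegion`. -/
theorem continuousAt_angle_comp (A : Admissible ε (H x) (δ x) (D x))
    (hx : t x ∈ halfPeriod (freq ε (H x))) (hH : ContinuousAt H x) (hδ : ContinuousAt δ x)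
    (hD : ContinuousAt D x) (ht : ContinuousAt t x) :
    ContinuousAt (fun y => angle ε (H y) (δ y) (D y) (t y)) x :=
  ContinuousAt.comp_of_eq (g := fun q : (ℝ × ℝ × ℝ) × ℝ => angle ε q.1.1 q.1.2.1 q.1.2.2 q.2)
    (f := fun y => ((H y, δ y, D y), t y)) (analyticAt_angle A hx).continuousAt
    ((hH.prodMk (hδ.prodMk hD)).prodMk ht) rfl

theorem continuousAt_cross_comp (A : Admissible ε (H x) (δ x) (D x))
    (hx : t x ∈ halfPeriod (freq ε (H x))) (hH : ContinuousAt H x) (hδ : ContinuousAt δ x)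
    (hD : ContinuousAt D x) (ht : ContinuousAt t x) :
    ContinuousAt (fun y => cross ε (H y) (δ y) (D y) (t y)) x := by
  have h1 : AnalyticAt ℝ (fun q : (ℝ × ℝ × ℝ) × ℝ => q.1.1) ((H x, δ x, D x), t x) :=
    analyticAt_fst.comp_of_eq analyticAt_fst rfl
  have h2 : AnalyticAt ℝ (fun q : (ℝ × ℝ × ℝ) × ℝ => q.1.2.1) ((H x, δ x, D x), t x) :=
    analyticAt_fst.comp_of_eq (analyticAt_snd.comp_of_eq analyticAt_fst rfl) rfl
  have h3 : AnalyticAt ℝ (fun q : (ℝ × ℝ × ℝ) × ℝ => q.1.2.2) ((H x, δ x, D x), t x) :=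
    analyticAt_snd.comp_of_eq (analyticAt_snd.comp_of_eq analyticAt_fst rfl) rfl
  exact ContinuousAt.comp_of_eq
    (g := fun q : (ℝ × ℝ × ℝ) × ℝ => cross ε q.1.1 q.1.2.1 q.1.2.2 q.2)
    (f := fun y => ((H y, δ y, D y), t y))
    (analyticAt_cross_comp (H := fun q : (ℝ × ℝ × ℝ) × ℝ => q.1.1) (δ := fun q => q.1.2.1)
      (D := fun q => q.1.2.2) (t := fun q => q.2) (x := ((H x, δ x, D x), t x)) ε A h1 h2 h3 analyticAt_snd hx).continuousAt
    ((hH.prodMk (hδ.prodMk hD)).prodMk ht) rfl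

theorem continuousAt_tilt_comp (A : Admissible ε (H x) (δ x) (D x))
    (hH : ContinuousAt H x) (hδ : ContinuousAt δ x)
    (hD : ContinuousAt D x) (ht : ContinuousAt t x) :
    ContinuousAt (fun y => tilt ε (H y) (δ y) (D y) (t y)) x := by
  have h1 : AnalyticAt ℝ (fun q : (ℝ × ℝ × ℝ) × ℝ => q.1.1) ((H x, δ x, D x), t x) :=
    analyticAt_fst.comp_of_eq analyticAt_fst rfl
  have h2 : AnalyticAt ℝ (fun q : (ℝ × ℝ × ℝ) × ℝ => q.1.2.1) ((H x, δ x, D x), t x) :=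
    analyticAt_fst.comp_of_eq (analyticAt_snd.comp_of_eq analyticAt_fst rfl) rfl
  have h3 : AnalyticAt ℝ (fun q : (ℝ × ℝ × ℝ) × ℝ => q.1.2.2) ((H x, δ x, D x), t x) :=
    analyticAt_snd.comp_of_eq (analyticAt_snd.comp_of_eq analyticAt_fst rfl) rfl
  exact ContinuousAt.comp_of_eq
    (g := fun q : (ℝ × ℝ × ℝ) × ℝ => tilt ε q.1.1 q.1.2.1 q.1.2.2 q.2)
    (f := fun y => ((H y, δ y, D y), t y))
    (analyticAt_tilt_comp (H := fun q : (ℝ × ℝ × ℝ) × ℝ => q.1.1) (δ := fun q => q.1.2.1)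
      (D := fun q => q.1.2.2) (t := fun q => q.2) (x := ((H x, δ x, D x), t x)) ε h1 h2 h3 analyticAt_snd A.denom_pos.ne').continuousAt
    ((hH.prodMk (hδ.prodMk hD)).prodMk ht) rfl

theorem eventually_mem_halfPeriod (hx : t x ∈ halfPeriod (freq ε (H x))) (hH : ContinuousAt H x)
    (ht : ContinuousAt t x) : ∀ᶠ y in 𝓝 x, t y ∈ halfPeriod (freq ε (H y)) := by
  have : ContinuousAt (fun y => freq ε (H y) * t y ^ 2) x := by
    unfold freq; fun_prop
  exact this.eventually_lt continuousAt_const hx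

end Joint

/-- The conditions defining the region are open, so the implicit solution of `cross` = 0 stays in
the region, and uniqueness identifies it with the chosen parameter. Analyticity is relative to
`params ε`, which contains its boundary points H = 0. -/
theorem analyticOn_freeBoundaryParam {ε : ℝ} (hε : ε = 1 ∨ ε = -1) :
    AnalyticOn ℝ (freeBoundaryParam ε) (params ε) := by
  rintro ⟨H, δ⟩ h
  have A := admissible_disc hε h
  have hD := disc_pos hε h
  obtain ⟨R, hc⟩ := freeBoundaryParam_spec hε h
  set s := freeBoundaryParam ε (H, δ) with hs
  have hf : AnalyticAt ℝ (fun q : (ℝ × ℝ) × ℝ => cross ε q.1.1 q.1.2 (disc ε q.1.1 q.1.2) q.2)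
      ((H, δ), s) := by
    refine analyticAt_cross_comp (H := fun q : (ℝ × ℝ) × ℝ => q.1.1) (δ := fun q => q.1.2)
      (D := fun q => disc ε q.1.1 q.1.2) (t := fun q => q.2) ε A
      (analyticAt_fst.comp_of_eq analyticAt_fst rfl)
      (analyticAt_snd.comp_of_eq analyticAt_fst rfl) ?_ analyticAt_snd R.half
    exact (analyticAt_disc (p := (H, δ)) (disc_sq_pos hε h)).comp_of_eq
      (f := fun q : (ℝ × ℝ) × ℝ => q.1) analyticAt_fst rfl
  obtain ⟨g, hg, hgs, hgc⟩ := exists_analyticAt_implicit hf (A.hasDerivAt_cross R.half)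
    (R.cross_deriv_neg A hD).ne
  have cH : ContinuousAt (fun p : ℝ × ℝ => p.1) (H, δ) := continuousAt_fst
  have cδ : ContinuousAt (fun p : ℝ × ℝ => p.2) (H, δ) := continuousAt_snd
  have cD : ContinuousAt (fun p : ℝ × ℝ => disc ε p.1 p.2) (H, δ) :=
    (continuous_disc ε).continuousAt
  have hhalf : g (H, δ) ∈ halfPeriod (freq ε H) := by rw [hgs]; exact R.half
  have e1 : ∀ᶠ p in 𝓝 (H, δ), 0 < g p :=
    continuousAt_const.eventually_lt hg.continuousAt (by rw [hgs]; exact R.pos)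
  have e2 := eventually_mem_halfPeriod (ε := ε) (x := (H, δ)) (t := g) hhalf cH hg.continuousAt
  have e3 : ∀ᶠ p in 𝓝 (H, δ), 0 < tilt ε p.1 p.2 (disc ε p.1 p.2) (g p) :=
    continuousAt_const.eventually_lt (continuousAt_tilt_comp (x := (H, δ)) (t := g) A cH cδ cD
      hg.continuousAt) (by rw [hgs]; exact R.tilt_pos)
  have e4 : ∀ᶠ p in 𝓝 (H, δ), ε = 1 → angle ε p.1 p.2 (disc ε p.1 p.2) (g p) < π / 2 := by
    by_cases h1 : ε = 1
    · have := (continuousAt_angle_comp (x := (H, δ)) (t := g) A hhalf cH cδ cD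
        hg.continuousAt).eventually_lt (continuousAt_const (y := π / 2))
        (by rw [hgs]; exact R.angle_lt h1)
      exact this.mono fun _ hp _ => hp
    · exact Filter.Eventually.of_forall fun _ hp => absurd hp h1
  refine (hg.analyticWithinAt (s := params ε)).congr_of_eventuallyEq ?_ (by rw [hgs])
  filter_upwards [nhdsWithin_le_nhds e1, nhdsWithin_le_nhds e2, nhdsWithin_le_nhds e3,
    nhdsWithin_le_nhds e4, nhdsWithin_le_nhds hgc, self_mem_nhdsWithin] with p h1 h2 h3 h4 h5 hp
  exact freeBoundaryParam_eq hε hp ⟨h1, h2, h3, h4⟩ (h5.trans hc)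

/-! ### The limit at the flat tori -/

section Torus

variable {H : ℝ}

theorem mu_one_facts (hH : 0 ≤ H) : 0 < mu 1 H ∧ mu 1 H ^ 2 = H ^ 2 + 1 ∧ H < mu 1 H := by
  have h1 : 0 < mu 1 H := sqrt_pos.2 (by positivity)
  have h2 : mu 1 H ^ 2 = H ^ 2 + 1 := sq_sqrt (by positivity)
  exact ⟨h1, h2, by nlinarith⟩

theorem admissible_torus (hH : 0 ≤ H) : Admissible 1 H ((H + mu 1 H) / 2) 0 where
  sign := Or.inl rfl
  H_nonneg := hH
  δ_pos := by linarith [(mu_one_facts hH).1]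
  D_nonneg := le_rfl
  D_sq := by linear_combination (mu_one_facts hH).2.1

theorem disc_torus (hH : 0 ≤ H) : disc 1 H ((H + mu 1 H) / 2) = 0 := by
  unfold disc
  rw [← (admissible_torus hH).D_sq]
  simp

theorem radSq_torus (hH : 0 ≤ H) (t : ℝ) :
    radSq 1 H ((H + mu 1 H) / 2) 0 t = (H + mu 1 H) / (2 * mu 1 H) := by
  obtain ⟨h1, h2, h3⟩ := mu_one_facts hH
  have h4 : 1 + 2 * H * ((H + mu 1 H) / 2) + 0 = mu 1 H * (H + mu 1 H) := by
    linear_combination -h2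
  have h5 : 0 < H + mu 1 H := by linarith
  simp only [radSq, radSqMin, h4]
  field_simp
  ring

/-- The value of the free boundary parameter in the limit of the flat tori. -/
noncomputable def torusParam (H : ℝ) : ℝ := π / (2 * √(2 * mu 1 H * (H + mu 1 H)))

theorem torusParam_pos (hH : 0 ≤ H) : 0 < torusParam H := by
  have h1 := (mu_one_facts hH).1
  unfold torusParam
  positivity

theorem torusParam_mem_halfPeriod (hH : 0 ≤ H) : torusParam H ∈ halfPeriod (freq 1 H) := by
  obtain ⟨h1, h2, h3⟩ := mu_one_facts hH
  have h4 : 0 < 2 * mu 1 H * (H + mu 1 H) := by positivity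
  simp only [halfPeriod, mem_ofPred_eq, torusParam, freq]
  rw [← h2, div_pow, mul_pow, sq_sqrt h4.le, ← mul_div_assoc, div_lt_div_iff₀ (by positivity)
    (by norm_num)]
  have := pow_pos pi_pos 2
  have h5 : mu 1 H ^ 2 < 2 * mu 1 H * (H + mu 1 H) := by nlinarith
  nlinarith

theorem angle_torus (hH : 0 ≤ H) (t : ℝ) :
    angle 1 H ((H + mu 1 H) / 2) 0 t = π / 2 * (t / torusParam H) := by
  obtain ⟨h1, h2, h3⟩ := mu_one_facts hH
  have A := admissible_torus hH
  have h4 : 0 < 2 * mu 1 H * (H + mu 1 H) := by positivity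
  have h5 : 0 < H + mu 1 H := by linarith
  unfold angle
  simp only [rad, tilt, radSq_torus hH]
  rw [intervalIntegral.integral_const, smul_eq_mul, sub_zero, torusParam]
  have h6 : √((H + mu 1 H) / (2 * mu 1 H)) =
      (H + mu 1 H) / √(2 * mu 1 H * (H + mu 1 H)) := by
    rw [eq_div_iff (sqrt_pos.2 h4).ne', ← sqrt_mul (by positivity)]
    rw [show (H + mu 1 H) / (2 * mu 1 H) * (2 * mu 1 H * (H + mu 1 H)) = (H + mu 1 H) ^ 2 by
      field_simp]
    exact sqrt_sq h5.le
  have h7 : 0 < √(2 * mu 1 H * (H + mu 1 H)) := sqrt_pos.2 h4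
  have h8 : (H + mu 1 H) / 2 - H * ((H + mu 1 H) / (2 * mu 1 H)) = 1 / (2 * mu 1 H) := by
    field_simp
    linear_combination h2
  have h9 : 1 - 1 * ((H + mu 1 H) / (2 * mu 1 H)) = 1 / (2 * mu 1 H * (H + mu 1 H)) := by
    field_simp
    linear_combination h2
  rw [h6, h8, h9]
  have hpi := pi_ne_zero
  field_simp

/-- At D = 0 the radius is constant and `dirCos` vanishes, so only a cosine of a linear angle
remains. Its first positive zero is where the angle equals π/2. -/
theorem cross_torus (hH : 0 ≤ H) (t : ℝ) : cross 1 H ((H + mu 1 H) / 2) 0 t =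
    dirSin 1 H ((H + mu 1 H) / 2) 0 t * rad 1 H ((H + mu 1 H) / 2) 0 t *
      cos (π / 2 * (t / torusParam H)) := by
  simp [cross, dirCos, halfDer, angle_torus hH, gc_one]

theorem tilt_torus_pos (hH : 0 ≤ H) (t : ℝ) : 0 < tilt 1 H ((H + mu 1 H) / 2) 0 t := by
  have h := (admissible_torus hH).tilt_zero_pos
  simpa [tilt, radSq] using h

/-- Near a flat torus, a sign change of `cross` brackets the free boundary parameter. -/
theorem freeBoundaryParam_mem_Ioo {H δ a b : ℝ} (h : (H, δ) ∈ params 1) (ha : 0 < a)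
    (hab : a ≤ b) (hb : b ∈ halfPeriod (freq 1 H)) (hw : 0 < tilt 1 H δ (disc 1 H δ) b)
    (hφ : angle 1 H δ (disc 1 H δ) b < π) (h1 : 0 < cross 1 H δ (disc 1 H δ) a)
    (h2 : cross 1 H δ (disc 1 H δ) b < 0) : freeBoundaryParam 1 (H, δ) ∈ Ioo a b := by
  have A := admissible_disc (Or.inl rfl) h
  have hD := disc_pos (Or.inl rfl) h
  have hb0 : 0 < b := ha.trans_le hab
  obtain ⟨s, hs, hs0⟩ := intermediate_value_Icc' hab
    ((A.continuousOn_cross hb hb0).mono (Icc_subset_Icc_left ha.le)) ⟨h2.le, h1.le⟩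
  have hsa : a < s := hs.1.lt_of_ne fun e => by
    rw [e, hs0] at h1
    exact lt_irrefl _ h1
  have hsb : s < b := hs.2.lt_of_ne fun e => by
    rw [← e, hs0] at h2
    exact lt_irrefl _ h2
  have hs1 : 0 < s := ha.trans hsa
  have hp := mem_halfPeriod_of_mem_Icc hb ⟨by linarith, hsb.le⟩
  have hwr : ∀ r ∈ Ioo 0 b, 0 < tilt 1 H δ (disc 1 H δ) r := fun r hr =>
    A.tilt_pos_of_le hb hw hr.1.le hr.2.le
  have hφs := (A.angle_lt hb hwr hs1.le hsb).trans hφ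
  have hφ0 := A.angle_pos hp (fun r hr => hwr r ⟨hr.1, hr.2.trans hsb⟩) hs1
  have R : InRegion 1 H δ (disc 1 H δ) s := by
    refine ⟨hs1, hp, hwr s ⟨hs1, hsb⟩, fun _ => ?_⟩
    -- Only φ < π is known at the zero. If φ ≥ π/2, both terms of `cross` would be nonpositive and
    -- the one with `dirCos` sin φ strictly negative, so `cross` could not vanish.
    by_contra! hle
    have e1 := mul_pos ((A.dirSin_pos_iff hp).2 (hwr s ⟨hs1, hsb⟩)) (A.rad_pos s)
    have e2 := mul_pos (A.dirCos_pos hD hp hs1) (sin_pos_of_pos_of_lt_pi hφ0 hφs)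
    have e3 := cos_nonpos_of_pi_div_two_le_of_le hle (by linarith [pi_pos])
    simp only [cross, gs_one, gc_one] at hs0
    nlinarith
  rw [freeBoundaryParam_eq (Or.inl rfl) h R hs0]
  exact ⟨hsa, hsb⟩

/-- The signs of `cross` at two times a < b around the limit value persist for nearby parameters and
bracket the zero. Taking b below twice the limit value keeps the limiting angle below π. -/
theorem tendsto_freeBoundaryParam_torus (hH : 0 ≤ H) :
    Filter.Tendsto (freeBoundaryParam 1) (𝓝[params 1] (H, (H + mu 1 H) / 2))
      (𝓝 (torusParam H)) := by
  have A := admissible_torus hH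
  have hs0 := torusParam_pos hH
  have hhalf := torusParam_mem_halfPeriod hH
  have hdisc := disc_torus hH
  rw [Metric.tendsto_nhds]
  intro e he
  have hopen : IsOpen (halfPeriod (freq 1 H) ∩ Ioo 0 (2 * torusParam H)) :=
    (isOpen_halfPeriod _).inter isOpen_Ioo
  obtain ⟨r, hr, hball⟩ := Metric.isOpen_iff.1 hopen (torusParam H)
    ⟨hhalf, hs0, by linarith⟩
  set d := min e r / 2 with hd
  have hd0 : 0 < d := by have := lt_min he hr; positivity
  have hde : d < e := by have := min_le_left e r; have := lt_min he hr; linarith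
  have hdr : d < r := by have := min_le_right e r; have := lt_min he hr; linarith
  have ha := hball (show torusParam H - d ∈ Metric.ball (torusParam H) r by
    rw [Real.ball_eq_Ioo]; constructor <;> linarith)
  have hb := hball (show torusParam H + d ∈ Metric.ball (torusParam H) r by
    rw [Real.ball_eq_Ioo]; constructor <;> linarith)
  set a := torusParam H - d
  set b := torusParam H + d
  have hpos : ∀ t ∈ halfPeriod (freq 1 H), 0 < dirSin 1 H ((H + mu 1 H) / 2) 0 t *
      rad 1 H ((H + mu 1 H) / 2) 0 t := fun t ht =>
    mul_pos ((A.dirSin_pos_iff ht).2 (tilt_torus_pos hH t)) (A.rad_pos t)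
  have hdiv : ∀ t, t / torusParam H * torusParam H = t := fun t => div_mul_cancel₀ _ hs0.ne'
  have hca : 0 < cross 1 H ((H + mu 1 H) / 2) 0 a := by
    rw [cross_torus hH]
    refine mul_pos (hpos a ha.1) (cos_pos_of_mem_Ioo ⟨?_, ?_⟩)
    · have : 0 < a / torusParam H := div_pos ha.2.1 hs0
      have := mul_pos pi_pos this
      linarith [pi_pos]
    · have : a / torusParam H < 1 := by rw [div_lt_one hs0]; linarith
      nlinarith [pi_pos]
  have hcb : cross 1 H ((H + mu 1 H) / 2) 0 b < 0 := by
    rw [cross_torus hH]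
    refine mul_neg_of_pos_of_neg (hpos b hb.1) (cos_neg_of_pi_div_two_lt_of_lt ?_ ?_)
    · have : 1 < b / torusParam H := by rw [one_lt_div hs0]; linarith
      nlinarith [pi_pos]
    · have : b / torusParam H < 2 := by rw [div_lt_iff₀ hs0]; exact hb.2.2
      nlinarith [pi_pos]
  have hφb : angle 1 H ((H + mu 1 H) / 2) 0 b < π := by
    rw [angle_torus hH]
    have : b / torusParam H < 2 := by rw [div_lt_iff₀ hs0]; exact hb.2.2
    nlinarith [pi_pos]
  have A' : Admissible 1 H ((H + mu 1 H) / 2) (disc 1 H ((H + mu 1 H) / 2)) := by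
    rw [hdisc]; exact A
  have cH : ContinuousAt (fun p : ℝ × ℝ => p.1) (H, (H + mu 1 H) / 2) := continuousAt_fst
  have cδ : ContinuousAt (fun p : ℝ × ℝ => p.2) (H, (H + mu 1 H) / 2) := continuousAt_snd
  have cD : ContinuousAt (fun p : ℝ × ℝ => disc 1 p.1 p.2) (H, (H + mu 1 H) / 2) :=
    (continuous_disc 1).continuousAt
  have e1 := eventually_mem_halfPeriod (ε := 1) (x := (H, (H + mu 1 H) / 2)) (t := fun _ => b)
    hb.1 cH continuousAt_const
  have e2 : ∀ᶠ p in 𝓝 (H, (H + mu 1 H) / 2), 0 < tilt 1 p.1 p.2 (disc 1 p.1 p.2) b :=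
    continuousAt_const.eventually_lt (continuousAt_tilt_comp (x := (H, (H + mu 1 H) / 2))
      (t := fun _ => b) A' cH cδ cD continuousAt_const)
      (by simp only [hdisc]; exact tilt_torus_pos hH b)
  have e3 : ∀ᶠ p in 𝓝 (H, (H + mu 1 H) / 2), angle 1 p.1 p.2 (disc 1 p.1 p.2) b < π :=
    (continuousAt_angle_comp (x := (H, (H + mu 1 H) / 2)) (t := fun _ => b) A' hb.1 cH cδ cD
      continuousAt_const).eventually_lt continuousAt_const (by simp only [hdisc]; exact hφb)
  have e4 : ∀ᶠ p in 𝓝 (H, (H + mu 1 H) / 2), 0 < cross 1 p.1 p.2 (disc 1 p.1 p.2) a :=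
    continuousAt_const.eventually_lt (continuousAt_cross_comp (x := (H, (H + mu 1 H) / 2))
      (t := fun _ => a) A' ha.1 cH cδ cD continuousAt_const) (by simp only [hdisc]; exact hca)
  have e5 : ∀ᶠ p in 𝓝 (H, (H + mu 1 H) / 2), cross 1 p.1 p.2 (disc 1 p.1 p.2) b < 0 :=
    (continuousAt_cross_comp (x := (H, (H + mu 1 H) / 2)) (t := fun _ => b) A' hb.1 cH cδ cD
      continuousAt_const).eventually_lt continuousAt_const (by simp only [hdisc]; exact hcb)
  filter_upwards [nhdsWithin_le_nhds e1, nhdsWithin_le_nhds e2, nhdsWithin_le_nhds e3,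
    nhdsWithin_le_nhds e4, nhdsWithin_le_nhds e5, self_mem_nhdsWithin] with p h1 h2 h3 h4 h5 hp
  have := freeBoundaryParam_mem_Ioo hp ha.2.1 (show a ≤ b by simp only [a, b]; linarith)
    h1 h2 h3 h4 h5
  rw [Real.dist_eq, abs_lt]
  constructor
  · have := this.1; simp only [a] at this; linarith
  · have := this.2; simp only [b] at this; linarith

theorem continuousOn_extended_freeBoundaryParam :
    ContinuousOn (fun p : ℝ × ℝ => if p.2 = (p.1 + mu 1 p.1) / 2 then
      π / (2 * √(2 * mu 1 p.1 * (p.1 + mu 1 p.1))) else freeBoundaryParam 1 p)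
      {p : ℝ × ℝ | 0 ≤ p.1 ∧ 0 < p.2 ∧ p.2 ≤ (p.1 + mu 1 p.1) / 2} := by
  set F : ℝ × ℝ → ℝ := fun p => if p.2 = (p.1 + mu 1 p.1) / 2 then
      π / (2 * √(2 * mu 1 p.1 * (p.1 + mu 1 p.1))) else freeBoundaryParam 1 p with hF
  have hmu : Continuous (mu 1) := by unfold mu; fun_prop
  have hFp : ∀ p ∈ params 1, F p = freeBoundaryParam 1 p := fun p hp =>
    if_neg (hp.2.2 rfl).ne
  have hsub : {p : ℝ × ℝ | 0 ≤ p.1 ∧ 0 < p.2 ∧ p.2 ≤ (p.1 + mu 1 p.1) / 2} ⊆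
      params 1 ∪ {p | 0 ≤ p.1 ∧ p.2 = (p.1 + mu 1 p.1) / 2} := by
    rintro p ⟨h1, h2, h3⟩
    rcases h3.eq_or_lt with h | h
    · exact Or.inr ⟨h1, h⟩
    · exact Or.inl ⟨h1, h2, fun _ => h⟩
  rintro ⟨H, δ⟩ hp
  have hH : 0 ≤ H := hp.1
  rcases hsub hp with h | ⟨-, h⟩
  · have h1 : ContinuousWithinAt F (params 1) (H, δ) :=
      (analyticOn_freeBoundaryParam (Or.inl rfl) _ h).continuousWithinAt.congr hFp (hFp _ h)
    refine h1.mono_of_mem_nhdsWithin ?_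
    have hopen : IsOpen {p : ℝ × ℝ | p.2 < (p.1 + mu 1 p.1) / 2} :=
      isOpen_lt continuous_snd (by fun_prop)
    filter_upwards [self_mem_nhdsWithin, nhdsWithin_le_nhds (hopen.mem_nhds (h.2.2 rfl))]
      with p h2 h3
    exact ⟨h2.1, h2.2.1, fun _ => h3⟩
  · obtain rfl : δ = (H + mu 1 H) / 2 := h
    have hval : F (H, (H + mu 1 H) / 2) = torusParam H := if_pos rfl
    refine ContinuousWithinAt.mono (ContinuousWithinAt.union ?_ ?_) hsub
    · have h1 := tendsto_freeBoundaryParam_torus hH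
      rw [← hval] at h1
      exact h1.congr' (eventually_nhdsWithin_of_forall fun p hp => (hFp p hp).symm)
    · have h1 : ContinuousAt (fun p : ℝ × ℝ => torusParam p.1) (H, (H + mu 1 H) / 2) := by
        have h2 := (mu_one_facts hH).1
        unfold torusParam
        refine ContinuousAt.div continuousAt_const (by fun_prop) ?_
        have : 0 < 2 * √(2 * mu 1 H * (H + mu 1 H)) := by positivity
        exact this.ne'
      exact h1.continuousWithinAt.congr (fun p hp => if_pos hp.2) hval

end Torus

/-! ### The axis points near the free boundary parameter -/

/-- The sign conditions of `isAxisPoint_axisPoint` hold at s₀ and are open. At s₀ the derivative of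
-`cross` divided by the norm reduces to -`cross`' over the norm, because `cross` vanishes there; it
is positive since `cross` decreases. -/
theorem exists_axisPoint_nhds {ε H δ : ℝ} (hε : ε = 1 ∨ ε = -1) (h : (H, δ) ∈ params ε) {s₀ : ℝ}
    (R : InRegion ε H δ (disc ε H δ) s₀) (hc : cross ε H δ (disc ε H δ) s₀ = 0) :
    ∃ I : Set ℝ, IsOpen I ∧ s₀ ∈ I ∧ ∃ p : ℝ → R4,
      (∀ s ∈ I, IsAxisPoint ε H δ s (p s) ∧ ∀ q, IsAxisPoint ε H δ s q → q = p s) ∧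
      AnalyticOnNhd ℝ p I ∧ p s₀ 2 = 0 ∧ 0 < deriv (fun s => p s 2) s₀ := by
  have A := admissible_disc hε h
  have hD := disc_pos hε h
  have hcos := A.dirCos_pos hD R.half R.pos
  have hcross : ∀ s ∈ halfPeriod (freq ε H), AnalyticAt ℝ (cross ε H δ (disc ε H δ)) s :=
    fun s hs => analyticAt_cross_comp (H := fun _ => H) (δ := fun _ => δ)
      (D := fun _ => disc ε H δ) (t := fun t => t) ε A
      analyticAt_const analyticAt_const analyticAt_const analyticAt_id hs
  have hvel : ∀ s ∈ halfPeriod (freq ε H), AnalyticAt ℝ (vel1 ε H δ (disc ε H δ)) s :=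
    fun s hs => (analyticAt_dirCos_comp (H := fun _ => H) (δ := fun _ => δ)
      (D := fun _ => disc ε H δ) (t := fun t => t) ε A
      analyticAt_const analyticAt_const analyticAt_const analyticAt_id hs).mul
      (analyticAt_hgt_comp (H := fun _ => H) (δ := fun _ => δ)
      (D := fun _ => disc ε H δ) (t := fun t => t) ε A
      analyticAt_const analyticAt_const analyticAt_const analyticAt_id hs)
  have hnor : ∀ s ∈ halfPeriod (freq ε H), AnalyticAt ℝ (nor3 ε H δ (disc ε H δ)) s :=
    fun s hs => (analyticAt_nor_curve hε h hs).2.1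
  have hnsq : ∀ s ∈ halfPeriod (freq ε H), AnalyticAt ℝ (axisNormSq ε H δ (disc ε H δ)) s :=
    fun s hs => ((hvel s hs).pow 2).add
      (analyticAt_const.mul ((analyticAt_pos_curve hε h hs).1.pow 2))
  have hinv : ∀ s ∈ halfPeriod (freq ε H), 0 < axisNormSq ε H δ (disc ε H δ) s →
      AnalyticAt ℝ (fun s => (√(axisNormSq ε H δ (disc ε H δ) s))⁻¹) s := fun s hs h0 =>
    (analyticAt_sqrt_comp (hnsq s hs) h0).inv (sqrt_pos.2 h0).ne'
  have hn0 : nor3 ε H δ (disc ε H δ) s₀ < 0 := by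
    have h1 := A.nor3_mul_gc hc
    have h2 := R.gc_pos A
    nlinarith
  have hg0 : 0 < axisNormSq ε H δ (disc ε H δ) s₀ := by
    rw [A.axisNormSq_eq R.half, hc]
    have := pow_pos (neg_pos.2 hn0) 2
    linarith
  have ev : ∀ᶠ s in 𝓝 s₀, s ∈ halfPeriod (freq ε H) ∧ 0 < vel1 ε H δ (disc ε H δ) s ∧
      nor3 ε H δ (disc ε H δ) s < 0 ∧ 0 < axisNormSq ε H δ (disc ε H δ) s := by
    have hev : ∀ᶠ s in 𝓝 s₀, s ∈ halfPeriod (freq ε H) :=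
      (isOpen_halfPeriod _).mem_nhds R.half
    refine hev.and (Filter.Eventually.and ?_ (Filter.Eventually.and ?_ ?_))
    · exact continuousAt_const.eventually_lt (hvel s₀ R.half).continuousAt
        (mul_pos hcos (A.hgt_pos R.half))
    · exact (hnor s₀ R.half).continuousAt.eventually_lt continuousAt_const hn0
    · exact continuousAt_const.eventually_lt (hnsq s₀ R.half).continuousAt hg0
  obtain ⟨I, hI, hIo, hI0⟩ := mem_nhds_iff.1 ev
  refine ⟨I, hIo, hI0, axisPoint ε H δ (disc ε H δ), fun s hs => ?_, fun s hs => ?_, ?_, ?_⟩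
  · obtain ⟨h1, h2, h3, h4⟩ := hI hs
    exact isAxisPoint_axisPoint hε h h1 h2 h3 h4
  · obtain ⟨h1, h2, h3, h4⟩ := hI hs
    have : AnalyticAt ℝ (fun s => axisPoint ε H δ (disc ε H δ) s) s := by
      rw [analyticAt_pi_iff]
      intro i
      fin_cases i
      · exact analyticAt_const
      · exact analyticAt_const
      · exact (hcross s h1).neg.mul (hinv s h1 h4)
      · exact (hnor s h1).neg.mul (hinv s h1 h4)
    exact this
  · simp [axisPoint, hc]
  · have hk := (hinv s₀ R.half hg0).differentiableAt.hasDerivAt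
    have hd := ((A.hasDerivAt_cross R.half).neg).mul hk
    have hd' : HasDerivAt (fun s => axisPoint ε H δ (disc ε H δ) s 2)
        (-(ε * (curv ε H δ (disc ε H δ) s₀ * vel4 ε H δ (disc ε H δ) s₀)) *
          (√(axisNormSq ε H δ (disc ε H δ) s₀))⁻¹) s₀ := by
      convert! hd using 1
      simp [hc]
    rw [hd'.deriv]
    exact mul_pos (by linarith [R.cross_deriv_neg A hD]) (inv_pos.2 (sqrt_pos.2 hg0))

theorem exists_normal_of_inRegion {ε H δ : ℝ} (hε : ε = 1 ∨ ε = -1) (h : (H, δ) ∈ params ε)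
    {s₀ : ℝ} (R : InRegion ε H δ (disc ε H δ) s₀) :
    ∃ η > 0, ∃ N : ℝ → ℝ → R4, ∃ κ : ℝ → ℝ,
      IsUnitNormal ε (psi ε H δ) N (Ioo (-(s₀ + η)) (s₀ + η)) ∧
      (∀ s ∈ Ioo (-(s₀ + η)) (s₀ + η), ∀ θ : ℝ, meanCurvature ε (psi ε H δ) N s θ = H) ∧
      IsProfilePrincipalCurvature (psi ε H δ) N (Ioo (-(s₀ + η)) (s₀ + η)) κ ∧
      StrictAntiOn κ (Ico 0 (s₀ + η)) := by
  obtain ⟨r, hr, hball⟩ := Metric.isOpen_iff.1 (isOpen_halfPeriod (freq ε H)) s₀ R.half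
  have hb : s₀ + r / 2 ∈ halfPeriod (freq ε H) := hball (by
    rw [Real.ball_eq_Ioo]; constructor <;> linarith)
  have hI : Ioo (-(s₀ + r / 2)) (s₀ + r / 2) ⊆ halfPeriod (freq ε H) := fun s hs =>
    mem_halfPeriod_of_mem_Icc hb (Ioo_subset_Icc_self hs)
  exact ⟨r / 2, by positivity, normalField ε H δ, curv ε H δ (disc ε H δ),
    isUnitNormal_normalField hε h hI, fun s hs θ => meanCurvature_psi hε h (hI hs) θ,
    isProfilePrincipalCurvature_psi hε h hI, strictAntiOn_curv hε h hb⟩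

end RotationalCMC

/-! ### The proposition -/

theorem proposition5p5 (ε : ℝ) (hε : ε = 1 ∨ ε = -1) :
    -- the solution `x(s)` that defines the surface exists and is unique
    (∀ H δ : ℝ, (H, δ) ∈ RotationalCMC.params ε →
      ∃! x : ℝ → ℝ, RotationalCMC.IsProfile ε H δ x) ∧
    ∃ sT : ℝ × ℝ → ℝ,
      -- embedded free boundary annulus of constant mean curvature `H`
      (∀ H δ : ℝ, (H, δ) ∈ RotationalCMC.params ε →
        RotationalCMC.IsEmbeddedAnnulus (RotationalCMC.psi ε H δ) (sT (H, δ)) ∧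
        RotationalCMC.HasFreeBoundary ε (RotationalCMC.psi ε H δ) (sT (H, δ)) RotationalCMC.e4
          (ε * RotationalCMC.x4 ε H δ (sT (H, δ))) ∧
        0 < RotationalCMC.x4 ε H δ (sT (H, δ)) ∧
        ∃ η > 0, ∃ N : ℝ → ℝ → RotationalCMC.R4, ∃ κ : ℝ → ℝ,
          RotationalCMC.IsUnitNormal ε (RotationalCMC.psi ε H δ) N
            (Set.Ioo (-(sT (H, δ) + η)) (sT (H, δ) + η)) ∧
          (∀ s ∈ Set.Ioo (-(sT (H, δ) + η)) (sT (H, δ) + η), ∀ θ : ℝ,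
            RotationalCMC.meanCurvature ε (RotationalCMC.psi ε H δ) N s θ = H) ∧
          RotationalCMC.IsProfilePrincipalCurvature (RotationalCMC.psi ε H δ) N
            (Set.Ioo (-(sT (H, δ) + η)) (sT (H, δ) + η)) κ ∧
          StrictAntiOn κ (Set.Ico 0 (sT (H, δ) + η))) ∧
      -- analytic dependence, and continuous extension to the flat tori in `𝕊³`
      AnalyticOn ℝ sT (RotationalCMC.params ε) ∧
      (ε = 1 → ContinuousOn
        (fun p : ℝ × ℝ =>
          if p.2 = (p.1 + RotationalCMC.mu ε p.1) / 2 then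
            Real.pi / (2 * √(2 * RotationalCMC.mu ε p.1 * (p.1 + RotationalCMC.mu ε p.1)))
          else sT p)
        {p : ℝ × ℝ | 0 ≤ p.1 ∧ 0 < p.2 ∧ p.2 ≤ (p.1 + RotationalCMC.mu ε p.1) / 2}) ∧
      -- the intersection of the profile geodesics with the rotation axis
      ∀ H δ : ℝ, (H, δ) ∈ RotationalCMC.params ε →
        ∃ I : Set ℝ, IsOpen I ∧ sT (H, δ) ∈ I ∧ ∃ p : ℝ → RotationalCMC.R4,
          (∀ s ∈ I, RotationalCMC.IsAxisPoint ε H δ s (p s) ∧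
            ∀ q, RotationalCMC.IsAxisPoint ε H δ s q → q = p s) ∧
          AnalyticOnNhd ℝ p I ∧
          p (sT (H, δ)) 2 = 0 ∧
          0 < deriv (fun s => p s 2) (sT (H, δ)) := by

  refine ⟨fun H δ h => (RotationalCMC.admissible_disc hε h).existsUnique_isProfile
    (RotationalCMC.disc_pos hε h), RotationalCMC.freeBoundaryParam ε, fun H δ h => ?_,
    RotationalCMC.analyticOn_freeBoundaryParam hε, ?_, fun H δ h => ?_⟩
  · obtain ⟨R, hc⟩ := RotationalCMC.freeBoundaryParam_spec hε h
    refine ⟨RotationalCMC.isEmbeddedAnnulus_psi hε h R,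
      RotationalCMC.hasFreeBoundary_psi hε h R hc, ?_,
      RotationalCMC.exists_normal_of_inRegion hε h R⟩
    rw [RotationalCMC.x4_eq hε h]
    exact RotationalCMC.pos4_pos hε h R
  · rintro rfl
    exact RotationalCMC.continuousOn_extended_freeBoundaryParam
  · obtain ⟨R, hc⟩ := RotationalCMC.freeBoundaryParam_spec hε h
    exact RotationalCMC.exists_axisPoint_nhds hε h R hc
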